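/- Let $D\subseteq\mathbb C$ be invariant under $s\mapsto s\pm1$ (for example $\mathbb Z$, $\mathbb R$, $\mathbb C$), let $\Lambda f(s)=f(s+1)$ on functions of $s\in D$, and let all functions be formal power series in the times $\boldsymbol x=(x^{(1)}_k,x^{(2)}_k)_{k\ge1}$ whose coefficients are complex functions on $D$. Put $\Delta=\Lambda-1$, $\Delta^*=\Lambda^{-1}-1$; for a formal difference operator $A$ write $A_{\Delta,\ge1}$, $A_{\Delta,\le0}$ (resp. $A_{\Delta^*,\ge1}$, $A_{\Delta^*,\le0}$) for its parts of degree $\ge1$, $\le0$ in the expansion in powers of $\Delta$ (resp. $\Delta^*$), where $\Delta^{-1}=\sum_{k\ge1}\Lambda^{-k}$ and $\Delta^{*-1}=\sum_{k\ge1}\Lambda^{k}$. Let $W_1=\sum_{n\ge0}w^{(1)}_n\Lambda^{-n}$, $W_2=\sum_{n\ge0}w^{(2)}_n\Lambda^{n}$ (with $w^{(1)}_0,w^{(2)}_0$ invertible) be dressing operators of a solution of the modified Toda hierarchy: with $L_1=W_1\Lambda W_1^{-1}$, $L_2=W_2\Lambda^{-1}W_2^{-1}$, for all $k\ge1$, $$\partial_{x^{(1)}_k}W_1=-(L_1^k)_{\Delta,\le0}W_1,\quad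 \partial_{x^{(1)}_k}W_2=(L_1^k)_{\Delta,\ge1}W_2,\quad \partial_{x^{(2)}_k}W_1=(L_2^k)_{\Delta^*,\ge1}W_1,\quad \partial_{x^{(2)}_k}W_2=-(L_2^k)_{\Delta^*,\le0}W_2 .$$ Let $\tau_0,\tau_1$ be invertible tau functions of it, that is $$\sum_n w^{(1)}_nz^{-n}=\frac{G_1(z)\tau_0(s)}{\tau_1(s)},\quad \sum_n w^{(2)}_nz^{n}=\frac{G_2(z)\tau_0(s+1)}{\tau_1(s)},\quad G_1(z)=e^{-\sum_{k\ge1}\frac{z^{-k}}k\partial_{x^{(1)}_k}},\ G_2(z)=e^{-\sum_{k\ge1}\frac{z^{k}}k\partial_{x^{(2)}_k}} .$$ Put $M_1=W_1\bigl(s\Lambda^{-1}+\sum_{k\ge1} kx^{(1)}_k\Lambda^{k-1}\bigr)W_1^{-1}$ and $M_2=W_2\bigl(-s\Lambda+\sum_{k\ge1} kx^{(2)}_k\Lambda^{1-k}\bigr)W_2^{-1}$. For $m\ge0$, $l\in\mathbb Z$ the additional symmetries are the vector fields $$\partial_{s^{(1)}_{m,l}}W_1=-(M_1^mL_1^l)_{\Delta,\le0}W_1,\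 \ \partial_{s^{(1)}_{m,l}}W_2=(M_1^mL_1^l)_{\Delta,\ge1}W_2,\ \ \partial_{s^{(2)}_{m,l}}W_1=(M_2^mL_2^l)_{\Delta^*,\ge1}W_1,\ \ \partial_{s^{(2)}_{m,l}}W_2=-(M_2^mL_2^l)_{\Delta^*,\le0}W_2 .$$ Such a vector field $\partial$ is said to act on the tau functions by $\partial\tau_0=f_0$, $\partial\tau_1=f_1$ if applying $\partial$ as a derivation to the two relations between $W_1,W_2$ and $\tau_0,\tau_1$ yields identities. For $a=1,2$ let $p^{(a)}_k=\partial_{x^{(a)}_k}$, $p^{(a)}_{-k}=kx^{(a)}_k$ $(k\ge1)$, $p^{(a)}_0=0$, and let $$X_a(\lambda,\mu)=e^{\sum_k x^{(a)}_k(\mu^k-\lambda^k)}\,e^{\sum_k\frac{\lambda^{-k}-\mu^{-k}}{k}\partial_{x^{(a)}_k}},\qquad \mathbb X_1=(\mu/\lambda)^sX_1,\quad \mathbb X_2=(\lambda/\mu)^sX_2,$$ and define the operators $W^{(a)}_{s,l,m}$ by the formal expansion $$\mathbb X_a(\lambda,\mu)=\sum_{m\ge0}\frac{(\mu-\lambda)^m}{m!}\sum_{l\in\mathbb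 Z}\lambda^{-m-l}\,W^{(a)}_{s,l,m}.$$ Then for all $m\ge0$ and $l\in\mathbb Z$ the additional symmetries act on the tau functions by $$\partial_{s^{(1)}_{m,m+l}}\tau_0=\frac{W^{(1)}_{s,l,m+1}}{m+1}\tau_0,\quad \partial_{s^{(1)}_{m,m+l}}\tau_1=\frac{W^{(1)}_{s+1,l,m+1}}{m+1}\tau_1,\quad \partial_{s^{(2)}_{m,m+l}}\tau_0=\frac{W^{(2)}_{s-1,l,m+1}}{m+1}\tau_0,\quad \partial_{s^{(2)}_{m,m+l}}\tau_1=\frac{W^{(2)}_{s-1,l,m+1}}{m+1}\tau_1 ,$$ and for each symmetry this action is unique up to replacing $(\partial\tau_0,\partial\tau_1)$ by $(\partial\tau_0+c\,\tau_0,\ \partial\tau_1+c\,\tau_1)$, where $c$ is a function on $D$ that does not depend on $\boldsymbol x$ and satisfies $c(s+1)=c(s)$ (every such $c$ occurs). Moreover $W^{(a)}_{s,l,0}=\delta_{l,0}$, $W^{(1)}_{s,l,1}=p^{(1)}_l+s\,\delta_{l,0}$, $W^{(2)}_{s,l,1}=p^{(2)}_l-s\,\delta_{l,0}$, and $$W^{(1)}_{s,l,2}=\sum_{i+j=l}:p^{(1)}_ip^{(1)}_j:-(l-2s+1)p^{(1)}_l+s(s-1)\delta_{l,0},\qquad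 W^{(2)}_{s,l,2}=\sum_{i+j=l}:p^{(2)}_ip^{(2)}_j:-(l+2s+1)p^{(2)}_l+s(s+1)\delta_{l,0},$$ where the normal ordering $:\cdot:$ puts the $p^{(a)}_k$ with $k>0$ to the right. -/

import Mathlib

noncomputable section

namespace MToda

/-! ### Formal difference operators

For a commutative ring `A` and an automorphism `θ` of `A`, the ring of series
`∑_{n ≥ n₀} aₙ Tⁿ` with `aₙ ∈ A` and `T a = θ(a) T`.
If `A` consists of functions of `s` and `σ` is the shift `f(s) ↦ f(s+1)`, then `θ = σ`, `T = Λ`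
gives `A((Λ))`, and `θ = σ⁻¹`, `T = Λ⁻¹` gives `A((Λ⁻¹))`. -/

section Skew

variable {A : Type*} [CommRing A]

def Skew (_θ : RingAut A) : Type _ := HahnSeries ℤ A

namespace Skew

variable {θ η : RingAut A}

instance : AddCommGroup (Skew θ) := inferInstanceAs (AddCommGroup (HahnSeries ℤ A))

/-- The coefficient `aₙ` of `Tⁿ`. -/
def coeff (c : Skew θ) (n : ℤ) : A := HahnSeries.coeff c n

/-- The operator `a Tⁿ`. -/
def mono (θ : RingAut A) (n : ℤ) (a : A) : Skew θ := HahnSeries.single n a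

theorem ext {c d : Skew θ} (h : ∀ n, c.coeff n = d.coeff n) : c = d :=
  HahnSeries.ext (funext h)

theorem isPWO (c : Skew θ) : (Function.support c.coeff).IsPWO := HahnSeries.isPWO_support c

/-- `(∑ aᵢ Tⁱ)(∑ bⱼ Tʲ) = ∑ aᵢ θⁱ(bⱼ) Tⁱ⁺ʲ`. -/
instance : Mul (Skew θ) where
  mul c d :=
    { coeff := fun n => ∑ ij ∈ Finset.antidiagonal c.isPWO d.isPWO n,
        c.coeff ij.1 * (θ ^ ij.1) (d.coeff ij.2)
      isPWO_support' := by
        refine (c.isPWO.add d.isPWO).mono fun n hn => ?_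
        by_contra hcon
        apply hn
        refine Finset.sum_eq_zero fun ij hij => ?_
        rw [Finset.mem_antidiagonal] at hij
        exact (hcon ⟨_, hij.1, _, hij.2.1, hij.2.2⟩).elim }

instance : One (Skew θ) := ⟨mono θ 0 1⟩

theorem coeff_mul (c d : Skew θ) (n : ℤ) :
    (c * d).coeff n = ∑ ij ∈ Finset.antidiagonal c.isPWO d.isPWO n,
      c.coeff ij.1 * (θ ^ ij.1) (d.coeff ij.2) := rfl

/-- The term `a Tⁿ` as an additive endomorphism `f ↦ a θⁿ(f)` of `A`. -/
def act (θ : RingAut A) (n : ℤ) (a : A) : AddMonoid.End A :=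
  (AddMonoidHom.mulLeft a).comp (((θ ^ n : RingAut A) : A →+* A) : A →+ A)

theorem act_apply (n : ℤ) (a f : A) : act θ n a f = a * (θ ^ n) f := rfl

theorem act_zero (n : ℤ) : act θ n (0 : A) = 0 := by
  ext f
  simp [act_apply]

/-- The series of endomorphisms `aₙ Tⁿ`; it is used only to transport the ring axioms. -/
def emb (c : Skew θ) : HahnSeries ℤ (AddMonoid.End A) where
  coeff n := act θ n (c.coeff n)
  isPWO_support' := c.isPWO.mono fun n hn h0 => hn (by
    show act θ n (c.coeff n) = 0
    rw [h0, act_zero])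

theorem coeff_emb (c : Skew θ) (n : ℤ) : (emb c).coeff n = act θ n (c.coeff n) := rfl

theorem emb_injective : Function.Injective (emb (θ := θ)) := by
  intro c d h
  refine ext fun n => ?_
  have h1 := congrArg (fun x : AddMonoid.End A => x 1) (congrArg (fun x => HahnSeries.coeff x n) h)
  simpa [coeff_emb, act_apply] using h1

theorem emb_add (c d : Skew θ) : emb (c + d) = emb c + emb d := by
  ext n f
  show ((c.coeff n + d.coeff n) * (θ ^ n) f) = c.coeff n * (θ ^ n) f + d.coeff n * (θ ^ n) f
  ring

theorem emb_zero : emb (0 : Skew θ) = 0 := by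
  ext n f
  show (0 : A) * (θ ^ n) f = 0
  simp

theorem emb_one : emb (1 : Skew θ) = 1 := by
  ext n f
  show (HahnSeries.single (0 : ℤ) (1 : A)).coeff n * (θ ^ n) f
    = ((1 : HahnSeries ℤ (AddMonoid.End A)).coeff n) f
  rw [HahnSeries.coeff_single, HahnSeries.coeff_one]
  split_ifs with h
  · subst h
    simp
  · simp

theorem emb_mul (c d : Skew θ) : emb (c * d) = emb c * emb d := by
  ext n : 2
  have hc : (emb c).support ⊆ Function.support c.coeff := fun n hn h0 => hn (by
    rw [coeff_emb, h0, act_zero])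
  have hd : (emb d).support ⊆ Function.support d.coeff := fun n hn h0 => hn (by
    rw [coeff_emb, h0, act_zero])
  have key : (emb c * emb d).coeff n
      = ∑ ij ∈ Finset.antidiagonal c.isPWO d.isPWO n,
          (emb c).coeff ij.1 * (emb d).coeff ij.2 := by
    rw [HahnSeries.coeff_mul]
    refine Finset.sum_subset ?_ ?_
    · intro ij hij
      rw [Finset.mem_antidiagonal] at hij ⊢
      exact ⟨hc hij.1, hd hij.2.1, hij.2.2⟩
    · intro ij h1 h2
      rw [Finset.mem_antidiagonal] at h1 h2
      by_cases h3 : (emb c).coeff ij.1 = 0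
      · rw [h3, zero_mul]
      · by_cases h4 : (emb d).coeff ij.2 = 0
        · rw [h4, mul_zero]
        · exact (h2 ⟨h3, h4, h1.2.2⟩).elim
  rw [key]
  ext f
  rw [coeff_emb, act_apply, coeff_mul, Finset.sum_mul]
  refine Eq.trans ?_ (map_sum (AddMonoidHom.eval f : (A →+ A) →+ A) _ _).symm
  refine Finset.sum_congr rfl fun ij hij => ?_
  rw [Finset.mem_antidiagonal] at hij
  show _ = c.coeff ij.1 * (θ ^ ij.1) (d.coeff ij.2 * (θ ^ ij.2) f)
  rw [map_mul, ← hij.2.2, zpow_add, RingAut.mul_apply, mul_assoc]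

instance : Ring (Skew θ) :=
  { (inferInstance : AddCommGroup (Skew θ)),
    (inferInstance : Mul (Skew θ)),
    (inferInstance : One (Skew θ)) with
    left_distrib := fun a b c => emb_injective (by
      simp only [emb_add, emb_mul, mul_add])
    right_distrib := fun a b c => emb_injective (by
      simp only [emb_add, emb_mul, add_mul])
    zero_mul := fun a => emb_injective (by simp only [emb_mul, emb_zero, zero_mul])
    mul_zero := fun a => emb_injective (by simp only [emb_mul, emb_zero, mul_zero])
    mul_assoc := fun a b c => emb_injective (by simp only [emb_mul, mul_assoc])
    one_mul := fun a => emb_injective (by simp only [emb_mul, emb_one, one_mul])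
    mul_one := fun a => emb_injective (by simp only [emb_mul, emb_one, mul_one]) }

theorem mono_mul_mono (i j : ℤ) (a b : A) :
    mono θ i a * mono θ j b = mono θ (i + j) (a * (θ ^ i) b) := by
  have hsingle : ∀ (n : ℤ) (a : A), emb (mono θ n a) = HahnSeries.single n (act θ n a) := by
    intro n a
    ext k f
    show (HahnSeries.single n a).coeff k * (θ ^ k) f = _
    rw [HahnSeries.coeff_single, HahnSeries.coeff_single]
    split_ifs with h
    · subst h
      rfl
    · simp
  refine emb_injective ?_
  rw [emb_mul, hsingle, hsingle, hsingle, HahnSeries.single_mul_single]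
  congr 1
  ext f
  show a * (θ ^ i) (b * (θ ^ j) f) = a * (θ ^ i) b * (θ ^ (i + j)) f
  rw [map_mul, zpow_add, RingAut.mul_apply, mul_assoc]

/-- `T` as an invertible operator. -/
def T (θ : RingAut A) : (Skew θ)ˣ where
  val := mono θ 1 1
  inv := mono θ (-1) 1
  val_inv := by
    rw [mono_mul_mono]
    simp
    rfl
  inv_val := by
    rw [mono_mul_mono]
    simp
    rfl

/-- The projection `c ↦ ∑_{n ≥ 1} c₋ₙ (T⁻ⁿ - 1)`; only finitely many `c₋ₙ` with `n ≥ 1` are nonzero.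
If `D = T⁻¹ - 1`, the negative powers of `T⁻¹ = 1 + D` expand in negative powers of `D`. So the part
of `c` of nonnegative degree in `D` is `∑_{n ≥ 0} c₋ₙ T⁻ⁿ`, and its part of degree zero in `D` is
`∑_{n ≥ 0} c₋ₙ`. The difference is the part of `c` of degree `≥ 1` in `D`.
For `T = Λ⁻¹` this is `c_{Δ,≥1}` with `Δ = Λ - 1`;
for `T = Λ` this is `c_{Δ*,≥1}` with `Δ* = Λ⁻¹ - 1`. -/
def geOne (c : Skew θ) : Skew θ :=
  ∑ᶠ n : ℕ, (mono θ (-((n : ℤ) + 1)) (c.coeff (-((n : ℤ) + 1)))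
    - mono θ 0 (c.coeff (-((n : ℤ) + 1))))

theorem finite_neg (c : Skew θ) : {n : ℕ | c.coeff (-((n : ℤ) + 1)) ≠ 0}.Finite := by
  by_contra hinf
  have hw := c.isPWO.isWF
  have hne : (Function.support c.coeff).Nonempty := by
    obtain ⟨n, hn⟩ := Set.Infinite.nonempty hinf
    exact ⟨_, hn⟩
  refine hinf ((Set.finite_Iic (-(hw.min hne)).toNat).subset fun n hn => ?_)
  have h1 : hw.min hne ≤ -((n : ℤ) + 1) := hw.min_le hne hn
  rw [Set.mem_Iic]
  omega

/-- The same finite operator `∑_{n ≥ 1} c₋ₙ (T⁻ⁿ - 1)`, viewed in the other ring of series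
`Skew η` with `η = θ⁻¹` (`A((Λ))` for `c ∈ A((Λ⁻¹))` and conversely), whose variable is `T⁻¹`. -/
def geOneOther (η : RingAut A) (c : Skew θ) : Skew η :=
  ∑ᶠ n : ℕ, (mono η ((n : ℤ) + 1) (c.coeff (-((n : ℤ) + 1)))
    - mono η 0 (c.coeff (-((n : ℤ) + 1))))

end Skew

end Skew

/-! ### Power series in the times -/

/-- The index set of the times: `Sum.inl k` stands for `x_k^{(1)}`, `Sum.inr k` for `x_k^{(2)}`. -/
abbrev Time : Type := ℕ+ ⊕ ℕ+

/-- Functions of `s` and of the times: formal power series in the times over functions of `s`. -/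
abbrev Fn (A : Type*) : Type _ := MvPowerSeries Time A

/-- Difference operators depending on the times: formal power series in the times whose
coefficients are series in `T`. -/
abbrev Op {A : Type*} [CommRing A] (θ : RingAut A) : Type _ := MvPowerSeries Time (Skew θ)

section General

variable {A : Type*} [CommRing A] {θ : RingAut A}

/-- The coefficient of `Tⁿ`, a function of `s` and of the times. -/
def symb (P : Op θ) (n : ℤ) : Fn A := fun α => (MvPowerSeries.coeff α P).coeff n

/-- The partial derivative with respect to the time `i`. -/
def dOp (i : Time) (P : Op θ) : Op θ :=
  fun α => (α i + 1) • MvPowerSeries.coeff (α + Finsupp.single i 1) P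

/-- `P_{Δ,≥1}` for `T = Λ⁻¹` and `P_{Δ*,≥1}` for `T = Λ`. -/
def geOne (P : Op θ) : Op θ := fun α => (MvPowerSeries.coeff α P).geOne

/-- The same operator `P_{Δ,≥1}` or `P_{Δ*,≥1}`, to be composed with the other dressing operator;
`η = θ⁻¹`. -/
def geOneOther (η : RingAut A) (P : Op θ) : Op η :=
  fun α => (MvPowerSeries.coeff α P).geOneOther η

/-- `P_{Δ,≤0}` for `T = Λ⁻¹` and `P_{Δ*,≤0}` for `T = Λ`. -/
def leZero (P : Op θ) : Op θ := P - geOne P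

/-- The Lax operator `W T⁻¹ W⁻¹`, that is `L₁ = W₁ Λ W₁⁻¹` for `T = Λ⁻¹` and
`L₂ = W₂ Λ⁻¹ W₂⁻¹` for `T = Λ`. -/
def lax (W : (Op θ)ˣ) : (Op θ)ˣ :=
  W * Units.map (MvPowerSeries.C (σ := Time) (R := Skew θ)).toMonoidHom (Skew.T θ)⁻¹ * W⁻¹

/-- `t T + ∑_{k ≥ 1} k x_k T^{1-k}` where `x_k` is the time with index `ι k`. -/
def bareOrlov (ι : ℕ+ → Time) (θ : RingAut A) (t : A) : Op θ := fun α =>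
  (if α = 0 then Skew.mono θ 1 t else 0)
    + ∑ᶠ k : ℕ+, if α = Finsupp.single (ι k) 1 then Skew.mono θ (1 - (k : ℤ)) ((k : ℕ) : A) else 0

/-- The Orlov--Schulman operator `W (t T + ∑_{k ≥ 1} k x_k T^{1-k}) W⁻¹`. -/
def orlov (ι : ℕ+ → Time) (t : A) (W : (Op θ)ˣ) : Op θ := W * bareOrlov ι θ t * ↑W⁻¹

/-- `M^m L^l`. -/
def orlovLax (ι : ℕ+ → Time) (t : A) (W : (Op θ)ˣ) (m : ℕ) (l : ℤ) : Op θ :=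
  orlov ι t W ^ m * ((lax W ^ l : (Op θ)ˣ) : Op θ)

/-! ### Vertex operators -/

/-- The coefficient of `zⁿ` in `exp (∑_{k ≥ 1} y_k z^k)`; since the exponent has no constant term,
its powers of order greater than `n` do not contribute. -/
def expCoeff {R : Type*} [Ring R] [Algebra ℂ R] (y : ℕ+ → R) (n : ℕ) : R :=
  ∑ r ∈ Finset.range (n + 1), ((r.factorial : ℂ)⁻¹) •
    PowerSeries.coeff n ((PowerSeries.mk fun k => if h : 0 < k then y ⟨k, h⟩ else 0) ^ r)

/-- The derivative with respect to the time `i`, as an operator on functions. -/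
def dFn (A : Type*) [CommRing A] (i : Time) : Module.End A (Fn A) :=
  (MvPowerSeries.pderiv A i).toLinearMap

/-- The multiplication by the time `i`, as an operator on functions. -/
def xFn (A : Type*) [CommRing A] (i : Time) : Module.End A (Fn A) :=
  LinearMap.mulLeft A (MvPowerSeries.X i : Fn A)

/-- The mode `p_k`: `∂_{x_k}` for `k > 0`, multiplication by `(-k) x_{-k}` for `k < 0`,
and `p_0 = 0`. -/
def mode (A : Type*) [CommRing A] (ι : ℕ+ → Time) (k : ℤ) : Module.End A (Fn A) :=
  if h : 0 < k then dFn A (ι ⟨k.toNat, by omega⟩)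
  else if h : k < 0 then (-k) • xFn A (ι ⟨(-k).toNat, by omega⟩)
  else 0

/-- The normally ordered product `:p_i p_j:`, with the larger index to the right. -/
def normalPair (A : Type*) [CommRing A] (ι : ℕ+ → Time) (i j : ℤ) : Module.End A (Fn A) :=
  mode A ι (min i j) * mode A ι (max i j)

/-- The sum of a family of power series, coefficient by coefficient; it is used for families in
which every coefficient vanishes for all but finitely many members. -/
def coeffSum {I : Type*} (F : I → Fn A) : Fn A :=
  fun α => ∑ᶠ i : I, MvPowerSeries.coeff α (F i)

/-! ### Finiteness of the coefficientwise sums -/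

/-- The weight of a monomial, with `x_k^{(1)}` and `x_k^{(2)}` of weight `k`. -/
def wt : (Time →₀ ℕ) →+ ℕ :=
  Finsupp.weight (Sum.elim (fun k : ℕ+ => (k : ℕ)) fun k : ℕ+ => (k : ℕ))

/-- The operator `B` raises the lowest weight of a power series by at least `n`. -/
def Raises (B : Module.End A (Fn A)) (n : ℕ) : Prop :=
  ∀ (f : Fn A) (w : ℕ), (∀ γ, wt γ < w → MvPowerSeries.coeff γ f = 0) →
    ∀ γ, wt γ < w + n → MvPowerSeries.coeff γ (B f) = 0

theorem Raises.mul {B C : Module.End A (Fn A)} {n k : ℕ} (hB : Raises B n) (hC : Raises C k) :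
    Raises (B * C) (n + k) := fun f w hf γ hγ =>
  hB (C f) (w + k) (hC f w hf) γ (by omega)

theorem Raises.one : Raises (1 : Module.End A (Fn A)) 0 := fun f w hf γ hγ => hf γ (by omega)

theorem Raises.sum {I : Type*} {S : Finset I} {B : I → Module.End A (Fn A)} {n : ℕ}
    (hB : ∀ i ∈ S, Raises (B i) n) : Raises (∑ i ∈ S, B i) n := fun f w hf γ hγ => by
  rw [LinearMap.sum_apply, map_sum]
  exact Finset.sum_eq_zero fun i hi => hB i hi f w hf γ hγ

theorem Raises.coeff_eq_zero {B : Module.End A (Fn A)} {n : ℕ} (hB : Raises B n) (f : Fn A)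
    (γ : Time →₀ ℕ) (hγ : wt γ < n) : MvPowerSeries.coeff γ (B f) = 0 :=
  hB f 0 (fun γ h => (Nat.not_lt_zero _ h).elim) γ (by omega)

theorem Raises.xFn {ι : ℕ+ → Time} (hι : ∀ k, wt (Finsupp.single (ι k) 1) = k) (k : ℕ+) :
    Raises (xFn A (ι k)) k := fun f w hf γ hγ => by
  show MvPowerSeries.coeff γ (MvPowerSeries.X (ι k) * f) = 0
  rw [MvPowerSeries.coeff_mul]
  refine Finset.sum_eq_zero fun p hp => ?_
  rw [Finset.HasAntidiagonal.mem_antidiagonal] at hp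
  rw [MvPowerSeries.coeff_X]
  split_ifs with h
  · rw [hf, mul_zero]
    have h1 : wt γ = wt p.1 + wt p.2 := by rw [← hp, map_add]
    rw [h, hι k] at h1
    omega
  · rw [zero_mul]

theorem wt_inl (k : ℕ+) : wt (Finsupp.single (Sum.inl k) 1) = k := by
  rw [wt, Finsupp.weight_apply, Finsupp.sum_single_index] <;> simp

theorem wt_inr (k : ℕ+) : wt (Finsupp.single (Sum.inr k) 1) = k := by
  rw [wt, Finsupp.weight_apply, Finsupp.sum_single_index] <;> simp

variable [Algebra ℂ A]

/-- The coefficient of `wⁿ` in `exp (- ∑_{k ≥ 1} w^k ∂_k / k)`: for `w = z⁻¹` and the first set of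
times the series is `G₁(z)`, for `w = z` and the second set of times it is `G₂(z)`. -/
def gCoeff (ι : ℕ+ → Time) (n : ℕ) : Module.End A (Fn A) :=
  expCoeff (fun k => -(((k : ℕ) : ℂ)⁻¹ • dFn A (ι k))) n

/-- The coefficient of `μ^a λ^b λ^{-c} μ^{-d}` in the vertex operator
`e^{ξ(x,μ)} e^{-ξ(x,λ)} e^{ξ(∂~,λ⁻¹)} e^{-ξ(∂~,μ⁻¹)}`, where `ξ(y,z) = ∑_{k ≥ 1} y_k z^k` and
`∂~ = (∂_1, ∂_2/2, ∂_3/3, …)`. -/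
def vertexTerm (ι : ℕ+ → Time) (a b c d : ℕ) : Module.End A (Fn A) :=
  expCoeff (fun k => xFn A (ι k)) a * expCoeff (fun k => -xFn A (ι k)) b
    * expCoeff (fun k => ((k : ℕ) : ℂ)⁻¹ • dFn A (ι k)) c
    * expCoeff (fun k => -(((k : ℕ) : ℂ)⁻¹ • dFn A (ι k))) d

/-- The coefficient of `μ^i λ^j` in `X(λ,μ) f`, where `X(λ,μ)` is the vertex operator. -/
def vertexCoeff (ι : ℕ+ → Time) (i j : ℤ) (f : Fn A) : Fn A :=
  coeffSum fun q : (ℕ × ℕ) × (ℕ × ℕ) =>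
    if (q.1.1 : ℤ) - q.2.2 = i ∧ (q.1.2 : ℤ) - q.2.1 = j then
      vertexTerm ι q.1.1 q.1.2 q.2.1 q.2.2 f
    else 0

/-- The operators `w_{t,l,m}` in the expansion
`(μ/λ)^t X(λ,μ) = ∑_{m ≥ 0} (μ-λ)^m / m! ∑_{l ∈ ℤ} λ^{-m-l} w_{t,l,m}`. Here
`(μ/λ)^t X(λ,μ) = ∑_{i,j} μ^{t+i} λ^{j-t} X_{i,j}`, and `w_{t,l,m}` is the coefficient of `λ^{-m-l}`
in the `m`-th derivative with respect to `μ` at `μ = λ`. -/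
def wOp (ι : ℕ+ → Time) (t : A) (l : ℤ) (m : ℕ) (f : Fn A) : Fn A :=
  coeffSum fun i : ℤ =>
    (∏ r ∈ Finset.range m, (t + (i : A) - (r : A))) • vertexCoeff ι i (-l - i) f

/-- `W^{(1)}_{t,l,m}`, from the expansion of `(μ/λ)^t X₁(λ,μ)`. -/
def W1 (t : A) (l : ℤ) (m : ℕ) (f : Fn A) : Fn A := wOp Sum.inl t l m f

/-- `W^{(2)}_{t,l,m}`, from the expansion of `(λ/μ)^t X₂(λ,μ)`. -/
def W2 (t : A) (l : ℤ) (m : ℕ) (f : Fn A) : Fn A := wOp Sum.inr (-t) l m f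

theorem Raises.smul {B : Module.End A (Fn A)} {n : ℕ} (z : ℂ) (hB : Raises B n) :
    Raises (z • B) n := fun f w hf γ hγ => by
  have h1 : (z • B) f = (algebraMap ℂ A z) • B f := by
    rw [LinearMap.smul_apply, algebraMap_smul]
  rw [h1, MvPowerSeries.coeff_smul, hB f w hf γ hγ, mul_zero]

theorem Raises.expCoeff {y : ℕ+ → Module.End A (Fn A)} (hy : ∀ k, Raises (y k) k) (n : ℕ) :
    Raises (expCoeff y n) n := by
  refine Raises.sum fun r hr => Raises.smul _ ?_
  clear hr
  induction r generalizing n with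
  | zero =>
    rw [pow_zero, PowerSeries.coeff_one]
    split_ifs with h
    · subst h
      exact Raises.one
    · intro f w hf γ hγ
      simp
  | succ r ih =>
    rw [pow_succ, PowerSeries.coeff_mul]
    refine Raises.sum fun p hp => ?_
    rw [Finset.HasAntidiagonal.mem_antidiagonal] at hp
    rw [← hp]
    refine Raises.mul (ih p.1) ?_
    rw [PowerSeries.coeff_mk]
    split_ifs with h
    · exact hy ⟨p.2, h⟩
    · intro f w hf γ hγ
      simp

theorem vertexTerm_eq_zero {ι : ℕ+ → Time} (hι : ∀ k, wt (Finsupp.single (ι k) 1) = k)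
    (a b c d : ℕ) (f : Fn A) (γ : Time →₀ ℕ) (h : wt γ < a + b) :
    MvPowerSeries.coeff γ (vertexTerm ι a b c d f) = 0 := by
  have h1 : Raises (expCoeff (fun k => MToda.xFn A (ι k)) a
      * expCoeff (fun k => -MToda.xFn A (ι k)) b) (a + b) := by
    refine Raises.mul (Raises.expCoeff (fun k => Raises.xFn hι k) a)
      (Raises.expCoeff (fun k => ?_) b)
    intro f w hf γ hγ
    rw [LinearMap.neg_apply, map_neg, Raises.xFn hι k f w hf γ hγ, neg_zero]
  exact h1.coeff_eq_zero _ γ h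

theorem finite_vertexCoeff {ι : ℕ+ → Time} (hι : ∀ k, wt (Finsupp.single (ι k) 1) = k)
    (i j : ℤ) (f : Fn A) (γ : Time →₀ ℕ) :
    (Function.support fun q : (ℕ × ℕ) × (ℕ × ℕ) => MvPowerSeries.coeff γ
      (if (q.1.1 : ℤ) - q.2.2 = i ∧ (q.1.2 : ℤ) - q.2.1 = j then
        vertexTerm ι q.1.1 q.1.2 q.2.1 q.2.2 f else 0)).Finite := by
  refine (((Set.finite_Iic (wt γ)).prod (Set.finite_Iic (wt γ))).prod
    ((Set.finite_Iic (wt γ + j.natAbs)).prod (Set.finite_Iic (wt γ + i.natAbs)))).subset ?_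
  rintro ⟨⟨a, b⟩, c, d⟩ hq
  simp only [Function.mem_support] at hq
  split_ifs at hq with h
  · have h1 : a + b ≤ wt γ := by
      by_contra hlt
      exact hq (vertexTerm_eq_zero hι a b c d f γ (by omega))
    simp only [Set.mem_prod, Set.mem_Iic]
    omega
  · simp at hq

theorem finite_wOp {ι : ℕ+ → Time} (hι : ∀ k, wt (Finsupp.single (ι k) 1) = k)
    (t : A) (l : ℤ) (m : ℕ) (f : Fn A) (γ : Time →₀ ℕ) :
    (Function.support fun i : ℤ => MvPowerSeries.coeff γ
      ((∏ r ∈ Finset.range m, (t + (i : A) - (r : A))) • vertexCoeff ι i (-l - i) f)).Finite := by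
  refine (Set.finite_Icc (-l - wt γ) (wt γ : ℤ)).subset fun i hi => ?_
  by_contra hcon
  apply hi
  show MvPowerSeries.coeff γ (_ • _) = 0
  rw [MvPowerSeries.coeff_smul]
  have h0 : MvPowerSeries.coeff γ (vertexCoeff ι i (-l - i) f) = 0 := by
    refine finsum_eq_zero_of_forall_eq_zero fun q => ?_
    dsimp only
    split_ifs with h
    · refine vertexTerm_eq_zero hι _ _ _ _ f γ ?_
      rw [Set.mem_Icc] at hcon
      omega
    · simp
  rw [h0, mul_zero]

/-! ### The modified Toda hierarchy -/

/-- `W₁ = ∑_{n ≥ 0} w_n^{(1)} Λ⁻ⁿ` and `W₂ = ∑_{n ≥ 0} w_n^{(2)} Λⁿ`, with invertible leading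
coefficients, are the dressing operators of a solution of the modified Toda hierarchy over the
functions of `s` with shift `σ`. -/
structure IsDressing (σ : RingAut A) (W₁ : (Op σ⁻¹)ˣ) (W₂ : (Op σ)ˣ) : Prop where
  form₁ : ∀ n : ℤ, n < 0 → symb (W₁ : Op σ⁻¹) n = 0
  form₂ : ∀ n : ℤ, n < 0 → symb (W₂ : Op σ) n = 0
  lead₁ : IsUnit (symb (W₁ : Op σ⁻¹) 0)
  lead₂ : IsUnit (symb (W₂ : Op σ) 0)
  flow₁₁ : ∀ k : ℕ+, dOp (Sum.inl k) (W₁ : Op σ⁻¹)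
    = -leZero ((lax W₁ : Op σ⁻¹) ^ (k : ℕ)) * W₁
  flow₁₂ : ∀ k : ℕ+, dOp (Sum.inl k) (W₂ : Op σ)
    = geOneOther σ ((lax W₁ : Op σ⁻¹) ^ (k : ℕ)) * W₂
  flow₂₁ : ∀ k : ℕ+, dOp (Sum.inr k) (W₁ : Op σ⁻¹)
    = geOneOther σ⁻¹ ((lax W₂ : Op σ) ^ (k : ℕ)) * W₁
  flow₂₂ : ∀ k : ℕ+, dOp (Sum.inr k) (W₂ : Op σ)
    = -leZero ((lax W₂ : Op σ) ^ (k : ℕ)) * W₂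

/-- The shift `f(s, x) ↦ f(s+1, x)`. -/
def shiftFn (σ : RingAut A) (f : Fn A) : Fn A := MvPowerSeries.map (σ : A →+* A) f

/-- `τ₀, τ₁` are tau functions of the solution with dressing operators `W₁, W₂`:
the wave functions `ψ_a = W_a e^{ξ} (z^s)` satisfy `ψ₁ = (G₁(z)τ₀(s)) / τ₁(s) z^s e^{ξ(x⁽¹⁾,z)}` and
`ψ₂ = (G₂(z)τ₀(s+1)) / τ₁(s) z^s e^{ξ(x⁽²⁾,1/z)}`. As `Λⁿ(z^s) = zⁿ z^s`, this is the equality of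
the coefficients of `z⁻ⁿ`, respectively of `zⁿ`, after division by the exponential and `z^s`. -/
structure IsTau (σ : RingAut A) (W₁ : Op σ⁻¹) (W₂ : Op σ) (τ₀ τ₁ : Fn A) : Prop where
  unit₀ : IsUnit τ₀
  unit₁ : IsUnit τ₁
  wave₁ : ∀ n : ℕ, symb W₁ n * τ₁ = gCoeff Sum.inl n τ₀
  wave₂ : ∀ n : ℕ, symb W₂ n * τ₁ = gCoeff Sum.inr n (shiftFn σ τ₀)

/-- The vector field `∂ W₁ = V₁`, `∂ W₂ = V₂` on dressing operators acts on the tau functions by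
`∂ τ₀ = f₀`, `∂ τ₁ = f₁`: applying the derivation `∂` to `w_n^{(1)} τ₁ = (coefficient of G₁ τ₀)` and
to `w_n^{(2)} τ₁ = (coefficient of G₂ τ₀(s+1))` gives identities. -/
structure ActsOnTau (σ : RingAut A) (W₁ : Op σ⁻¹) (W₂ : Op σ) (τ₁ : Fn A)
    (V₁ : Op σ⁻¹) (V₂ : Op σ) (f₀ f₁ : Fn A) : Prop where
  wave₁ : ∀ n : ℕ, symb V₁ n * τ₁ + symb W₁ n * f₁ = gCoeff Sum.inl n f₀
  wave₂ : ∀ n : ℕ, symb V₂ n * τ₁ + symb W₂ n * f₁ = gCoeff Sum.inr n (shiftFn σ f₀)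

/-- The additional symmetry `∂ = ∂_{s^{(1)}_{m,l}}` (`s` is the coordinate function):
`∂ W₁ = -(M₁^m L₁^l)_{Δ,≤0} W₁`, `∂ W₂ = (M₁^m L₁^l)_{Δ,≥1} W₂`, and its action on tau functions. -/
def AddSymm1 (σ : RingAut A) (s : A) (W₁ : (Op σ⁻¹)ˣ) (W₂ : (Op σ)ˣ) (τ₁ : Fn A)
    (m : ℕ) (l : ℤ) (f₀ f₁ : Fn A) : Prop :=
  ActsOnTau σ (W₁ : Op σ⁻¹) (W₂ : Op σ) τ₁
    (-leZero (orlovLax Sum.inl s W₁ m l) * W₁)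
    (geOneOther σ (orlovLax Sum.inl s W₁ m l) * W₂) f₀ f₁

/-- The additional symmetry `∂ = ∂_{s^{(2)}_{m,l}}` (`s` is the coordinate function):
`∂ W₁ = (M₂^m L₂^l)_{Δ*,≥1} W₁`, `∂ W₂ = -(M₂^m L₂^l)_{Δ*,≤0} W₂`, and its action on tau
functions. Here `M₂ = W₂ (-s Λ + ∑ k x_k^{(2)} Λ^{1-k}) W₂⁻¹`. -/
def AddSymm2 (σ : RingAut A) (s : A) (W₁ : (Op σ⁻¹)ˣ) (W₂ : (Op σ)ˣ) (τ₁ : Fn A)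
    (m : ℕ) (l : ℤ) (f₀ f₁ : Fn A) : Prop :=
  ActsOnTau σ (W₁ : Op σ⁻¹) (W₂ : Op σ) τ₁
    (geOneOther σ⁻¹ (orlovLax Sum.inr (-s) W₂ m l) * W₁)
    (-leZero (orlovLax Sum.inr (-s) W₂ m l) * W₂) f₀ f₁

end General

/-! ### Functions of `s` -/

/-- The shift `f(s) ↦ f(s+1)` on the complex functions on a set `D` of complex numbers that is
invariant under `s ↦ s ± 1`, such as `ℤ`, `ℝ` or `ℂ`. -/
def shift (D : Set ℂ) (hD : ∀ s : ℂ, s + 1 ∈ D ↔ s ∈ D) : RingAut (D → ℂ) where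
  toFun f := fun s => f ⟨s + 1, (hD s).2 s.2⟩
  invFun f := fun s => f ⟨s - 1, (hD (s - 1)).1 (by rw [sub_add_cancel]; exact s.2)⟩
  left_inv f := by
    funext s
    simp
  right_inv f := by
    funext s
    simp
  map_mul' _ _ := rfl
  map_add' _ _ := rfl

/-- The coordinate function `s`. -/
def coord (D : Set ℂ) : D → ℂ := fun p => (p : ℂ)

end MToda

/-! Both families of times are treated at once: `θ` is the automorphism with `T = Λ⁻¹` (first
family) or `T = Λ` (second family), and the parameter `s` of the general argument, with `θ s = s -
1`, stands for `s` or `-s`. Put ξ(x,z) = ∑ x_k z^k, Γ(z) = e^{ξ(x,z)} G(z) = ∑ z^j Γ_j (`waveOp`)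
and Ψ = W E, where E = exp(∑ x_k T⁻ᵏ) (`expOp`). That τ₀, τ₁ are tau functions means that τ₁ times
the coefficient of T⁻ʲ in Ψ is Γ_j τ₀ (`IsSolution.symb_wave`).

Two computations meet. On the operator side, E conjugates the bare Orlov operator to sT, so M^m
L^{m+l} Ψ = Ψ · (s)_m T⁻ˡ with (s)_m the falling factorial (`orlovLax_mul`). On the vertex side,
X(λ,μ) Γ(z) - (λ/μ) Γ(z) X(λ,μ) = (1 - λ/μ) δ(λ/z) Γ(μ) (`vOp_waveOp`). The factor λ/μ is a shift of
the exponent t in (μ/λ)^t, and expanding at μ = λ gives W_{t+1,l,m+1} Γ_j = Γ_j W_{t,l,m+1} + (m+1)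
(t+j-l)_m Γ_{j-l} (`wOp_waveOp`). For t = s, applied to τ₀, the last term is (m+1) τ₁ times the
coefficient of T⁻ʲ in M^m L^{m+l} Ψ.

It remains to split W_{s+1,l,m+1}(τ₁Ψ). Since W_{t,l,m} is a series of times on the left and
derivatives on the right (`wOp_succ`), and ∂_k Ψ = (L^k)_{≥1} Ψ, one has W_{s+1,l,m+1}(τ₁Ψ) =
(W_{s+1,l,m+1} τ₁) Ψ + BΨ, where the difference operator B is a combination of terms a(Λⁿ - 1), n ≥
0 (`isDelta_wDelta`, `wOp_mul_symb`). Comparison with the commutation relation gives (B - (m+1) τ₁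
M^m L^{m+l}) W = N, where N contains the coefficients G_n(W_{s,l,m+1} τ₀) - w_n W_{s+1,l,m+1} τ₁ and
no negative powers of T. As W starts with an invertible coefficient, B and (m+1) τ₁ M^m L^{m+l} have
the same negative powers of T, and being divisible by Λ - 1 then forces B = (m+1) τ₁ (M^m
L^{m+l})_{≥1} (`IsSolution.exists_wDelta`). What remains is the identity for the symmetry on W. The
other dressing operator U satisfies ∂_k U = (L^k)_{≥1} U with the same operators, so the same B acts
on U and yields the second identity (`IsSolution.wave_wOp'`). To let one B act in both rings of
series, it is carried as a pair in `Skew θ × Skew η`.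

Uniqueness: two actions differ by (κτ₀, κτ₁) with G(κτ₀) = κ G τ₀ for both families, up to the shift
in the second. As G is multiplicative, G fixes κ, so all derivatives of κ vanish; the order-zero
relations make κ periodic.

The explicit formulas for m ≤ 2 come from X(λ,λ) = 1 (`locSum_vOp`) and a recursion in m, which is
Euler's identity for μ∂_μ X (`euler_vOp`).

All sums are infinite, and all interchanges rest on one topology: x_k has weight k, and a family is
summable if all but finitely many members vanish below any given weight (`Null`, `map_locSum`). -/

namespace MToda

open MvPowerSeries

/-! ### Locally finite sums of power series -/

section Series

variable {R S : Type*} [Ring R] [Ring S] {I J : Type*}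

/-- All monomials of weight less than `w` have coefficient zero. -/
def Van (w : ℤ) (f : MvPowerSeries Time R) : Prop := ∀ γ, (wt γ : ℤ) < w → coeff γ f = 0

/-- The map `φ` raises the lowest weight of a power series by at least `n`. -/
def Shifts (n : ℤ) (φ : MvPowerSeries Time R → MvPowerSeries Time S) : Prop :=
  ∀ w f, Van w f → Van (w + n) (φ f)

/-- The coefficientwise sum of a family of power series. -/
def locSum (F : I → MvPowerSeries Time R) : MvPowerSeries Time R := fun γ => ∑ᶠ i, coeff γ (F i)

/-- For each `w`, all but finitely many members of the family vanish below weight `w`. -/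
def Null (F : I → MvPowerSeries Time R) : Prop := ∀ w : ℕ, {i | ¬ Van w (F i)}.Finite

theorem coeff_locSum (F : I → MvPowerSeries Time R) (γ : Time →₀ ℕ) :
    coeff γ (locSum F) = ∑ᶠ i, coeff γ (F i) := rfl

theorem Van.mono {w v : ℤ} {f : MvPowerSeries Time R} (h : Van w f) (hv : v ≤ w) : Van v f :=
  fun γ hγ => h γ (by omega)

theorem van_of_nonpos {w : ℤ} (hw : w ≤ 0) (f : MvPowerSeries Time R) : Van w f :=
  fun γ hγ => by omega

theorem van_zero (w : ℤ) : Van w (0 : MvPowerSeries Time R) := fun γ _ => by simp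

theorem Van.add {w : ℤ} {f g : MvPowerSeries Time R} (hf : Van w f) (hg : Van w g) :
    Van w (f + g) := fun γ hγ => by rw [map_add, hf γ hγ, hg γ hγ, add_zero]

theorem Van.neg {w : ℤ} {f : MvPowerSeries Time R} (hf : Van w f) : Van w (-f) :=
  fun γ hγ => by rw [map_neg, hf γ hγ, neg_zero]

theorem Van.sub {w : ℤ} {f g : MvPowerSeries Time R} (hf : Van w f) (hg : Van w g) :
    Van w (f - g) := fun γ hγ => by rw [map_sub, hf γ hγ, hg γ hγ, sub_zero]

theorem Van.mul {w v : ℤ} {f g : MvPowerSeries Time R} (hf : Van w f) (hg : Van v g) :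
    Van (w + v) (f * g) := fun γ hγ => by
  classical
  rw [coeff_mul]
  refine Finset.sum_eq_zero fun p hp => ?_
  rw [Finset.HasAntidiagonal.mem_antidiagonal] at hp
  have h1 : wt γ = wt p.1 + wt p.2 := by rw [← hp, map_add]
  by_cases h : (wt p.1 : ℤ) < w
  · rw [hf _ h, zero_mul]
  · rw [hg _ (by omega), mul_zero]

theorem Van.mul_left {w : ℤ} {g : MvPowerSeries Time R} (hg : Van w g)
    (f : MvPowerSeries Time R) : Van w (f * g) := by
  simpa using (van_of_nonpos le_rfl f).mul hg

theorem Van.mul_right {w : ℤ} {g : MvPowerSeries Time R} (hg : Van w g)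
    (f : MvPowerSeries Time R) : Van w (g * f) := by
  simpa using hg.mul (van_of_nonpos le_rfl f)

theorem Van.zsmul {w : ℤ} {f : MvPowerSeries Time R} (hf : Van w f) (n : ℤ) : Van w (n • f) :=
  fun γ hγ => by rw [map_zsmul, hf γ hγ, smul_zero]

theorem Van.nsmul {w : ℤ} {f : MvPowerSeries Time R} (hf : Van w f) (n : ℕ) : Van w (n • f) :=
  fun γ hγ => by rw [map_nsmul, hf γ hγ, smul_zero]

theorem van_X (τ : Time) : Van (wt (Finsupp.single τ 1)) (X τ : MvPowerSeries Time R) :=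
  fun γ hγ => by
    classical
    rw [coeff_X, if_neg]
    rintro rfl
    exact lt_irrefl _ hγ

theorem Van.locSum {w : ℤ} {F : I → MvPowerSeries Time R} (h : ∀ i, Van w (F i)) :
    Van w (locSum F) := fun γ hγ => by
  rw [coeff_locSum]
  exact finsum_eq_zero_of_forall_eq_zero fun i => h i γ hγ

theorem eq_of_van {f g : MvPowerSeries Time R} (h : ∀ w : ℕ, Van w (f - g)) : f = g := by
  ext γ
  have := h (wt γ + 1) γ (by push_cast; omega)
  rwa [map_sub, sub_eq_zero] at this

theorem Null.finite {F : I → MvPowerSeries Time R} (hF : Null F) (γ : Time →₀ ℕ) :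
    (Function.support fun i => coeff γ (F i)).Finite :=
  (hF (wt γ + 1)).subset fun _ hi hcon => hi (hcon γ (by push_cast; omega))

theorem Null.van_sub_sum {F : I → MvPowerSeries Time R} (hF : Null F) (w : ℕ) :
    Van w (locSum F - ∑ i ∈ (hF w).toFinset, F i) := fun γ hγ => by
  rw [map_sub, map_sum, coeff_locSum, sub_eq_zero]
  refine finsum_eq_sum_of_support_subset _ fun i hi => ?_
  rw [Set.Finite.coe_toFinset]
  exact fun hcon => hi (hcon γ hγ)

theorem Null.map {F : I → MvPowerSeries Time R} (hF : Null F) {n : ℤ}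
    {φ : MvPowerSeries Time R → MvPowerSeries Time S} (hφ : Shifts n φ) :
    Null fun i => φ (F i) := fun w =>
  (hF (w - n).toNat).subset fun i hi hcon => hi ((hφ _ _ hcon).mono (by omega))

/-- A map that moves weights by a bounded amount is continuous: below any weight both sides agree
with one finite sum, on which additivity suffices. -/
theorem map_locSum {Φ : Type*} [FunLike Φ (MvPowerSeries Time R) (MvPowerSeries Time S)]
    [AddMonoidHomClass Φ (MvPowerSeries Time R) (MvPowerSeries Time S)] (φ : Φ) {n : ℤ}
    (hφ : Shifts n φ) {F : I → MvPowerSeries Time R} (hF : Null F) :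
    φ (locSum F) = locSum fun i => φ (F i) := by
  refine eq_of_van fun w => ?_
  have h1 := hφ _ _ (hF.van_sub_sum (w - n).toNat)
  rw [map_sub, map_sum] at h1
  have h2 : Van w (locSum (fun i => φ (F i)) - ∑ i ∈ (hF (w - n).toNat).toFinset, φ (F i)) :=
    fun γ hγ => by
      rw [map_sub, map_sum, coeff_locSum, sub_eq_zero]
      refine finsum_eq_sum_of_support_subset _ fun i hi => ?_
      rw [Set.Finite.coe_toFinset]
      exact fun hcon => hi (hφ _ _ hcon γ (by omega))
  have h3 := (h1.mono (v := w) (by omega)).sub h2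
  rwa [sub_sub_sub_cancel_right] at h3

theorem Null.of_subset {F : I → MvPowerSeries Time R} (K : ℕ → Set I) (hK : ∀ w, (K w).Finite)
    (h : ∀ w i, i ∉ K w → Van (w : ℕ) (F i)) : Null F := fun w =>
  (hK w).subset fun i hi => by
    by_contra hcon
    exact hi (h w i hcon)

theorem Null.add {F G : I → MvPowerSeries Time R} (hF : Null F) (hG : Null G) :
    Null fun i => F i + G i := fun w =>
  ((hF w).union (hG w)).subset fun i hi => by
    by_contra hcon
    simp only [Set.mem_union, Set.mem_ofPred_eq, not_or, not_not] at hcon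
    exact hi (hcon.1.add hcon.2)

theorem Null.comp {F : J → MvPowerSeries Time R} (hF : Null F) {e : I → J}
    (he : Function.Injective e) : Null fun i => F (e i) := fun w =>
  (hF w).preimage he.injOn

theorem locSum_add {F G : I → MvPowerSeries Time R} (hF : Null F) (hG : Null G) :
    locSum (fun i => F i + G i) = locSum F + locSum G := by
  ext γ
  simp only [map_add, coeff_locSum]
  exact finsum_add_distrib (hF.finite γ) (hG.finite γ)

theorem locSum_sub {F G : I → MvPowerSeries Time R} (hF : Null F) (hG : Null G) :
    locSum (fun i => F i - G i) = locSum F - locSum G := by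
  ext γ
  simp only [map_sub, coeff_locSum]
  exact finsum_sub_distrib (hF.finite γ) (hG.finite γ)

theorem locSum_comp_equiv (e : I ≃ J) (F : J → MvPowerSeries Time R) :
    locSum (fun i => F (e i)) = locSum F := by
  ext γ
  exact finsum_comp_equiv e (f := fun j => coeff γ (F j))

theorem locSum_eq_single {F : I → MvPowerSeries Time R} (a : I) (h : ∀ i, i ≠ a → F i = 0) :
    locSum F = F a := by
  ext γ
  exact finsum_eq_single _ a fun i hi => by rw [h i hi, map_zero]

theorem locSum_zero : locSum (fun _ : I => (0 : MvPowerSeries Time R)) = 0 := by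
  ext γ
  simp [coeff_locSum]

theorem locSum_congr {F G : I → MvPowerSeries Time R} (h : ∀ i, F i = G i) :
    locSum F = locSum G := by
  rw [funext h]

/-- Summability over the product index reduces each coefficient to Fubini for a finitely supported
sum. -/
theorem locSum_comm {F : I → J → MvPowerSeries Time R} (hF : Null fun p : I × J => F p.1 p.2) :
    locSum (fun i => locSum fun j => F i j) = locSum fun j => locSum fun i => F i j := by
  ext γ
  have h1 := finsum_curry (fun p : I × J => coeff γ (F p.1 p.2)) (hF.finite γ)
  have h2 := finsum_curry (fun p : J × I => coeff γ (F p.2 p.1))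
    ((hF.comp Prod.swap_injective).finite γ)
  have h3 := finsum_comp_equiv (Equiv.prodComm I J) (f := fun p : J × I => coeff γ (F p.2 p.1))
  simp only [coeff_locSum]
  rw [← h1, ← h2, ← h3]
  rfl

theorem Null.locSum {F : I → J → MvPowerSeries Time R} (hF : Null fun p : I × J => F p.1 p.2) :
    Null fun i => locSum fun j => F i j := fun w =>
  ((hF w).image Prod.fst).subset fun i hi => by
    by_contra hcon
    refine hi (Van.locSum fun j => ?_)
    by_contra h
    exact hcon ⟨(i, j), h, rfl⟩

/-! ### Derivatives -/

/-- The partial derivative with respect to the time `i`. -/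
def der (i : Time) : MvPowerSeries Time R →+ MvPowerSeries Time R where
  toFun P := fun α => (α i + 1) • coeff (α + Finsupp.single i 1) P
  map_zero' := by
    ext α
    show (α i + 1) • coeff (α + Finsupp.single i 1) (0 : MvPowerSeries Time R) = 0
    simp
  map_add' P Q := by
    ext α
    show (α i + 1) • coeff (α + Finsupp.single i 1) (P + Q) = (α i + 1) • _ + (α i + 1) • _
    rw [map_add, smul_add]

theorem coeff_der (i : Time) (P : MvPowerSeries Time R) (α : Time →₀ ℕ) :
    coeff α (der i P) = (α i + 1) • coeff (α + Finsupp.single i 1) P := rfl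

/-- The terms with zero exponent of `i` drop out, and the others are obtained by adding one unit to
the first exponent. This is the reindexing behind Leibniz' rule. -/
theorem sum_antidiagonal_add_single (f : (Time →₀ ℕ) → (Time →₀ ℕ) → R) (i : Time)
    (α : Time →₀ ℕ) :
    ∑ p ∈ Finset.HasAntidiagonal.antidiagonal (α + Finsupp.single i 1),
        (p.1 : Time →₀ ℕ) i • f p.1 p.2
      = ∑ p ∈ Finset.HasAntidiagonal.antidiagonal α, (p.1 i + 1) • f (p.1 + Finsupp.single i 1) p.2 := by
  symm
  refine Finset.sum_of_injOn (fun p => (p.1 + Finsupp.single i 1, p.2)) ?_ ?_ ?_ ?_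
  · intro p _ q _ h
    simp only [Prod.mk.injEq, add_left_inj] at h
    exact Prod.ext h.1 h.2
  · intro p hp
    rw [Finset.mem_coe, Finset.HasAntidiagonal.mem_antidiagonal] at hp ⊢
    rw [← hp]
    exact add_right_comm _ _ _
  · intro p hp hcon
    rw [Finset.HasAntidiagonal.mem_antidiagonal] at hp
    by_cases h : p.1 i = 0
    · rw [h, zero_smul]
    · exfalso
      apply hcon
      have h1 : p.1 - Finsupp.single i 1 + Finsupp.single i 1 = p.1 :=
        tsub_add_cancel_of_le (Finsupp.single_le_iff.2 (Nat.one_le_iff_ne_zero.2 h))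
      refine ⟨(p.1 - Finsupp.single i 1, p.2), ?_, by simp only [h1]⟩
      rw [Finset.mem_coe, Finset.HasAntidiagonal.mem_antidiagonal]
      refine add_right_cancel (b := Finsupp.single i 1) ?_
      rw [← hp, add_right_comm, h1]
  · intro p _
    simp

/-- The coefficient ring need not commute here, since operators are also power series in the times.
The factor α_i + 1 is distributed as p_i + q_i over the pairs p + q = α + e_i. -/
theorem der_mul (i : Time) (P Q : MvPowerSeries Time R) :
    der i (P * Q) = der i P * Q + P * der i Q := by
  ext α
  have hswap : ∀ (β : Time →₀ ℕ) (f : (Time →₀ ℕ) × (Time →₀ ℕ) → R),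
      ∑ p ∈ Finset.HasAntidiagonal.antidiagonal β, f p.swap
        = ∑ p ∈ Finset.HasAntidiagonal.antidiagonal β, f p := fun β f =>
    Finset.sum_equiv (Equiv.prodComm _ _) (fun p => by
      simp [Finset.HasAntidiagonal.mem_antidiagonal, add_comm]) (fun p _ => rfl)
  have h1 := sum_antidiagonal_add_single (fun p q => coeff p P * coeff q Q) i α
  have h2 := sum_antidiagonal_add_single (fun p q => coeff q P * coeff p Q) i α
  rw [coeff_der, map_add, coeff_mul, coeff_mul, coeff_mul, Finset.smul_sum]
  rw [← hswap, ← hswap α] at h2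
  simp only [Prod.fst_swap, Prod.snd_swap] at h2
  have h3 : ∀ p ∈ Finset.HasAntidiagonal.antidiagonal (α + Finsupp.single i 1),
      (α i + 1) • (coeff p.1 P * coeff p.2 Q)
        = p.1 i • (coeff p.1 P * coeff p.2 Q) + p.2 i • (coeff p.1 P * coeff p.2 Q) := by
    intro p hp
    rw [Finset.HasAntidiagonal.mem_antidiagonal] at hp
    rw [← add_smul]
    congr 1
    have := DFunLike.congr_fun hp i
    simp at this
    omega
  rw [Finset.sum_congr rfl h3, Finset.sum_add_distrib, h1, h2]
  congr 1
  · refine Finset.sum_congr rfl fun p _ => ?_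
    rw [coeff_der, smul_mul_assoc]
  · refine Finset.sum_congr rfl fun p _ => ?_
    rw [coeff_der, mul_smul_comm]

theorem shifts_der (i : Time) :
    Shifts (-(wt (Finsupp.single i 1) : ℤ)) (der i : MvPowerSeries Time R →+ _) :=
  fun w f hf γ hγ => by
    rw [coeff_der, hf _ (by rw [map_add]; push_cast; omega), smul_zero]

theorem der_C (i : Time) (a : R) : der i (C a : MvPowerSeries Time R) = 0 := by
  classical
  ext α
  rw [coeff_der, coeff_C, if_neg, smul_zero, map_zero]
  intro h
  have := DFunLike.congr_fun h i
  simp at this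

theorem der_X (i j : Time) :
    der i (X j : MvPowerSeries Time R) = if i = j then 1 else 0 := by
  classical
  ext α
  rw [coeff_der, coeff_X]
  by_cases h : i = j
  · subst h
    rw [if_pos rfl, coeff_one]
    by_cases hα : α = 0
    · subst hα
      simp
    · rw [if_neg hα, if_neg, smul_zero]
      simpa using hα
  · rw [if_neg h, if_neg, smul_zero, map_zero]
    intro h1
    have := DFunLike.congr_fun h1 i
    rw [Finsupp.single_apply, if_neg (Ne.symm h)] at this
    simp at this

theorem Time.induction {P : (Time →₀ ℕ) → Prop} (h0 : P 0)
    (h1 : ∀ γ τ, P γ → P (γ + Finsupp.single τ 1)) (γ : Time →₀ ℕ) : P γ := by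
  induction γ using Finsupp.induction with
  | zero => exact h0
  | single_add a b f ha hb hf =>
    clear ha hb
    induction b with
    | zero => simpa using hf
    | succ n ih =>
      rw [Finsupp.single_add, add_right_comm]
      exact h1 _ _ ih

/-- A power series whose coefficients lie in a torsion-free group is determined by a linear system
of differential equations and its constant term. -/
theorem eq_zero_of_der [IsAddTorsionFree R] {P : MvPowerSeries Time R}
    (Q : Time → MvPowerSeries Time R) (h0 : coeff 0 P = 0) (hd : ∀ i, der i P = Q i * P) :
    P = 0 := by
  have key : ∀ n : ℕ, ∀ γ : Time →₀ ℕ, γ.degree ≤ n → coeff γ P = 0 := by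
    intro n
    induction n with
    | zero =>
      intro γ hγ
      rw [(Finsupp.degree_eq_zero_iff γ).1 (by omega)]
      exact h0
    | succ n ih =>
      intro γ hγ
      by_cases h : γ = 0
      · rw [h, h0]
      obtain ⟨i, hi⟩ := Finsupp.ne_iff.1 h
      have h1 : γ - Finsupp.single i 1 + Finsupp.single i 1 = γ :=
        tsub_add_cancel_of_le (Finsupp.single_le_iff.2 (Nat.one_le_iff_ne_zero.2 hi))
      have h2 := coeff_der i P (γ - Finsupp.single i 1)
      rw [h1, hd, coeff_mul] at h2
      have h3 : (γ - Finsupp.single i 1).degree + 1 = γ.degree := by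
        conv_rhs => rw [← h1, map_add, Finsupp.degree_single]
      -- The coefficient of P at γ is, up to a nonzero factor, a coefficient of `Q i * P` at γ -
      -- e_i, which involves only coefficients of P of lower degree.
      rw [Finset.sum_eq_zero] at h2
      · exact (smul_eq_zero.1 h2.symm).resolve_left (by omega)
      · intro p hp
        rw [Finset.HasAntidiagonal.mem_antidiagonal] at hp
        rw [ih p.2, mul_zero]
        have : p.1.degree + p.2.degree = (γ - Finsupp.single i 1).degree := by
          rw [← map_add, hp]
        omega
  ext γ
  exact key _ γ le_rfl

end Series

/-! ### Coefficients of exponentials -/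

section Exp

variable {R : Type*} [Ring R]

/-- The series `∑_{k ≥ 1} y_k z^k`. -/
def expArg (y : ℕ+ → R) : PowerSeries R :=
  PowerSeries.mk fun k => if h : 0 < k then y ⟨k, h⟩ else 0

theorem coeff_expArg_zero (y : ℕ+ → R) : PowerSeries.coeff 0 (expArg y) = 0 := by
  simp [expArg]

theorem coeff_expArg_succ (y : ℕ+ → R) (k : ℕ) :
    PowerSeries.coeff (k + 1) (expArg y) = y k.succPNat := by
  simp [expArg, Nat.succPNat]

theorem coeff_pow_expArg (y : ℕ+ → R) {n r : ℕ} (h : n < r) :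
    PowerSeries.coeff n (expArg y ^ r) = 0 := by
  induction r generalizing n with
  | zero => omega
  | succ r ih =>
    rw [pow_succ, PowerSeries.coeff_mul]
    refine Finset.sum_eq_zero fun p hp => ?_
    rw [Finset.HasAntidiagonal.mem_antidiagonal] at hp
    rcases Nat.eq_zero_or_pos p.2 with h0 | h0
    · rw [h0, coeff_expArg_zero, mul_zero]
    · rw [ih (by omega), zero_mul]

theorem commute_expArg {y : ℕ+ → R} {g : ℕ → R} (hg : ∀ j k, Commute (y j) (g k)) :
    Commute (expArg y) (PowerSeries.mk g) := by
  ext n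
  rw [PowerSeries.coeff_mul, PowerSeries.coeff_mul, ← Finset.Nat.sum_antidiagonal_swap]
  refine Finset.sum_congr rfl fun p _ => ?_
  rw [Prod.fst_swap, Prod.snd_swap, PowerSeries.coeff_mk]
  cases h : p.2 with
  | zero => rw [coeff_expArg_zero, zero_mul, mul_zero]
  | succ k => rw [coeff_expArg_succ, (hg _ _).eq]

variable [Algebra ℂ R]

theorem expCoeff_eq (y : ℕ+ → R) (n : ℕ) :
    expCoeff y n = ∑ r ∈ Finset.range (n + 1), ((r.factorial : ℂ)⁻¹) •
      PowerSeries.coeff n (expArg y ^ r) := rfl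

theorem expCoeff_zero (y : ℕ+ → R) : expCoeff y 0 = 1 := by
  simp [expCoeff]

theorem map_expCoeff {S : Type*} [Ring S] [Algebra ℂ S] (φ : R →ₐ[ℂ] S) (y : ℕ+ → R) (n : ℕ) :
    expCoeff (fun k => φ (y k)) n = φ (expCoeff y n) := by
  have h : expArg (fun k => φ (y k)) = PowerSeries.map (φ : R →+* S) (expArg y) := by
    ext k
    rw [PowerSeries.coeff_map]
    cases k with
    | zero => simp [coeff_expArg_zero]
    | succ k => simp [coeff_expArg_succ]
  rw [expCoeff_eq, expCoeff_eq, map_sum]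
  refine Finset.sum_congr rfl fun r _ => ?_
  rw [h, ← map_pow, PowerSeries.coeff_map, map_smul]
  rfl

/-- A graded derivation acts on the exponential of a commuting family by the chain rule. -/
theorem derivation_expCoeff {y : ℕ+ → R} (D : ℕ → R →ₗ[ℂ] R)
    (hD : ∀ i j a b, D (i + j) (a * b) = D i a * b + a * D j b)
    (hy : ∀ j k, Commute (y j) (D k (PowerSeries.coeff k (expArg y)))) (n : ℕ) :
    D n (expCoeff y n) = ∑ p ∈ Finset.HasAntidiagonal.antidiagonal n,
      expCoeff y p.1 * D p.2 (PowerSeries.coeff p.2 (expArg y)) := by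
  set Y := expArg y with hY
  set Y' : PowerSeries R := PowerSeries.mk fun k => D k (PowerSeries.coeff k Y) with hY'
  -- Commutation of Y with its derivative Y' gives D(Y^{r+1}) = (r+1) Y^r Y' without commutativity
  -- of the ring.
  have hcomm : Commute Y Y' := commute_expArg hy
  have hmul : ∀ (P Q : PowerSeries R) (n : ℕ), D n (PowerSeries.coeff n (P * Q))
      = PowerSeries.coeff n ((PowerSeries.mk fun k => D k (PowerSeries.coeff k P)) * Q)
        + PowerSeries.coeff n (P * PowerSeries.mk fun k => D k (PowerSeries.coeff k Q)) := by
    intro P Q n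
    simp only [PowerSeries.coeff_mul, PowerSeries.coeff_mk, map_sum]
    rw [← Finset.sum_add_distrib]
    refine Finset.sum_congr rfl fun p hp => ?_
    rw [Finset.HasAntidiagonal.mem_antidiagonal] at hp
    rw [← hp, hD]
  have hD1 : D 0 (1 : R) = 0 := by
    have := hD 0 0 1 1
    simpa using this
  have hpow : ∀ r : ℕ, (PowerSeries.mk fun k => D k (PowerSeries.coeff k (Y ^ (r + 1))))
      = (r + 1) • (Y ^ r * Y') := by
    intro r
    induction r with
    | zero => simp [hY']
    | succ r ih =>
      have h1 : (PowerSeries.mk fun k => D k (PowerSeries.coeff k (Y ^ (r + 1 + 1))))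
          = (PowerSeries.mk fun k => D k (PowerSeries.coeff k (Y ^ (r + 1)))) * Y
            + Y ^ (r + 1) * Y' := by
        ext k
        rw [PowerSeries.coeff_mk, pow_succ Y (r + 1), hmul, map_add]
      rw [h1, ih, smul_mul_assoc, mul_assoc, ← hcomm.eq, ← mul_assoc, ← pow_succ, ← succ_nsmul]
  have hsum : D n (expCoeff y n) = ∑ r ∈ Finset.range n, ((r.factorial : ℂ)⁻¹) •
      PowerSeries.coeff n (Y ^ r * Y') := by
    rw [expCoeff_eq, Finset.sum_range_succ', map_add, map_sum]
    have h0 : D n (((Nat.factorial 0 : ℂ)⁻¹) • PowerSeries.coeff n (expArg y ^ 0)) = 0 := by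
      rw [map_smul, pow_zero, PowerSeries.coeff_one]
      split_ifs with h
      · rw [h, hD1, smul_zero]
      · rw [map_zero, smul_zero]
    rw [h0, add_zero]
    refine Finset.sum_congr rfl fun r _ => ?_
    have h1 := congrArg (PowerSeries.coeff n) (hpow r)
    rw [PowerSeries.coeff_mk, map_nsmul] at h1
    rw [map_smul, ← hY, h1, ← Nat.cast_smul_eq_nsmul ℂ, smul_smul]
    congr 1
    rw [Nat.factorial_succ]
    push_cast
    have h2 : ((r : ℂ) + 1) ≠ 0 := Nat.cast_add_one_ne_zero r
    have h3 : (r.factorial : ℂ) ≠ 0 := Nat.cast_ne_zero.2 (Nat.factorial_ne_zero r)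
    field_simp
  rw [hsum]
  simp only [PowerSeries.coeff_mul, Finset.smul_sum]
  rw [Finset.sum_comm]
  refine Finset.sum_congr rfl fun p hp => ?_
  rw [Finset.HasAntidiagonal.mem_antidiagonal] at hp
  rw [hY', PowerSeries.coeff_mk]
  rcases Nat.eq_zero_or_pos p.2 with h0 | h0
  · rw [h0, hY, coeff_expArg_zero, map_zero, mul_zero]
    exact Finset.sum_eq_zero fun r _ => by rw [mul_zero, smul_zero]
  · rw [expCoeff_eq, Finset.sum_mul]
    symm
    -- Since `p.2 > 0`, the range for `expCoeff y p.1` lies inside `range n`. The extra exponents r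
    -- exceed `p.1`, and Y has no constant term, so Y^r does not reach degree `p.1`.
    refine Finset.sum_subset_zero_on_sdiff ?_ ?_ ?_
    · intro r hr
      rw [Finset.mem_range] at hr ⊢
      omega
    · intro r hr
      rw [Finset.mem_sdiff, Finset.mem_range, Finset.mem_range] at hr
      rw [hY, coeff_pow_expArg y (by omega), zero_mul, smul_zero]
    · intro r _
      rw [smul_mul_assoc]

/-- The coefficient of `zⁿ` in `exp (∑_{k ≥ 1} y_k z^k)`, for an integer `n`. -/
def expZ (y : ℕ+ → R) (n : ℤ) : R := if 0 ≤ n then expCoeff y n.toNat else 0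

theorem expZ_natCast (y : ℕ+ → R) (n : ℕ) : expZ y n = expCoeff y n := by
  simp [expZ]

theorem expZ_of_neg (y : ℕ+ → R) {n : ℤ} (h : n < 0) : expZ y n = 0 := by
  rw [expZ, if_neg (by omega)]

theorem expZ_zero (y : ℕ+ → R) : expZ y 0 = 1 := by
  have := expZ_natCast y 0
  rw [expCoeff_zero] at this
  exact_mod_cast this

theorem map_expZ {S : Type*} [Ring S] [Algebra ℂ S] (φ : R →ₐ[ℂ] S) (y : ℕ+ → R) (n : ℤ) :
    expZ (fun k => φ (y k)) n = φ (expZ y n) := by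
  unfold expZ
  split_ifs
  · exact map_expCoeff φ y _
  · rw [map_zero]

/-- The derivative of an exponential along a derivation that moves only one argument. -/
theorem derivation_expZ {y : ℕ+ → R} (δ : R →ₗ[ℂ] R)
    (hδ : ∀ a b, δ (a * b) = δ a * b + a * δ b) (r : ℕ+) (c : R)
    (hr : δ (y r) = c) (hr' : ∀ k, k ≠ r → δ (y k) = 0) (hc : ∀ k, Commute (y k) c) (n : ℤ) :
    δ (expZ y n) = expZ y (n - r) * c := by
  rcases lt_or_ge n 0 with h | h
  · rw [expZ_of_neg y h, expZ_of_neg y (by have := r.pos; omega), map_zero, zero_mul]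
  lift n to ℕ using h
  have hY : ∀ k, δ (PowerSeries.coeff k (expArg y)) = if k = r then c else 0 := by
    intro k
    cases k with
    | zero => rw [coeff_expArg_zero, map_zero, if_neg (ne_of_lt r.pos)]
    | succ k =>
      rw [coeff_expArg_succ]
      by_cases hk : k + 1 = r
      · rw [if_pos hk, ← hr]
        congr 2
        exact PNat.eq hk
      · rw [if_neg hk, hr']
        rintro rfl
        exact hk rfl
  rw [expZ_natCast, derivation_expCoeff (fun _ => δ) (fun _ _ => hδ) (fun j k => by
    rw [hY]
    split_ifs
    · exact hc j
    · exact Commute.zero_right _)]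
  simp only [hY]
  by_cases hn : (r : ℕ) ≤ n
  · rw [Finset.sum_eq_single (n - r, (r : ℕ))]
    · have h1 : ((n : ℤ) - r) = ((n - r : ℕ) : ℤ) := by push_cast [hn]; rfl
      rw [if_pos rfl, h1, expZ_natCast]
    · intro p hp hne
      rw [Finset.HasAntidiagonal.mem_antidiagonal] at hp
      rw [if_neg, mul_zero]
      intro h2
      exact hne (Prod.ext (by simp only; omega) h2)
    · intro h2
      rw [Finset.HasAntidiagonal.mem_antidiagonal] at h2
      omega
  · rw [expZ_of_neg y (by omega), zero_mul]
    refine Finset.sum_eq_zero fun p hp => ?_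
    rw [Finset.HasAntidiagonal.mem_antidiagonal] at hp
    rw [if_neg (by omega), mul_zero]

theorem derivation_expZ_eq_zero {y : ℕ+ → R} (δ : R →ₗ[ℂ] R)
    (hδ : ∀ a b, δ (a * b) = δ a * b + a * δ b) (h : ∀ k, δ (y k) = 0) (n : ℤ) :
    δ (expZ y n) = 0 := by
  rw [derivation_expZ δ hδ 1 0 (h 1) (fun k _ => h k) (fun k => Commute.zero_right _), mul_zero]

/-- The commutator with a fixed element. -/
def adL (a : R) : R →ₗ[ℂ] R := LinearMap.mulLeft ℂ a - LinearMap.mulRight ℂ a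

theorem adL_apply (a b : R) : adL a b = a * b - b * a := rfl

theorem adL_mul (a b c : R) : adL a (b * c) = adL a b * c + b * adL a c := by
  simp only [adL_apply]
  noncomm_ring

/-- The commutator with `a` is a derivation that kills every `y k`, hence kills the exponential. -/
theorem commute_expZ {y : ℕ+ → R} {a : R} (h : ∀ k, Commute a (y k)) (n : ℤ) :
    Commute a (expZ y n) :=
  sub_eq_zero.1 (derivation_expZ_eq_zero (adL a) (adL_mul a)
    (fun k => sub_eq_zero.2 (h k).eq) n)

theorem expZ_support_finite (y : ℕ+ → R) (n : ℤ) (f : ℕ+ → R) :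
    (Function.support fun k : ℕ+ => f k * expZ y (n - k)).Finite := by
  refine ((Set.finite_Iic (n.toNat)).preimage (PNat.coe_injective.injOn)).subset fun k hk => ?_
  rw [Set.mem_preimage, Set.mem_Iic]
  by_contra hcon
  exact hk (by dsimp only; rw [expZ_of_neg y (by omega), mul_zero])

/-- Euler's identity `n eₙ = ∑ k y_k eₙ₋ₖ` for `∑ eₙ zⁿ = exp (∑ y_k z^k)`. -/
theorem euler_expZ_natCast {y : ℕ+ → R} (hy : ∀ j k, Commute (y j) (y k)) (n : ℕ) :
    n • expZ y n
      = ∑ j ∈ Finset.range n, ((j + 1) • y j.succPNat) * expZ y ((n : ℤ) - (j + 1)) := by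
  -- The graded derivation is z d/dz, which multiplies degree k by k. It is the reason why
  -- `derivation_expCoeff` allows the map to depend on the degree.
  have hD := derivation_expCoeff (y := y) (fun k => (k : ℂ) • LinearMap.id)
    (fun i j a b => by
      simp only [LinearMap.smul_apply, LinearMap.id_apply, Nat.cast_add, add_smul, smul_mul_assoc,
        mul_smul_comm, LinearMap.add_apply])
    (fun j k => by
      rw [LinearMap.smul_apply, LinearMap.id_apply]
      refine Commute.smul_right ?_ _
      cases k with
      | zero => rw [coeff_expArg_zero]; exact Commute.zero_right _
      | succ k => rw [coeff_expArg_succ]; exact hy _ _) n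
  simp only [LinearMap.smul_apply, LinearMap.id_apply] at hD
  rw [expZ_natCast, ← Nat.cast_smul_eq_nsmul ℂ, hD, ← Finset.Nat.sum_antidiagonal_swap,
    Finset.Nat.sum_antidiagonal_eq_sum_range_succ_mk, Finset.sum_range_succ']
  rw [Prod.snd_swap, coeff_expArg_zero, smul_zero, mul_zero, add_zero]
  refine Finset.sum_congr rfl fun j hj => ?_
  rw [Finset.mem_range] at hj
  have h1 : ((n : ℤ) - (j + 1)) = ((n - (j + 1) : ℕ) : ℤ) := by omega
  simp only [Prod.fst_swap, Prod.snd_swap]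
  rw [h1, expZ_natCast, coeff_expArg_succ, Nat.cast_smul_eq_nsmul]
  have h2 : Commute (expCoeff y (n - (j + 1))) (y j.succPNat) := by
    have := commute_expZ (a := y j.succPNat) (fun k => hy _ k) ((n - (j + 1) : ℕ) : ℤ)
    rw [expZ_natCast] at this
    exact this.symm
  rw [mul_smul_comm, smul_mul_assoc, h2.eq]

theorem euler_expZ {y : ℕ+ → R} (hy : ∀ j k, Commute (y j) (y k)) (n : ℤ) :
    n • expZ y n = ∑ᶠ k : ℕ+, ((k : ℕ) • y k) * expZ y (n - k) := by
  rcases lt_or_ge n 0 with h | h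
  · rw [expZ_of_neg y h, smul_zero, finsum_eq_zero_of_forall_eq_zero]
    intro k
    rw [expZ_of_neg y (by have := k.pos; omega), mul_zero]
  lift n to ℕ using h
  have hs : (Function.support fun k : ℕ+ => ((k : ℕ) • y k) * expZ y ((n : ℤ) - k))
      ⊆ ((Finset.range n).map ⟨Nat.succPNat, Nat.succPNat_injective⟩ : Finset ℕ+) := by
    intro k hk
    rw [Finset.coe_map, Set.mem_image]
    refine ⟨k.natPred, ?_, PNat.succPNat_natPred k⟩
    rw [Finset.coe_range, Set.mem_Iio]
    by_contra hcon
    have h1 := PNat.natPred_add_one k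
    exact hk (by dsimp only; rw [expZ_of_neg y (by omega), mul_zero])
  rw [finsum_eq_sum_of_support_subset _ hs, Finset.sum_map, natCast_zsmul, euler_expZ_natCast hy]
  refine Finset.sum_congr rfl fun j _ => ?_
  simp [Nat.succPNat_coe]

/-- The coefficient of `zⁿ` in the exponential has degree `n` if `y_k` has degree `k`. -/
theorem expZ_graded {y : ℕ+ → R} (P : ℤ → R → Prop) (hzero : ∀ n, P n 0) (hone : P 0 1)
    (hadd : ∀ n a b, P n a → P n b → P n (a + b)) (hsmul : ∀ n (z : ℂ) a, P n a → P n (z • a))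
    (hmul : ∀ m n a b, P m a → P n b → P (m + n) (a * b)) (hy : ∀ k : ℕ+, P k (y k)) (n : ℤ) :
    P n (expZ y n) := by
  have hsum : ∀ (m : ℤ) {κ : Type} (s : Finset κ) (f : κ → R), (∀ i ∈ s, P m (f i)) →
      P m (∑ i ∈ s, f i) := by
    intro m κ s f h
    exact Finset.sum_induction _ (P m) (hadd m) (hzero m) h
  rcases lt_or_ge n 0 with h | h
  · rw [expZ_of_neg y h]
    exact hzero n
  lift n to ℕ using h
  rw [expZ_natCast, expCoeff_eq]
  refine hsum _ _ _ fun r hr => hsmul _ _ _ ?_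
  clear hr
  induction r generalizing n with
  | zero =>
    rw [pow_zero, PowerSeries.coeff_one]
    split_ifs with h
    · subst h
      exact hone
    · exact hzero _
  | succ r ih =>
    rw [pow_succ, PowerSeries.coeff_mul]
    refine hsum _ _ _ fun p hp => ?_
    rw [Finset.HasAntidiagonal.mem_antidiagonal] at hp
    rw [← hp, Nat.cast_add]
    refine hmul _ _ _ _ (ih p.1) ?_
    cases p.2 with
    | zero => rw [coeff_expArg_zero]; exact hzero _
    | succ k => rw [coeff_expArg_succ]; exact hy k.succPNat

end Exp

/-! ### Exponentials of times and of derivatives -/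

section Vertex

variable {A : Type*} [CommRing A]

theorem dFn_apply (i : Time) (f : Fn A) : dFn A i f = der i f := by
  ext α
  show coeff α (pderiv A i f) = _
  rw [coeff_pderiv, coeff_der, nsmul_eq_mul, mul_comm]
  push_cast
  rfl

theorem der_one (i : Time) : der i (1 : Fn A) = 0 := der_C i 1

theorem commute_dFn (i j : Time) : Commute (dFn A i) (dFn A j) := by
  ext f : 1
  show dFn A i (dFn A j f) = dFn A j (dFn A i f)
  simp only [dFn_apply]
  ext α
  simp only [coeff_der, smul_smul]
  rw [add_right_comm α]
  congr 1
  by_cases h : i = j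
  · subst h; rfl
  · simp [h, Ne.symm h, mul_comm]

variable [Algebra ℂ A]

theorem der_smul (i : Time) (z : ℂ) (f : Fn A) : der i (z • f) = z • der i f := by
  ext α
  rw [coeff_der]
  show (α i + 1) • (z • coeff _ f) = z • ((α i + 1) • coeff _ f)
  rw [smul_comm]

theorem coeff_csmul (γ : Time →₀ ℕ) (z : ℂ) (f : Fn A) : coeff γ (z • f) = z • coeff γ f := rfl

theorem Van.csmul {w : ℤ} {f : Fn A} (hf : Van w f) (z : ℂ) : Van w (z • f) := fun γ hγ => by
  rw [coeff_csmul, hf γ hγ, smul_zero]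

theorem Null.csmul {I : Type*} {F : I → Fn A} (hF : Null F) (z : ℂ) : Null fun i => z • F i :=
  fun w => (hF w).subset fun _ hi hcon => hi (hcon.csmul z)

theorem locSum_csmul {I : Type*} {F : I → Fn A} (hF : Null F) (z : ℂ) :
    locSum (fun i => z • F i) = z • locSum F := by
  ext γ
  rw [coeff_csmul, coeff_locSum, coeff_locSum, smul_finsum' z (hF.finite γ)]
  rfl

/-- The index map `ι` names times of weight `1, 2, 3, …`. -/
def IsTimes (ι : ℕ+ → Time) : Prop := ∀ k, wt (Finsupp.single (ι k) 1) = k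

variable {ι : ℕ+ → Time}

theorem IsTimes.injective (hι : IsTimes ι) : Function.Injective ι := fun j k h => by
  have h1 := hι j
  rw [h, hι k] at h1
  exact (PNat.eq h1).symm

theorem IsTimes.van_X {R : Type*} [Ring R] (hι : IsTimes ι) (k : ℕ+) :
    Van (k : ℤ) (X (ι k) : MvPowerSeries Time R) := by
  have h := MToda.van_X (R := R) (ι k)
  rwa [hι k] at h

theorem IsTimes.shifts_der {R : Type*} [Ring R] (hι : IsTimes ι) (k : ℕ+) :
    Shifts (-(k : ℤ)) (der (ι k) : MvPowerSeries Time R →+ _) := by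
  have h := MToda.shifts_der (R := R) (ι k)
  rwa [hι k] at h

/-- The coefficient of `zⁿ` in `exp (ε ∑ x_k z^k)`. -/
def expX (A : Type*) [CommRing A] [Algebra ℂ A] (ι : ℕ+ → Time) (ε : ℂ) (n : ℤ) : Fn A :=
  expZ (fun k => ε • (X (ι k) : Fn A)) n

/-- The coefficient of `zⁿ` in `exp (ε ∑ z^k ∂_k / k)`. -/
def expD (A : Type*) [CommRing A] [Algebra ℂ A] (ι : ℕ+ → Time) (ε : ℂ) (n : ℤ) :
    Module.End A (Fn A) :=
  expZ (fun k => (ε * ((k : ℕ) : ℂ)⁻¹) • dFn A (ι k)) n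

theorem expX_of_neg (ε : ℂ) {n : ℤ} (h : n < 0) : expX A ι ε n = 0 := expZ_of_neg _ h

theorem expX_zero (ε : ℂ) : expX A ι ε 0 = 1 := expZ_zero _

theorem expD_of_neg (ε : ℂ) {n : ℤ} (h : n < 0) : expD A ι ε n = 0 := expZ_of_neg _ h

theorem expD_zero (ε : ℂ) : expD A ι ε 0 = 1 := expZ_zero _

/-- The derivative with respect to the time `i` as a complex linear map. -/
def derL (A : Type*) [CommRing A] [Algebra ℂ A] (i : Time) : Fn A →ₗ[ℂ] Fn A where
  toFun := der i
  map_add' := map_add _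
  map_smul' := der_smul i

theorem derL_mul (i : Time) (f g : Fn A) :
    derL A i (f * g) = derL A i f * g + f * derL A i g := der_mul i f g

theorem der_expX (hι : IsTimes ι) (ε : ℂ) (r : ℕ+) (n : ℤ) :
    der (ι r) (expX A ι ε n) = ε • expX A ι ε (n - r) := by
  have h := derivation_expZ (y := fun k => ε • (X (ι k) : Fn A)) (derL A (ι r)) (derL_mul _) r
    (ε • 1) (by
      show der _ _ = _
      rw [der_smul, der_X, if_pos rfl]) (fun k hk => by
      show der _ _ = _
      rw [der_smul, der_X, if_neg (fun h => hk (hι.injective h).symm), smul_zero])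
    (fun k => Commute.all _ _) n
  rw [mul_smul_comm, mul_one] at h
  exact h

theorem der_expX_of_notMem {τ : Time} (hτ : τ ∉ Set.range ι) (ε : ℂ) (n : ℤ) :
    der τ (expX A ι ε n) = 0 :=
  derivation_expZ_eq_zero (derL A τ) (derL_mul _) (fun k => by
    show der _ _ = _
    rw [der_smul, der_X, if_neg (fun h => hτ ⟨k, h.symm⟩), smul_zero]) n

theorem van_expX (hι : IsTimes ι) (ε : ℂ) (n : ℤ) : Van n (expX A ι ε n) :=
  expZ_graded (fun n f => Van n f) (fun n => van_zero n) (van_of_nonpos le_rfl _)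
    (fun _ _ _ h1 h2 => h1.add h2) (fun _ z _ h => h.csmul z) (fun _ _ _ _ h1 h2 => h1.mul h2)
    (fun k => (hι.van_X k).csmul ε) n

theorem coeff_zero_expX (hι : IsTimes ι) (ε : ℂ) (n : ℤ) :
    coeff 0 (expX A ι ε n) = if n = 0 then 1 else 0 := by
  rcases lt_trichotomy n 0 with h | h | h
  · rw [expX_of_neg ε h, map_zero, if_neg h.ne]
  · subst h
    rw [expX_zero, coeff_zero_one, if_pos rfl]
  · rw [van_expX hι ε n 0 (by rw [map_zero]; exact_mod_cast h), if_neg h.ne']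

theorem commute_smul_dFn (ε ε' : ℂ) (i j : Time) :
    Commute (ε • dFn A i) (ε' • dFn A j) :=
  ((commute_dFn i j).smul_left ε).smul_right ε'

theorem expD_der (ε : ℂ) (n : ℤ) (i : Time) (f : Fn A) :
    expD A ι ε n (der i f) = der i (expD A ι ε n f) := by
  have h : Commute (dFn A i) (expD A ι ε n) :=
    commute_expZ (fun k => (commute_dFn i (ι k)).smul_right _) n
  have h1 := LinearMap.congr_fun h.eq f
  simp only [Module.End.mul_apply, dFn_apply] at h1
  exact h1.symm

theorem adL_xFn_dFn (i j : Time) :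
    adL (xFn A i) (dFn A j) = if j = i then -1 else 0 := by
  ext f : 1
  show X i * dFn A j f - dFn A j (X i * f) = _
  rw [dFn_apply, dFn_apply, der_mul, der_X]
  split_ifs
  · show _ = -f
    ring
  · show _ = (0 : Fn A)
    ring

/-- The commutator with x_r is a derivation that moves only the argument ∂_r, by a constant. So it
multiplies exp(ε ∑ z^k ∂_k / k) by a multiple of z^r. -/
theorem expD_X (hι : IsTimes ι) (ε : ℂ) (n : ℤ) (r : ℕ+) (f : Fn A) :
    expD A ι ε n (X (ι r) * f)
      = X (ι r) * expD A ι ε n f + (ε * ((r : ℕ) : ℂ)⁻¹) • expD A ι ε (n - r) f := by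
  have h := derivation_expZ (y := fun k : ℕ+ => (ε * ((k : ℕ) : ℂ)⁻¹) • dFn A (ι k))
    (adL (xFn A (ι r))) (adL_mul _) r ((ε * ((r : ℕ) : ℂ)⁻¹) • (-1)) (by
      rw [map_smul, adL_xFn_dFn, if_pos rfl]) (fun k hk => by
      rw [map_smul, adL_xFn_dFn, if_neg (fun h => hk (hι.injective h)), smul_zero])
    (fun k => by
      rw [smul_neg, ← neg_smul]
      exact (Commute.one_right _).smul_right _) n
  have h1 := LinearMap.congr_fun h f
  rw [mul_smul_comm] at h1
  have h2 : X (ι r) * expD A ι ε n f - expD A ι ε n (X (ι r) * f)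
    = (ε * ((r : ℕ) : ℂ)⁻¹) • expD A ι ε (n - r) (-f) := h1
  rw [map_neg, smul_neg] at h2
  linear_combination -h2

theorem expD_X_of_notMem {τ : Time} (hτ : τ ∉ Set.range ι) (ε : ℂ) (n : ℤ) (f : Fn A) :
    expD A ι ε n (X τ * f) = X τ * expD A ι ε n f := by
  have h := commute_expZ (y := fun k : ℕ+ => (ε * ((k : ℕ) : ℂ)⁻¹) • dFn A (ι k))
    (a := xFn A τ) (fun k => sub_eq_zero.1 (by
      have := adL_xFn_dFn (A := A) τ (ι k)
      rw [if_neg (fun h => hτ ⟨k, h⟩)] at this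
      show adL _ _ = _
      rw [map_smul, this, smul_zero])) n
  exact (LinearMap.congr_fun h.eq f).symm

theorem shifts_expD (hι : IsTimes ι) (ε : ℂ) (n : ℤ) : Shifts (-n) (expD A ι ε n) :=
  expZ_graded (fun n (φ : Module.End A (Fn A)) => Shifts (-n) φ) (fun _ _ _ _ => van_zero _)
    (fun w f hf => by simpa using hf)
    (fun _ _ _ h1 h2 w f hf => (h1 w f hf).add (h2 w f hf))
    (fun _ z φ h w f hf => by
      rw [LinearMap.smul_apply]
      exact (h w f hf).csmul z)
    (fun m n φ ψ h1 h2 w f hf => by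
      have := h1 _ _ (h2 w f hf)
      exact this.mono (by omega))
    (fun k w f hf => by
      rw [LinearMap.smul_apply, dFn_apply]
      exact (hι.shifts_der k w f hf).csmul _) n

theorem euler_expX (ε : ℂ) (n : ℤ) :
    n • expX A ι ε n = locSum fun k : ℕ+ => (k : ℕ) • (ε • X (ι k) * expX A ι ε (n - k)) := by
  have h := euler_expZ (y := fun k => ε • (X (ι k) : Fn A)) (fun _ _ => Commute.all _ _) n
  rw [expX, h]
  ext γ
  rw [coeff_locSum, map_finsum]
  · refine finsum_congr fun k => ?_
    rw [smul_mul_assoc, map_nsmul, map_nsmul]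
    rfl
  · exact expZ_support_finite _ n _

theorem euler_expD (ε : ℂ) (n : ℤ) (f : Fn A) :
    n • expD A ι ε n f = locSum fun k : ℕ+ => ε • der (ι k) (expD A ι ε (n - k) f) := by
  have h := euler_expZ (y := fun k : ℕ+ => (ε * ((k : ℕ) : ℂ)⁻¹) • dFn A (ι k))
    (fun _ _ => commute_smul_dFn _ _ _ _) n
  have h1 := LinearMap.congr_fun h f
  rw [LinearMap.smul_apply] at h1
  rw [expD, h1]
  ext γ
  rw [coeff_locSum]
  have h2 := AddMonoidHom.map_finsum
    ((coeff (R := A) γ).toAddMonoidHom.comp (LinearMap.applyₗ' A f).toAddMonoidHom)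
    (expZ_support_finite (fun k : ℕ+ => (ε * ((k : ℕ) : ℂ)⁻¹) • dFn A (ι k)) n
      (fun k => (k : ℕ) • (ε * ((k : ℕ) : ℂ)⁻¹) • dFn A (ι k)))
  refine h2.trans (finsum_congr fun k => ?_)
  have hk : ((k : ℕ) : ℂ) ≠ 0 := Nat.cast_ne_zero.2 k.ne_zero
  rw [← Nat.cast_smul_eq_nsmul ℂ, smul_smul, mul_left_comm, mul_inv_cancel₀ hk, mul_one,
    smul_mul_assoc]
  show coeff γ (ε • dFn A (ι k) _) = _
  rw [dFn_apply]
  rfl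

end Vertex

/-! ### Vanishing criterion for operators; translations in the times -/

section Vertex

variable {A : Type*} [CommRing A]

theorem le_wt (γ : Time →₀ ℕ) (τ : Time) (h : γ τ ≠ 0) :
    γ τ ≤ wt γ ∧ wt (Finsupp.single τ 1) ≤ wt γ := by
  have h1 : γ = (γ - Finsupp.single τ (γ τ)) + Finsupp.single τ (γ τ) :=
    (tsub_add_cancel_of_le (Finsupp.single_le_iff.2 le_rfl)).symm
  have h2 : wt (Finsupp.single τ (γ τ)) = γ τ * wt (Finsupp.single τ 1) := by
    rw [← smul_eq_mul, ← map_nsmul, Finsupp.smul_single, smul_eq_mul, mul_one]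
  have h3 : 1 ≤ wt (Finsupp.single τ 1) := by
    cases τ with
    | inl k => rw [wt_inl]; exact k.pos
    | inr k => rw [wt_inr]; exact k.pos
  have h4 : wt γ = wt (γ - Finsupp.single τ (γ τ)) + γ τ * wt (Finsupp.single τ 1) := by
    rw [← h2, ← map_add, ← h1]
  have h5 : 1 ≤ γ τ := Nat.one_le_iff_ne_zero.2 h
  constructor <;> nlinarith

/-- Every time has positive weight and only finitely many have weight at most `w`, so both the times
that occur and their exponents are bounded. -/
theorem finite_wt_lt (w : ℕ) : {γ : Time →₀ ℕ | wt γ < w}.Finite := by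
  classical
  have hfin : ({τ : Time | wt (Finsupp.single τ 1) ≤ w}).Finite := by
    refine (((Set.finite_Iic w).preimage PNat.coe_injective.injOn).image Sum.inl |>.union
      (((Set.finite_Iic w).preimage PNat.coe_injective.injOn).image Sum.inr)).subset ?_
    rintro (k | k) hk
    · rw [Set.mem_ofPred_eq, wt_inl] at hk
      exact Or.inl ⟨k, hk, rfl⟩
    · rw [Set.mem_ofPred_eq, wt_inr] at hk
      exact Or.inr ⟨k, hk, rfl⟩
  refine (Set.finite_Iic (Finsupp.indicator hfin.toFinset fun _ _ => w)).subset fun γ hγ => ?_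
  rw [Set.mem_Iic]
  intro τ
  rw [Set.mem_ofPred_eq] at hγ
  by_cases h : γ τ = 0
  · rw [h]
    exact Nat.zero_le _
  · have h1 := le_wt γ τ h
    rw [Finsupp.indicator_of_mem]
    · omega
    · rw [Set.Finite.mem_toFinset]
      exact h1.2.trans hγ.le

/-- A family of operators that is closed under commutators with the times and the derivatives, and
kills `1` at the origin, is zero. -/
theorem eq_zero_of_commutators [Algebra ℂ A] {I : Type*} (F : I → Module.End A (Fn A)) (n : I → ℤ)
    (hF : ∀ i, Shifts (n i) (F i))
    (hX : ∀ τ f, (∀ j, F j f = 0) → ∀ i, F i (X τ * f) = 0)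
    (hD : ∀ τ γ, (∀ j, coeff γ (F j 1) = 0) → ∀ i, coeff γ (der τ (F i 1)) = 0)
    (h0 : ∀ i, coeff 0 (F i 1) = 0) (i : I) : F i = 0 := by
  have h1 : ∀ γ i, coeff γ (F i 1) = 0 := by
    intro γ
    induction γ using Time.induction with
    | h0 => exact h0
    | h1 γ τ ih =>
      intro i
      have h := hD τ γ ih i
      rw [coeff_der, ← Nat.cast_smul_eq_nsmul ℂ] at h
      exact (smul_eq_zero_iff_right (Nat.cast_ne_zero.2 (Nat.succ_ne_zero _))).1 h
  have h2 : ∀ (γ : Time →₀ ℕ) i, F i (monomial γ 1) = 0 := by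
    intro γ
    induction γ using Time.induction with
    | h0 =>
      intro i
      ext γ
      rw [monomial_zero_one, h1, map_zero]
    | h1 γ τ ih =>
      intro i
      have : (monomial (γ + Finsupp.single τ 1) 1 : Fn A) = X τ * monomial γ 1 := by
        rw [X_def, monomial_mul_monomial, one_mul, add_comm]
      rw [this]
      exact hX τ _ ih i
  ext f : 1
  refine eq_of_van fun w => ?_
  -- Below the relevant weight f is a finite combination of monomials, all of which are killed by
  -- `h2`; the rest is pushed above weight `w` by `Shifts`.
  have hfin := finite_wt_lt (w - n i).toNat
  have h3 : Van ((w - n i).toNat : ℤ) (f - ∑ γ ∈ hfin.toFinset, coeff γ f • monomial γ 1) := by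
    classical
    intro γ hγ
    rw [map_sub, map_sum, Finset.sum_eq_single γ]
    · rw [coeff_smul, coeff_monomial_same, mul_one, sub_self]
    · intro β _ hβ
      rw [coeff_smul, coeff_monomial_ne hβ.symm, mul_zero]
    · intro h
      rw [Set.Finite.mem_toFinset, Set.mem_ofPred_eq] at h
      exact absurd (by exact_mod_cast hγ) h
  have h4 := hF i _ _ h3
  rw [map_sub, map_sum, Finset.sum_eq_zero, sub_zero] at h4
  · rw [LinearMap.zero_apply, sub_zero]
    exact h4.mono (by omega)
  · intro γ _
    rw [map_smul, h2, smul_zero]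

variable [Algebra ℂ A] {ι : ℕ+ → Time}

theorem euler_expD_natCast (ε : ℂ) (n : ℕ) (f : Fn A) :
    n • expD A ι ε n f
      = ε • ∑ j ∈ Finset.range n, der (ι j.succPNat) (expD A ι ε ((n : ℤ) - (j + 1)) f) := by
  have h := euler_expZ_natCast (y := fun k : ℕ+ => (ε * ((k : ℕ) : ℂ)⁻¹) • dFn A (ι k))
    (fun _ _ => commute_smul_dFn _ _ _ _) n
  have h1 := LinearMap.congr_fun h f
  rw [LinearMap.smul_apply] at h1
  rw [expD, h1, LinearMap.sum_apply, Finset.smul_sum]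
  refine Finset.sum_congr rfl fun j _ => ?_
  have hk : ((j + 1 : ℕ) : ℂ) ≠ 0 := Nat.cast_ne_zero.2 (Nat.succ_ne_zero j)
  rw [← Nat.cast_smul_eq_nsmul ℂ, Nat.succPNat_coe, Nat.succ_eq_add_one, smul_smul, mul_left_comm,
    mul_inv_cancel₀ hk, mul_one, smul_mul_assoc, LinearMap.smul_apply, Module.End.mul_apply,
    dFn_apply]
  rfl

/-- Both sides run over the triples (j, a, b) with a + b + j + 1 = n. -/
theorem sum_antidiagonal_range {M : Type*} [AddCommMonoid M] (F : ℕ → ℕ → ℕ → M) (n : ℕ) :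
    ∑ p ∈ Finset.HasAntidiagonal.antidiagonal n, ∑ j ∈ Finset.range p.1, F j (p.1 - (j + 1)) p.2
      = ∑ j ∈ Finset.range n, ∑ p ∈ Finset.HasAntidiagonal.antidiagonal (n - (j + 1)),
          F j p.1 p.2 := by
  rw [Finset.sum_sigma', Finset.sum_sigma']
  refine Finset.sum_bij' (fun x _ => ⟨x.2, (x.1.1 - (x.2 + 1), x.1.2)⟩)
    (fun x _ => ⟨(x.2.1 + (x.1 + 1), x.2.2), x.1⟩) ?_ ?_ ?_ ?_ ?_
  · rintro ⟨⟨a, b⟩, j⟩ h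
    simp only [Finset.mem_sigma, Finset.HasAntidiagonal.mem_antidiagonal, Finset.mem_range] at h ⊢
    omega
  · rintro ⟨j, a, b⟩ h
    simp only [Finset.mem_sigma, Finset.HasAntidiagonal.mem_antidiagonal, Finset.mem_range] at h ⊢
    omega
  · rintro ⟨⟨a, b⟩, j⟩ h
    simp only [Finset.mem_sigma, Finset.HasAntidiagonal.mem_antidiagonal, Finset.mem_range] at h
    have : a - (j + 1) + (j + 1) = a := by omega
    simp only [this]
  · rintro ⟨j, a, b⟩ h
    simp
  · rintro ⟨⟨a, b⟩, j⟩ h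
    rfl

theorem eq_of_nsmul_eq {n : ℕ} (hn : n ≠ 0) {f g : Fn A} (h : n • f = n • g) : f = g := by
  rw [← Nat.cast_smul_eq_nsmul ℂ, ← Nat.cast_smul_eq_nsmul ℂ] at h
  exact smul_right_injective _ (Nat.cast_ne_zero.2 hn : (n : ℂ) ≠ 0) h

/-- The exponential of a derivation is a ring homomorphism, here the translation x_k ↦ x_k + ε z^k /
k. Euler's identity expresses n times the n-th coefficient by lower ones, so strong induction and
Leibniz' rule suffice. -/
theorem expD_mul (ε : ℂ) (n : ℕ) (f g : Fn A) :
    expD A ι ε n (f * g) = ∑ p ∈ Finset.HasAntidiagonal.antidiagonal n,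
      expD A ι ε p.1 f * expD A ι ε p.2 g := by
  induction n using Nat.strong_induction_on with
  | _ n ih =>
    rcases Nat.eq_zero_or_pos n with h | h
    · subst h
      simp [expD_zero]
    refine eq_of_nsmul_eq h.ne' ?_
    rw [euler_expD_natCast]
    have h1 : ∀ j ∈ Finset.range n,
        der (ι j.succPNat) (expD A ι ε ((n : ℤ) - (j + 1)) (f * g))
          = ∑ p ∈ Finset.HasAntidiagonal.antidiagonal (n - (j + 1)),
              der (ι j.succPNat) (expD A ι ε p.1 f) * expD A ι ε p.2 g
            + ∑ p ∈ Finset.HasAntidiagonal.antidiagonal (n - (j + 1)),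
              der (ι j.succPNat) (expD A ι ε p.1 g) * expD A ι ε p.2 f := by
      intro j hj
      rw [Finset.mem_range] at hj
      have h2 : ((n : ℤ) - (j + 1)) = ((n - (j + 1) : ℕ) : ℤ) := by omega
      rw [h2, ih _ (by omega), map_sum,
        ← Finset.Nat.sum_antidiagonal_swap (f := fun p => der _ (expD A ι ε p.1 g) * _),
        ← Finset.sum_add_distrib]
      refine Finset.sum_congr rfl fun p _ => ?_
      rw [der_mul, Prod.fst_swap, Prod.snd_swap, mul_comm (expD A ι ε p.1 f)]
    have h3 : ∀ f g : Fn A, ε • ∑ j ∈ Finset.range n,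
        ∑ p ∈ Finset.HasAntidiagonal.antidiagonal (n - (j + 1)),
              der (ι j.succPNat) (expD A ι ε p.1 f) * expD A ι ε p.2 g
        = ∑ p ∈ Finset.HasAntidiagonal.antidiagonal n,
          (p.1 • expD A ι ε p.1 f) * expD A ι ε p.2 g := by
      intro f g
      rw [← sum_antidiagonal_range (fun j a b =>
        der (ι j.succPNat) (expD A ι ε a f) * expD A ι ε b g), Finset.smul_sum]
      refine Finset.sum_congr rfl fun p _ => ?_
      rw [euler_expD_natCast, smul_mul_assoc, Finset.sum_mul]
      congr 1
      refine Finset.sum_congr rfl fun j hj => ?_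
      rw [Finset.mem_range] at hj
      have h2 : ((p.1 : ℤ) - (j + 1)) = ((p.1 - (j + 1) : ℕ) : ℤ) := by omega
      rw [h2]
    rw [Finset.sum_congr rfl h1, Finset.sum_add_distrib, smul_add, h3, h3,
      ← Finset.Nat.sum_antidiagonal_swap (f := fun p => (p.1 • expD A ι ε p.1 g) * _),
      ← Finset.sum_add_distrib, Finset.smul_sum]
    refine Finset.sum_congr rfl fun p hp => ?_
    rw [Finset.HasAntidiagonal.mem_antidiagonal] at hp
    rw [Prod.fst_swap, Prod.snd_swap, ← hp, add_smul, smul_mul_assoc, smul_mul_assoc,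
      mul_comm (expD A ι ε p.1 f)]

theorem expD_one (ε : ℂ) {n : ℕ} (hn : n ≠ 0) : expD A ι ε n (1 : Fn A) = 0 := by
  refine eq_of_nsmul_eq hn ?_
  rw [euler_expD_natCast, smul_zero, Finset.sum_eq_zero, smul_zero]
  intro j _
  rw [← expD_der, der_one, map_zero]

theorem expD_csmul (ε : ℂ) (n : ℤ) (z : ℂ) (f : Fn A) :
    expD A ι ε n (z • f) = z • expD A ι ε n f := by
  rw [← algebraMap_smul A z f, map_smul, algebraMap_smul]

/-- The translation multiplies e^{ε'ξ(x,w)} by exp(εε' ∑ (zw)^k / k) = (1 - zw)^{-εε'}. For εε' = 1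
this is the geometric series, so the coefficient of zⁿ is the factor wⁿ. -/
theorem expD_expX (hι : IsTimes ι) {ε ε' : ℂ} (h : ε * ε' = 1) (n : ℕ) (c : ℤ) :
    expD A ι ε n (expX A ι ε' c) = expX A ι ε' (c - n) := by
  induction n using Nat.strong_induction_on generalizing c with
  | _ n ih =>
    rcases Nat.eq_zero_or_pos n with h0 | h0
    · subst h0
      simp [expD_zero]
    refine eq_of_nsmul_eq h0.ne' ?_
    rw [euler_expD_natCast, Finset.smul_sum, Finset.sum_congr rfl (g := fun _ => _),
      Finset.sum_const, Finset.card_range]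
    intro j hj
    rw [Finset.mem_range] at hj
    have h2 : ((n : ℤ) - (j + 1)) = ((n - (j + 1) : ℕ) : ℤ) := by omega
    rw [← expD_der, der_expX hι, expD_csmul, h2, ih _ (by omega), smul_smul, h, one_smul]
    congr 1
    rw [Nat.succPNat_coe]
    omega

theorem expD_one_expX (hι : IsTimes ι) {ε ε' : ℂ} (h : ε * ε' = -1) (c : ℤ) :
    expD A ι ε 1 (expX A ι ε' c) = -expX A ι ε' (c - 1) := by
  have h1 := euler_expD_natCast (ι := ι) ε 1 (expX A ι ε' c)
  rw [Finset.sum_range_one] at h1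
  simp only [Nat.cast_one, Nat.cast_zero, zero_add, sub_self, expD_zero, one_smul] at h1
  rw [h1, Module.End.one_apply, der_expX hι, smul_smul, h, neg_one_smul]
  rfl

/-- For εε' = -1 the factor is 1 - zw, without powers of z above the first. In Euler's identity only
the two last terms survive, and they cancel. -/
theorem expD_two_expX (hι : IsTimes ι) {ε ε' : ℂ} (h : ε * ε' = -1) (n : ℕ) (hn : 2 ≤ n) (c : ℤ) :
    expD A ι ε n (expX A ι ε' c) = 0 := by
  induction n using Nat.strong_induction_on generalizing c with
  | _ n ih =>
    obtain ⟨n, rfl⟩ := Nat.exists_eq_add_of_le' hn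
    refine eq_of_nsmul_eq (n := n + 2) (by omega) ?_
    rw [euler_expD_natCast, smul_zero, Finset.sum_range_succ, Finset.sum_range_succ,
      Finset.sum_eq_zero, zero_add]
    · have h1 : (((n + 2 : ℕ) : ℤ) - (n + 1)) = 1 := by omega
      have h2 : (((n + 2 : ℕ) : ℤ) - ((n + 1 : ℕ) + 1)) = 0 := by omega
      rw [h1, h2, expD_zero, expD_one_expX hι h, map_neg, Module.End.one_apply, der_expX hι,
        der_expX hι, neg_add_eq_zero.2, smul_zero]
      congr 2
      simp only [Nat.succPNat_coe]
      omega
    · intro j hj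
      rw [Finset.mem_range] at hj
      have h2 : (((n + 2 : ℕ) : ℤ) - (j + 1)) = ((n + 2 - (j + 1) : ℕ) : ℤ) := by omega
      rw [h2, ih _ (by omega) (by omega), map_zero]

end Vertex

/-! ### The vertex operator and its commutators with times and derivatives -/

section Vertex

variable {A : Type*} [CommRing A]

/-- The sum of a locally finite family of operators. -/
def locSumEnd {I : Type*} (F : I → Module.End A (Fn A)) (hF : ∀ f, Null fun i => F i f) :
    Module.End A (Fn A) where
  toFun f := locSum fun i => F i f
  map_add' f g := by
    simp only [map_add]
    exact locSum_add (hF f) (hF g)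
  map_smul' a f := by
    ext γ
    simp only [map_smul, coeff_locSum, RingHom.id_apply]
    exact (mul_finsum' _ _ ((hF f).finite γ)).symm

theorem coeff_zero_mul (f g : Fn A) : coeff 0 (f * g) = coeff 0 f * coeff 0 g := by
  simp [coeff_zero_eq_constantCoeff_apply]

variable [Algebra ℂ A] {ι : ℕ+ → Time}

/-- A term of the expansion of the vertex operator. -/
def vTerm (A : Type*) [CommRing A] [Algebra ℂ A] (ι : ℕ+ → Time) (i j : ℤ) (p : ℤ × ℤ) :
    Module.End A (Fn A) :=
  LinearMap.mulLeft A (expX A ι 1 (i + p.2) * expX A ι (-1) (j + p.1))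
    * (expD A ι 1 p.1 * expD A ι (-1) p.2)

theorem vTerm_apply (i j : ℤ) (p : ℤ × ℤ) (f : Fn A) : vTerm A ι i j p f
    = expX A ι 1 (i + p.2) * expX A ι (-1) (j + p.1) * expD A ι 1 p.1 (expD A ι (-1) p.2 f) :=
  rfl

theorem vTerm_of_neg (i j : ℤ) (p : ℤ × ℤ) (h : p.1 < 0 ∨ p.2 < 0) (f : Fn A) :
    vTerm A ι i j p f = 0 := by
  rw [vTerm_apply]
  rcases h with h | h
  · rw [expD_of_neg 1 h, LinearMap.zero_apply, mul_zero]
  · rw [expD_of_neg (-1) h, LinearMap.zero_apply, map_zero, mul_zero]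

theorem van_expX_max (hι : IsTimes ι) (ε : ℂ) (n : ℤ) : Van (max n 0) (expX A ι ε n) := by
  rcases le_total n 0 with h | h
  · rw [max_eq_right h]
    exact van_of_nonpos le_rfl _
  · rw [max_eq_left h]
    exact van_expX hι ε n

theorem van_vTerm (hι : IsTimes ι) (i j : ℤ) (p : ℤ × ℤ) (f : Fn A) :
    Van (max (i + p.2) 0 + max (j + p.1) 0) (vTerm A ι i j p f) :=
  ((van_expX_max hι 1 _).mul (van_expX_max hι (-1) _)).mul_right _

/-- Outside a finite box of derivative orders, either an order is negative or one of the exponential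
prefactors already has weight at least `w`. -/
theorem null_vTerm (hι : IsTimes ι) (i j : ℤ) (f : Fn A) : Null fun p => vTerm A ι i j p f := by
  refine Null.of_subset (fun w => Set.Icc 0 (w - j) ×ˢ Set.Icc 0 (w - i))
    (fun w => (Set.finite_Icc _ _).prod (Set.finite_Icc _ _)) fun w p hp => ?_
  by_cases h : p.1 < 0 ∨ p.2 < 0
  · rw [vTerm_of_neg i j p h]
    exact van_zero _
  · refine (van_vTerm hι i j p f).mono ?_
    simp only [Set.mem_prod, Set.mem_Icc] at hp
    omega

/-- The coefficient of `μ^i λ^j` in the vertex operator `X(λ,μ)`. -/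
def vOp (hι : IsTimes ι) (i j : ℤ) : Module.End A (Fn A) :=
  locSumEnd (vTerm A ι i j) (null_vTerm hι i j)

theorem vOp_apply (hι : IsTimes ι) (i j : ℤ) (f : Fn A) :
    vOp hι i j f = locSum fun p => vTerm A ι i j p f := rfl

theorem van_vOp (hι : IsTimes ι) (i j : ℤ) (f : Fn A) :
    Van (max i 0 + max j 0) (vOp hι i j f) := by
  refine Van.locSum fun p => ?_
  by_cases h : p.1 < 0 ∨ p.2 < 0
  · rw [vTerm_of_neg i j p h]
    exact van_zero _
  · exact (van_vTerm hι i j p f).mono (by omega)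

theorem shifts_vOp (hι : IsTimes ι) (i j : ℤ) : Shifts (i + j) (vOp (A := A) hι i j) := by
  intro w f hf
  refine Van.locSum fun p => ?_
  exact (((van_expX hι 1 _).mul (van_expX hι (-1) _)).mul
    (shifts_expD hι 1 p.1 _ _ (shifts_expD hι (-1) p.2 _ _ hf))).mono (by omega)

/-- At the origin only the constant term 1 of each exponential prefactor survives, which fixes both
derivative orders. -/
theorem coeff_zero_vOp (hι : IsTimes ι) (i j : ℤ) (f : Fn A) :
    coeff 0 (vOp hι i j f) = coeff 0 (expD A ι 1 (-j) (expD A ι (-1) (-i) f)) := by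
  rw [vOp_apply, coeff_locSum, finsum_eq_single _ (-j, -i)]
  · rw [vTerm_apply, coeff_zero_mul, coeff_zero_mul, coeff_zero_expX hι, coeff_zero_expX hι,
      if_pos (add_neg_cancel i), if_pos (add_neg_cancel j), one_mul, one_mul]
  · intro p hp
    rw [vTerm_apply, coeff_zero_mul, coeff_zero_mul, coeff_zero_expX hι, coeff_zero_expX hι]
    by_cases h : i + p.2 = 0
    · rw [if_neg (c := j + p.1 = 0), mul_zero, zero_mul]
      intro h1
      exact hp (Prod.ext (by simp only; omega) (by simp only; omega))
    · rw [if_neg h, zero_mul, zero_mul]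

/-- In generating functions: [∂_r, X] = (μ^r - λ^r) X. -/
theorem der_vOp (hι : IsTimes ι) (i j : ℤ) (r : ℕ+) (f : Fn A) :
    der (ι r) (vOp hι i j f)
      = vOp hι i j (der (ι r) f) + vOp hι (i - r) j f - vOp hι i (j - r) f := by
  rw [vOp_apply, map_locSum (der (ι r)) (hι.shifts_der r) (null_vTerm hι i j f)]
  simp only [vOp_apply]
  rw [← locSum_add (null_vTerm hι _ _ _) (null_vTerm hι _ _ _),
    ← locSum_sub ((null_vTerm hι _ _ _).add (null_vTerm hι _ _ _)) (null_vTerm hι _ _ _)]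
  refine locSum_congr fun p => ?_
  simp only [vTerm_apply, der_mul, der_expX hι, expD_der]
  rw [sub_add_eq_add_sub i, sub_add_eq_add_sub j, one_smul, neg_one_smul]
  ring

theorem der_vOp_of_notMem (hι : IsTimes ι) (i j : ℤ) {τ : Time} (hτ : τ ∉ Set.range ι) (f : Fn A) :
    der τ (vOp hι i j f) = vOp hι i j (der τ f) := by
  rw [vOp_apply, map_locSum (der τ) (shifts_der τ) (null_vTerm hι i j f)]
  refine locSum_congr fun p => ?_
  simp only [vTerm_apply, der_mul, der_expX_of_notMem hτ, expD_der]
  ring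

theorem shifts_X_mul {R : Type*} [Ring R] (τ : Time) :
    Shifts 0 (fun f : MvPowerSeries Time R => X τ * f) :=
  fun w f hf => (hf.mul_left _).mono (by omega)

theorem X_mul_locSum {R I : Type*} [Ring R] (g : MvPowerSeries Time R)
    {F : I → MvPowerSeries Time R} (hF : Null F) :
    g * locSum F = locSum fun i => g * F i :=
  map_locSum (AddMonoidHom.mulLeft g) (n := 0)
    (fun w f hf => (hf.mul_left g).mono (by omega)) hF

/-- In generating functions: [X, x_r] = (λ⁻ʳ - μ⁻ʳ)/r · X. Each of the two exponentials of
derivatives contributes one shifted sum, reindexed by r. -/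
theorem vOp_X (hι : IsTimes ι) (i j : ℤ) (r : ℕ+) (f : Fn A) :
    vOp hι i j (X (ι r) * f) = X (ι r) * vOp hι i j f
      + ((r : ℕ) : ℂ)⁻¹ • (vOp hι i (j + r) f - vOp hι (i + r) j f) := by
  have h1 := locSum_comp_equiv ((Equiv.addRight (r : ℤ)).prodCongr (Equiv.refl ℤ))
    (fun p => vTerm A ι i j (p.1, p.2) f)
  set F1 : ℤ × ℤ → Fn A := fun p => expX A ι 1 (i + p.2) * expX A ι (-1) (j + p.1)
    * expD A ι 1 (p.1 - r) (expD A ι (-1) p.2 f) with hF1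
  set F2 : ℤ × ℤ → Fn A := fun p => expX A ι 1 (i + p.2) * expX A ι (-1) (j + p.1)
    * expD A ι 1 p.1 (expD A ι (-1) (p.2 - r) f) with hF2
  have e1 : ∀ p, F1 p = vTerm A ι i (j + r)
      (((Equiv.subRight (r : ℤ)).prodCongr (Equiv.refl ℤ)) p) f := by
    intro p
    rw [vTerm_apply, hF1]
    simp [add_assoc]
  have e2 : ∀ p, F2 p = vTerm A ι (i + r) j
      (((Equiv.refl ℤ).prodCongr (Equiv.subRight (r : ℤ))) p) f := by
    intro p
    rw [vTerm_apply, hF2]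
    simp [add_assoc]
  have n1 : Null F1 := by
    rw [funext e1]
    exact (null_vTerm hι i (j + r) f).comp (Equiv.injective _)
  have n2 : Null F2 := by
    rw [funext e2]
    exact (null_vTerm hι (i + r) j f).comp (Equiv.injective _)
  have s1 : locSum F1 = vOp hι i (j + r) f := by
    rw [funext e1]
    exact locSum_comp_equiv _ fun p => vTerm A ι i (j + r) p f
  have s2 : locSum F2 = vOp hι (i + r) j f := by
    rw [funext e2]
    exact locSum_comp_equiv _ fun p => vTerm A ι (i + r) j p f
  have n12 : Null fun p => F1 p - F2 p := by
    simp only [sub_eq_add_neg]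
    exact n1.add (n2.map (φ := fun f => -f) (n := 0) fun w f hf => by simpa using hf.neg)
  rw [← s1, ← s2, ← locSum_sub n1 n2, ← locSum_csmul n12, vOp_apply, vOp_apply,
    X_mul_locSum _ (null_vTerm hι i j f),
    ← locSum_add ((null_vTerm hι i j f).map (shifts_X_mul _)) (n12.csmul _)]
  refine locSum_congr fun p => ?_
  rw [vTerm_apply, vTerm_apply, expD_X hι, map_add, expD_X hι, expD_csmul, hF1, hF2]
  simp only [one_mul, mul_add, mul_smul_comm, neg_mul, neg_smul, smul_sub, mul_neg]
  ring

theorem vOp_X_of_notMem (hι : IsTimes ι) (i j : ℤ) {τ : Time} (hτ : τ ∉ Set.range ι) (f : Fn A) :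
    vOp hι i j (X τ * f) = X τ * vOp hι i j f := by
  rw [vOp_apply, vOp_apply, X_mul_locSum _ (null_vTerm hι i j f)]
  refine locSum_congr fun p => ?_
  rw [vTerm_apply, vTerm_apply, expD_X_of_notMem hτ, expD_X_of_notMem hτ]
  ring

/-! ### The wave operator -/

/-- A term of `e^{ξ(x,z)} G(z)`. -/
def waveTerm (A : Type*) [CommRing A] [Algebra ℂ A] (ι : ℕ+ → Time) (j n : ℤ) :
    Module.End A (Fn A) :=
  LinearMap.mulLeft A (expX A ι 1 (j + n)) * expD A ι (-1) n

theorem waveTerm_apply (j n : ℤ) (f : Fn A) :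
    waveTerm A ι j n f = expX A ι 1 (j + n) * expD A ι (-1) n f := rfl

theorem null_waveTerm (hι : IsTimes ι) (j : ℤ) (f : Fn A) :
    Null fun n => waveTerm A ι j n f := by
  refine Null.of_subset (fun w => Set.Icc 0 (w - j))
    (fun w => Set.finite_Icc _ _) fun w n hn => ?_
  by_cases h : n < 0
  · rw [waveTerm_apply, expD_of_neg _ h, LinearMap.zero_apply, mul_zero]
    exact van_zero _
  · refine ((van_expX hι 1 (j + n)).mul_right _).mono ?_
    simp only [Set.mem_Icc] at hn
    omega

/-- The coefficient of `z^j` in `e^{ξ(x,z)} G(z)`. -/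
def waveOp (hι : IsTimes ι) (j : ℤ) : Module.End A (Fn A) :=
  locSumEnd (waveTerm A ι j) (null_waveTerm hι j)

theorem waveOp_apply (hι : IsTimes ι) (j : ℤ) (f : Fn A) :
    waveOp hι j f = locSum fun n => waveTerm A ι j n f := rfl

theorem shifts_waveOp (hι : IsTimes ι) (j : ℤ) : Shifts j (waveOp (A := A) hι j) := by
  intro w f hf
  refine Van.locSum fun p => ?_
  exact ((van_expX hι 1 _).mul (shifts_expD hι (-1) p _ _ hf)).mono (by omega)

theorem coeff_zero_waveOp (hι : IsTimes ι) (j : ℤ) (f : Fn A) :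
    coeff 0 (waveOp hι j f) = coeff 0 (expD A ι (-1) (-j) f) := by
  rw [waveOp_apply, coeff_locSum, finsum_eq_single _ (-j)]
  · rw [waveTerm_apply, coeff_zero_mul, coeff_zero_expX hι, if_pos (add_neg_cancel j), one_mul]
  · intro p hp
    rw [waveTerm_apply, coeff_zero_mul, coeff_zero_expX hι, if_neg (by omega), zero_mul]

/-- In generating functions [∂_r, Γ(z)] = z^r Γ(z); the companion `waveOp_X` is [Γ(z), x_r] =
-(z⁻ʳ/r) Γ(z). -/
theorem der_waveOp (hι : IsTimes ι) (j : ℤ) (r : ℕ+) (f : Fn A) :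
    der (ι r) (waveOp hι j f) = waveOp hι j (der (ι r) f) + waveOp hι (j - r) f := by
  rw [waveOp_apply, map_locSum (der (ι r)) (hι.shifts_der r) (null_waveTerm hι j f)]
  simp only [waveOp_apply]
  rw [← locSum_add (null_waveTerm hι _ _) (null_waveTerm hι _ _)]
  refine locSum_congr fun p => ?_
  simp only [waveTerm_apply, der_mul, der_expX hι, expD_der]
  rw [sub_add_eq_add_sub j, one_smul, add_comm]

theorem der_waveOp_of_notMem (hι : IsTimes ι) (j : ℤ) {τ : Time} (hτ : τ ∉ Set.range ι)
    (f : Fn A) : der τ (waveOp hι j f) = waveOp hι j (der τ f) := by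
  rw [waveOp_apply, map_locSum (der τ) (shifts_der τ) (null_waveTerm hι j f)]
  refine locSum_congr fun p => ?_
  simp only [waveTerm_apply, der_mul, der_expX_of_notMem hτ, expD_der]
  ring

theorem waveOp_X (hι : IsTimes ι) (j : ℤ) (r : ℕ+) (f : Fn A) :
    waveOp hι j (X (ι r) * f) = X (ι r) * waveOp hι j f
      - ((r : ℕ) : ℂ)⁻¹ • waveOp hι (j + r) f := by
  have e1 : ∀ n, expX A ι 1 (j + n) * expD A ι (-1) (n - r) f
      = waveTerm A ι (j + r) (Equiv.subRight (r : ℤ) n) f := by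
    intro n
    rw [waveTerm_apply]
    simp [add_assoc]
  have n1 : Null fun n => waveTerm A ι (j + r) (Equiv.subRight (r : ℤ) n) f :=
    (null_waveTerm hι (j + r) f).comp (Equiv.injective _)
  have s1 : locSum (fun n => waveTerm A ι (j + r) (Equiv.subRight (r : ℤ) n) f)
      = waveOp hι (j + r) f :=
    locSum_comp_equiv _ fun n => waveTerm A ι (j + r) n f
  rw [← s1, ← locSum_csmul n1, waveOp_apply, waveOp_apply, X_mul_locSum _ (null_waveTerm hι j f),
    ← locSum_sub ((null_waveTerm hι j f).map (shifts_X_mul _)) (n1.csmul _)]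
  refine locSum_congr fun n => ?_
  rw [← e1, waveTerm_apply, waveTerm_apply, expD_X hι]
  simp only [mul_add, mul_smul_comm, neg_mul, neg_smul, one_mul, mul_neg]
  ring

theorem waveOp_X_of_notMem (hι : IsTimes ι) (j : ℤ) {τ : Time} (hτ : τ ∉ Set.range ι) (f : Fn A) :
    waveOp hι j (X τ * f) = X τ * waveOp hι j f := by
  rw [waveOp_apply, waveOp_apply, X_mul_locSum _ (null_waveTerm hι j f)]
  refine locSum_congr fun p => ?_
  rw [waveTerm_apply, waveTerm_apply, expD_X_of_notMem hτ]
  ring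

theorem waveOp_one (hι : IsTimes ι) (j : ℤ) : waveOp hι j (1 : Fn A) = expX A ι 1 j := by
  rw [waveOp_apply, locSum_eq_single 0]
  · rw [waveTerm_apply, add_zero, expD_zero, Module.End.one_apply, mul_one]
  · intro n hn
    rw [waveTerm_apply]
    rcases lt_or_gt_of_ne hn with h | h
    · rw [expD_of_neg _ h, LinearMap.zero_apply, mul_zero]
    · lift n to ℕ using h.le
      rw [expD_one _ (by exact_mod_cast hn), mul_zero]

end Vertex

/-! ### The commutation relation of vertex and wave operators -/

section Vertex

variable {A : Type*} [CommRing A]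

/-- The falling factorial `t (t - 1) ⋯ (t - m + 1)`. -/
def fall (t : A) (m : ℕ) : A := ∏ r ∈ Finset.range m, (t - (r : A))

theorem fall_zero (t : A) : fall t 0 = 1 := by simp [fall]

theorem fall_succ (t : A) (m : ℕ) : fall t (m + 1) = fall t m * (t - m) := by
  rw [fall, Finset.prod_range_succ, fall]

theorem fall_add_one_sub (t : A) (m : ℕ) :
    fall (t + 1) (m + 1) - fall t (m + 1) = (m + 1) * fall t m := by
  have h : fall (t + 1) (m + 1) = fall t m * (t + 1) := by
    rw [fall, Finset.prod_range_succ', fall]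
    simp
  rw [h, fall_succ]
  ring

variable [Algebra ℂ A] {ι : ℕ+ → Time}

theorem vOp_one (hι : IsTimes ι) (i j : ℤ) :
    vOp hι i j (1 : Fn A) = expX A ι 1 i * expX A ι (-1) j := by
  have hD : ∀ (ε : ℂ) (n : ℤ), n ≠ 0 → expD A ι ε n (1 : Fn A) = 0 := by
    intro ε n hn
    rcases lt_or_gt_of_ne hn with h | h
    · rw [expD_of_neg _ h, LinearMap.zero_apply]
    · lift n to ℕ using h.le
      exact expD_one _ (by exact_mod_cast hn)
  rw [vOp_apply, locSum_eq_single (0, 0)]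
  · rw [vTerm_apply, add_zero, add_zero, expD_zero, expD_zero, Module.End.one_apply,
      Module.End.one_apply, mul_one]
  · intro p hp
    rw [vTerm_apply]
    by_cases h : p.2 = 0
    · rw [h, expD_zero, Module.End.one_apply, hD _ _ fun h1 => hp (Prod.ext h1 h), mul_zero]
    · rw [hD _ _ h, map_zero, mul_zero]

/-- G(u) is multiplicative and multiplies e^{ξ(x,w)} by 1 - uw, so only two terms of the product
formula remain. -/
theorem expD_expX_mul (hι : IsTimes ι) (n p : ℤ) (g : Fn A) :
    expD A ι (-1) n (expX A ι 1 p * g)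
      = expX A ι 1 p * expD A ι (-1) n g - expX A ι 1 (p - 1) * expD A ι (-1) (n - 1) g := by
  rcases lt_or_ge n 0 with h | h
  · rw [expD_of_neg _ h, expD_of_neg (n := n - 1) _ (by omega)]
    simp
  lift n to ℕ using h
  rw [expD_mul, Finset.Nat.sum_antidiagonal_eq_sum_range_succ_mk]
  rcases n with _ | n
  · rw [expD_of_neg (n := ((0 : ℕ) : ℤ) - 1) _ (by simp)]
    simp [expD_zero]
  · rw [Finset.sum_range_succ', Finset.sum_range_succ', Finset.sum_eq_zero, zero_add]
    · have h1 := expD_one_expX (A := A) hι (ε := -1) (ε' := 1) (by ring) p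
      simp only [zero_add, Nat.cast_one, Nat.sub_zero, Nat.cast_zero, Nat.add_sub_cancel]
      rw [h1, expD_zero, Module.End.one_apply, Nat.cast_succ, add_sub_cancel_right]
      ring
    · intro j _
      have h2 := expD_two_expX (A := A) hι (ε := -1) (ε' := 1) (by ring) (j + 1 + 1) (by omega) p
      simp only
      rw [h2, zero_mul]

theorem expD_expX_int (hι : IsTimes ι) {ε ε' : ℂ} (h : ε * ε' = 1) (n c : ℤ) :
    expD A ι ε n (expX A ι ε' c) = if 0 ≤ n then expX A ι ε' (c - n) else 0 := by
  split_ifs with h0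
  · lift n to ℕ using h0
    exact expD_expX hι h n c
  · rw [expD_of_neg _ (by omega), LinearMap.zero_apply]

/-- At the origin X(λ,μ) Γ(z) 1 is (1 - z/μ)/(1 - z/λ) expanded in powers of z/λ; the conditions `b
≤ 0` record this direction of expansion. -/
theorem coeff_zero_vOp_expX (hι : IsTimes ι) (a b c : ℤ) :
    coeff 0 (vOp hι a b (expX A ι 1 c))
      = (if a = 0 ∧ b + c = 0 ∧ b ≤ 0 then 1 else 0)
        - (if a = -1 ∧ b + c = 1 ∧ b ≤ 0 then 1 else 0) := by
  have h1 := expD_expX_mul (A := A) hι (-a) c 1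
  have hD : ∀ n : ℤ, expD A ι (-1) n (1 : Fn A) = if n = 0 then 1 else 0 := by
    intro n
    split_ifs with hn
    · rw [hn, expD_zero, Module.End.one_apply]
    rcases lt_or_gt_of_ne hn with h | h
    · rw [expD_of_neg _ h, LinearMap.zero_apply]
    · lift n to ℕ using h.le
      exact expD_one _ (by exact_mod_cast hn)
  rw [mul_one, hD, hD] at h1
  rw [coeff_zero_vOp, h1, map_sub, map_sub, mul_ite, mul_ite, mul_one, mul_one, mul_zero, mul_zero]
  congr 1
  · by_cases ha : a = 0
    · rw [if_pos (by omega), expD_expX_int hι (by ring)]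
      by_cases hb : b ≤ 0
      · rw [if_pos (by omega), coeff_zero_expX hι]
        exact if_congr (by omega) rfl rfl
      · rw [if_neg (by omega), map_zero, if_neg (by omega)]
    · rw [if_neg (by omega), map_zero, map_zero, if_neg (by omega)]
  · by_cases ha : a = -1
    · rw [if_pos (by omega), expD_expX_int hι (by ring)]
      by_cases hb : b ≤ 0
      · rw [if_pos (by omega), coeff_zero_expX hι]
        exact if_congr (by omega) rfl rfl
      · rw [if_neg (by omega), map_zero, if_neg (by omega)]
    · rw [if_neg (by omega), map_zero, map_zero, if_neg (by omega)]

/-- At the origin (λ/μ) Γ(z) X(λ,μ) 1 is (λ/μ)(1 - μ/z)/(1 - λ/z), the same rational function as for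
X Γ(z) 1, now expanded in powers of λ/z. The difference of the two expansions is the delta function
in the commutation relation. -/
theorem coeff_zero_waveOp_vOp_one (hι : IsTimes ι) (a b c : ℤ) :
    coeff 0 (waveOp hι c (vOp hι (a + 1) (b - 1) (1 : Fn A)))
      = (if a = -1 ∧ b + c = 1 ∧ c ≤ 0 then 1 else 0)
        - (if a = 0 ∧ b + c = 0 ∧ c + 1 ≤ 0 then 1 else 0) := by
  rw [coeff_zero_waveOp, vOp_one, expD_expX_mul hι, map_sub, coeff_zero_mul, coeff_zero_mul,
    coeff_zero_expX hι, coeff_zero_expX hι, expD_expX_int hι (by ring), expD_expX_int hι (by ring)]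
  congr 1
  · by_cases ha : a = -1
    · rw [if_pos (by omega), one_mul]
      by_cases hb : c ≤ 0
      · rw [if_pos (by omega), coeff_zero_expX hι]
        exact if_congr (by omega) rfl rfl
      · rw [if_neg (by omega), map_zero, if_neg (by omega)]
    · rw [if_neg (by omega), zero_mul, if_neg (by omega)]
  · by_cases ha : a = 0
    · rw [if_pos (by omega), one_mul]
      by_cases hb : c + 1 ≤ 0
      · rw [if_pos (by omega), coeff_zero_expX hι]
        exact if_congr (by omega) rfl rfl
      · rw [if_neg (by omega), map_zero, if_neg (by omega)]
    · rw [if_neg (by omega), zero_mul, if_neg (by omega)]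

/-- The coefficients of `1 - z`. -/
def stepZ (n : ℤ) : ℤ := (if n = 0 then 1 else 0) - (if n = 1 then 1 else 0)

/-- The defect of the commutation relation between the vertex operator and the wave operator. -/
def commDefect (A : Type*) [CommRing A] [Algebra ℂ A] {ι : ℕ+ → Time} (hι : IsTimes ι) (a b c : ℤ) :
    Module.End A (Fn A) :=
  vOp hι a b * waveOp hι c - waveOp hι c * vOp hι (a + 1) (b - 1)
    - stepZ (b + c) • waveOp hι (a + b + c)

theorem commDefect_apply (hι : IsTimes ι) (a b c : ℤ) (f : Fn A) :
    commDefect A hι a b c f = vOp hι a b (waveOp hι c f) - waveOp hι c (vOp hι (a + 1) (b - 1) f)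
      - stepZ (b + c) • waveOp hι (a + b + c) f := rfl

theorem waveOp_csmul (hι : IsTimes ι) (j : ℤ) (z : ℂ) (f : Fn A) :
    waveOp hι j (z • f) = z • waveOp hι j f := by
  rw [← algebraMap_smul A z f, map_smul, algebraMap_smul]

theorem vOp_csmul (hι : IsTimes ι) (i j : ℤ) (z : ℂ) (f : Fn A) :
    vOp hι i j (z • f) = z • vOp hι i j f := by
  rw [← algebraMap_smul A z f, map_smul, algebraMap_smul]

/-- All three terms of the defect have the same commutator with x_r as generating functions:
multiplication by (λ⁻ʳ - μ⁻ʳ - z⁻ʳ)/r. On the delta term λ = z, which leaves the -μ⁻ʳ/r of Γ(μ). -/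
theorem commDefect_X (hι : IsTimes ι) (a b c : ℤ) (r : ℕ+) (f : Fn A) :
    commDefect A hι a b c (X (ι r) * f) = X (ι r) * commDefect A hι a b c f
      + ((r : ℕ) : ℂ)⁻¹ • (commDefect A hι a (b + r) c f - commDefect A hι (a + r) b c f
        - commDefect A hι a b (c + r) f) := by
  simp only [commDefect_apply, waveOp_X hι, vOp_X hι, map_sub, map_add, waveOp_csmul, vOp_csmul]
  have e1 : b + r + c = b + (c + r) := by ring
  have e2 : a + (b + r) + c = a + b + c + r := by ring
  have e3 : a + r + b + c = a + b + c + r := by ring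
  have e4 : a + b + (c + r) = a + b + c + r := by ring
  have e5 : b - 1 + (r : ℤ) = b + r - 1 := by ring
  have e6 : a + 1 + (r : ℤ) = a + r + 1 := by ring
  rw [e1, e2, e3, e4, e5, e6]
  simp only [mul_sub, smul_sub, mul_smul_comm]
  module

theorem commDefect_X_of_notMem (hι : IsTimes ι) (a b c : ℤ) {τ : Time} (hτ : τ ∉ Set.range ι)
    (f : Fn A) : commDefect A hι a b c (X τ * f) = X τ * commDefect A hι a b c f := by
  simp only [commDefect_apply, waveOp_X_of_notMem hι _ hτ, vOp_X_of_notMem hι _ _ hτ, mul_sub,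
    mul_smul_comm]

theorem der_commDefect (hι : IsTimes ι) (a b c : ℤ) (r : ℕ+) (f : Fn A) :
    der (ι r) (commDefect A hι a b c f) = commDefect A hι a b c (der (ι r) f)
      + commDefect A hι (a - r) b c f - commDefect A hι a (b - r) c f
      + commDefect A hι a b (c - r) f := by
  simp only [commDefect_apply, map_sub, map_zsmul, der_waveOp hι, der_vOp hι, map_add]
  have e1 : b - r + c = b + (c - r) := by ring
  have e2 : a + (b - r) + c = a + b + c - r := by ring
  have e3 : a - r + b + c = a + b + c - r := by ring
  have e4 : a + b + (c - r) = a + b + c - r := by ring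
  have e5 : b - 1 - (r : ℤ) = b - r - 1 := by ring
  have e6 : a + 1 - (r : ℤ) = a - r + 1 := by ring
  rw [e1, e2, e3, e4, e5, e6]
  module

theorem der_commDefect_of_notMem (hι : IsTimes ι) (a b c : ℤ) {τ : Time} (hτ : τ ∉ Set.range ι)
    (f : Fn A) : der τ (commDefect A hι a b c f) = commDefect A hι a b c (der τ f) := by
  simp only [commDefect_apply, map_sub, map_zsmul, der_waveOp_of_notMem hι _ hτ,
    der_vOp_of_notMem hι _ _ hτ]

theorem shifts_commDefect (hι : IsTimes ι) (a b c : ℤ) :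
    Shifts (a + b + c) (commDefect A hι a b c) := fun w f hf => by
  rw [commDefect_apply]
  refine Van.sub (Van.sub ?_ ?_) (Van.zsmul ?_ _)
  · exact (shifts_vOp hι _ _ _ _ (shifts_waveOp hι _ _ _ hf)).mono (by omega)
  · exact (shifts_waveOp hι _ _ _ (shifts_vOp hι _ _ _ _ hf)).mono (by omega)
  · exact shifts_waveOp hι _ _ _ hf

/-- The defects for all (a, b, c) together form a family closed under commutators with times and
derivatives. Thus `eq_zero_of_commutators` leaves only their values on 1 at the origin, where the
two expansions of one rational function differ by the delta function. -/
theorem commDefect_eq_zero (hι : IsTimes ι) (a b c : ℤ) : commDefect A hι a b c = 0 := by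
  refine eq_zero_of_commutators (fun p : ℤ × ℤ × ℤ => commDefect A hι p.1 p.2.1 p.2.2)
    (fun p => p.1 + p.2.1 + p.2.2) (fun p => shifts_commDefect hι _ _ _) ?_ ?_ ?_ (a, b, c)
  · rintro τ f hf ⟨a, b, c⟩
    have hf' : ∀ a b c, commDefect A hι a b c f = 0 := fun a b c => hf (a, b, c)
    by_cases hτ : τ ∈ Set.range ι
    · obtain ⟨r, rfl⟩ := hτ
      simp only [commDefect_X, hf', mul_zero, sub_zero, smul_zero, add_zero]
    · simp only [commDefect_X_of_notMem hι _ _ _ hτ, hf', mul_zero]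
  · rintro τ γ hf ⟨a, b, c⟩
    have hf' : ∀ a b c, coeff γ (commDefect A hι a b c 1) = 0 := fun a b c => hf (a, b, c)
    by_cases hτ : τ ∈ Set.range ι
    · obtain ⟨r, rfl⟩ := hτ
      simp only [der_commDefect, der_one, map_zero, map_add, map_sub, hf', sub_zero, add_zero]
    · simp only [der_commDefect_of_notMem hι _ _ _ hτ, der_one, map_zero]
  · rintro ⟨a, b, c⟩
    simp only [commDefect_apply, map_sub, map_zsmul, waveOp_one, coeff_zero_vOp_expX,
      coeff_zero_waveOp_vOp_one, coeff_zero_expX hι, stepZ]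
    by_cases h0 : b + c = 0
    · by_cases ha : a = 0
      · by_cases hb : b ≤ 0
        · simp [h0, ha, hb, show ¬ c + 1 ≤ 0 by omega]
        · simp [h0, ha, hb, show c + 1 ≤ 0 by omega]
      · simp [h0, ha, show a + b + c ≠ 0 by omega]
    · by_cases h1 : b + c = 1
      · by_cases ha : a = -1
        · by_cases hb : b ≤ 0
          · simp [h1, ha, hb, show ¬ c ≤ 0 by omega, show -1 + b + c = 0 by omega]
          · simp [h1, ha, hb, show c ≤ 0 by omega, show -1 + b + c = 0 by omega]
        · simp [h1, ha, show a + b + c ≠ 0 by omega]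
      · simp [h0, h1]

/-- The commutation relation between the vertex operator and the wave operator. -/
theorem vOp_waveOp (hι : IsTimes ι) (a b c : ℤ) (f : Fn A) :
    vOp hι a b (waveOp hι c f) = waveOp hι c (vOp hι (a + 1) (b - 1) f)
      + stepZ (b + c) • waveOp hι (a + b + c) f := by
  have h := commDefect_apply hι a b c f
  rw [commDefect_eq_zero, LinearMap.zero_apply, sub_sub, eq_comm, sub_eq_zero] at h
  exact h

end Vertex

/-! ### The operators W_{t,l,m} and their relation with the wave operator -/

section Vertex

variable {A : Type*} [CommRing A]

theorem Van.asmul {w : ℤ} {f : Fn A} (hf : Van w f) (a : A) : Van w (a • f) := fun γ hγ => by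
  rw [coeff_smul, hf γ hγ, mul_zero]

theorem Null.asmul {I : Type*} {F : I → Fn A} (hF : Null F) (a : I → A) :
    Null fun i => a i • F i :=
  fun w => (hF w).subset fun _ hi hcon => hi (hcon.asmul _)

theorem locSum_asmul {I : Type*} {F : I → Fn A} (hF : Null F) (a : A) :
    locSum (fun i => a • F i) = a • locSum F := by
  simp only [smul_eq_C_mul]
  exact (map_locSum (AddMonoidHom.mulLeft (C a)) (n := 0)
    (fun w f hf => (hf.mul_left _).mono (by omega)) hF).symm

variable [Algebra ℂ A] {ι : ℕ+ → Time}

theorem neg_one_mul_smul (z : ℂ) (φ : Module.End A (Fn A)) : (-1 * z) • φ = -(z • φ) := by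
  ext f : 1
  show (-1 * z) • φ f = -(z • φ f)
  rw [neg_one_mul, neg_smul]

theorem neg_one_smul_end (φ : Module.End A (Fn A)) : (-1 : ℂ) • φ = -φ := by
  ext f : 1
  show (-1 : ℂ) • φ f = -φ f
  rw [neg_smul, one_smul]

theorem expCoeff_xFn (ε : ℂ) (n : ℕ) :
    expCoeff (fun k => ε • xFn A (ι k)) n = LinearMap.mulLeft A (expX A ι ε n) := by
  have h := map_expCoeff ((Algebra.lmul A (Fn A)).restrictScalars ℂ)
    (fun k => ε • (X (ι k) : Fn A)) n
  rw [expX, expZ_natCast]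
  refine Eq.trans ?_ h
  congr 1
  funext k
  rw [map_smul]
  rfl

theorem vertexTerm_apply (a b c d : ℕ) (f : Fn A) : vertexTerm ι a b c d f
    = expX A ι 1 a * expX A ι (-1) b * expD A ι 1 c (expD A ι (-1) d f) := by
  have h1 := expCoeff_xFn (A := A) (ι := ι) 1 a
  have h2 := expCoeff_xFn (A := A) (ι := ι) (-1) b
  simp only [one_smul, neg_one_smul_end] at h1 h2
  have h3 : expD A ι 1 c = expCoeff (fun k => ((k : ℕ) : ℂ)⁻¹ • dFn A (ι k)) c := by
    rw [expD, expZ_natCast]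
    simp only [one_mul]
  have h4 : expD A ι (-1) d = expCoeff (fun k => -(((k : ℕ) : ℂ)⁻¹ • dFn A (ι k))) d := by
    rw [expD, expZ_natCast]
    simp only [neg_one_mul_smul]
  rw [vertexTerm, h1, h2, ← h3, ← h4]
  simp only [Module.End.mul_apply, LinearMap.mulLeft_apply, mul_assoc]

theorem gCoeff_eq (n : ℕ) : gCoeff (A := A) ι n = expD A ι (-1) n := by
  rw [expD, expZ_natCast, gCoeff]
  simp only [neg_one_mul_smul]

/-- Once i and j are fixed, the derivative orders (c, d) determine the exponents a = i + d and b = j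
+ c. This turns the sum over four natural numbers into a sum over two integers, with zero terms for
negative indices. -/
theorem vertexCoeff_eq (hι : IsTimes ι) (i j : ℤ) (f : Fn A) :
    vertexCoeff ι i j f = vOp hι i j f := by
  ext γ
  rw [vOp_apply, coeff_locSum]
  show ∑ᶠ q : (ℕ × ℕ) × (ℕ × ℕ), coeff γ (if (q.1.1 : ℤ) - q.2.2 = i ∧ (q.1.2 : ℤ) - q.2.1 = j then
      vertexTerm ι q.1.1 q.1.2 q.2.1 q.2.2 f else 0) = _
  set s : Set ((ℕ × ℕ) × (ℕ × ℕ)) := {q | (q.1.1 : ℤ) - q.2.2 = i ∧ (q.1.2 : ℤ) - q.2.1 = j}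
  set t : Set (ℤ × ℤ) := {p | 0 ≤ p.1 ∧ 0 ≤ p.2 ∧ 0 ≤ i + p.2 ∧ 0 ≤ j + p.1}
  have hs := finsum_mem_inter_support (fun q : (ℕ × ℕ) × (ℕ × ℕ) =>
    coeff γ (if (q.1.1 : ℤ) - q.2.2 = i ∧ (q.1.2 : ℤ) - q.2.1 = j then
      vertexTerm ι q.1.1 q.1.2 q.2.1 q.2.2 f else 0)) s
  have ht := finsum_mem_inter_support (fun p => coeff γ (vTerm A ι i j p f)) t
  rw [Set.inter_eq_right.2, finsum_mem_support] at hs ht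
  · rw [hs, ht]
    refine finsum_mem_eq_of_bijOn (fun q => ((q.2.1 : ℤ), (q.2.2 : ℤ))) ⟨?_, ?_, ?_⟩ ?_
    · rintro ⟨⟨a, b⟩, c, d⟩ h
      simp only [s, t, Set.mem_ofPred_eq] at h ⊢
      omega
    · rintro ⟨⟨a, b⟩, c, d⟩ h ⟨⟨a', b'⟩, c', d'⟩ h' heq
      simp only [s, Set.mem_ofPred_eq, Prod.mk.injEq] at h h' heq ⊢
      omega
    · rintro ⟨c, d⟩ h
      simp only [t, Set.mem_ofPred_eq] at h
      refine ⟨(((i + d).toNat, (j + c).toNat), (c.toNat, d.toNat)), ?_, ?_⟩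
      · simp only [s, Set.mem_ofPred_eq]
        omega
      · simp only [Prod.mk.injEq]
        omega
    · rintro ⟨⟨a, b⟩, c, d⟩ h
      simp only [s, Set.mem_ofPred_eq] at h
      rw [if_pos h, vertexTerm_apply, vTerm_apply, ← h.1, ← h.2]
      simp
  · intro p hp
    by_contra hcon
    simp only [t, Set.mem_ofPred_eq] at hcon
    refine hp ?_
    dsimp only
    by_cases h : p.1 < 0 ∨ p.2 < 0
    · rw [vTerm_of_neg i j p h, map_zero]
    · rw [vTerm_apply]
      by_cases h1 : i + p.2 < 0
      · rw [expX_of_neg 1 h1, zero_mul, zero_mul, map_zero]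
      · rw [expX_of_neg (n := j + p.1) (-1) (by omega), mul_zero, zero_mul, map_zero]
  · intro q hq
    by_contra hcon
    refine hq ?_
    dsimp only
    rw [if_neg (by simpa only [s, Set.mem_ofPred_eq] using hcon), map_zero]

theorem null_wOp (hι : IsTimes ι) (t : A) (l : ℤ) (m : ℕ) (f : Fn A) :
    Null fun i : ℤ => fall (t + i) m • vOp hι i (-l - i) f := by
  refine Null.of_subset (fun w => Set.Icc (-l - w) w) (fun w => Set.finite_Icc _ _)
    fun w i hi => ?_
  refine ((van_vOp hι i (-l - i) f).mono ?_).asmul _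
  rw [Set.mem_Icc] at hi
  omega

theorem wOp_eq (hι : IsTimes ι) (t : A) (l : ℤ) (m : ℕ) (f : Fn A) :
    wOp ι t l m f = locSum fun i : ℤ => fall (t + i) m • vOp hι i (-l - i) f := by
  simp only [← vertexCoeff_eq]
  rfl

/-- The commutation relation of `W_{t,l,m+1}` with the wave operator. -/
theorem wOp_waveOp (hι : IsTimes ι) (t : A) (l j : ℤ) (m : ℕ) (f : Fn A) :
    wOp ι (t + 1) l (m + 1) (waveOp hι j f) = waveOp hι j (wOp ι t l (m + 1) f)
      + (((m : A) + 1) * fall (t + j - l) m) • waveOp hι (j - l) f := by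
  -- The factor λ/μ in the commutation relation is the substitution i ↦ i + 1; it is compensated by
  -- the shift from t to t + 1.
  have e := locSum_comp_equiv (Equiv.addRight (1 : ℤ))
    (fun i : ℤ => fall (t + i) (m + 1) • waveOp hι j (vOp hι i (-l - i) f))
  have n1 := (null_wOp hι t l (m + 1) f).map (shifts_waveOp (A := A) hι j)
  simp only [map_smul] at n1
  have n2 := n1.comp (Equiv.addRight (1 : ℤ)).injective
  have n3 := null_wOp hι (t + 1) l (m + 1) (waveOp hι j f)
  rw [wOp_eq hι, wOp_eq hι, map_locSum _ (shifts_waveOp hι j) (null_wOp hι _ _ _ _)]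
  simp only [map_smul]
  rw [← e, ← sub_eq_iff_eq_add', ← locSum_sub n3 n2]
  -- The two vertex terms cancel, and `stepZ` leaves only i = j - l and i = j - l - 1.
  have h : ∀ i : ℤ, fall (t + 1 + i) (m + 1) • vOp hι i (-l - i) (waveOp hι j f)
      - fall (t + (Equiv.addRight (1 : ℤ) i : ℤ)) (m + 1) •
        waveOp hι j (vOp hι (Equiv.addRight (1 : ℤ) i) (-l - Equiv.addRight (1 : ℤ) i) f)
      = (if i = j - l then fall (t + 1 + j - l) (m + 1) • waveOp hι (j - l) f else 0)
        - (if i = j - l - 1 then fall (t + j - l) (m + 1) • waveOp hι (j - l) f else 0) := by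
    intro i
    have e1 : Equiv.addRight (1 : ℤ) i = i + 1 := rfl
    have e2 : -l - (i + 1) = -l - i - 1 := by ring
    have e3 : t + ((i + 1 : ℤ) : A) = t + 1 + i := by push_cast; ring
    have e4 : i + (-l - i) + j = j - l := by ring
    rw [e1, e2, e3, vOp_waveOp, smul_add, add_sub_cancel_left, e4, stepZ]
    by_cases h0 : i = j - l
    · have h1 : t + 1 + (i : A) = t + 1 + j - l := by rw [h0]; push_cast; ring
      rw [h1, if_pos h0, if_neg (c := i = j - l - 1) (by omega), if_pos (by omega),
        if_neg (by omega)]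
      simp
    · by_cases h2 : i = j - l - 1
      · have h1 : t + 1 + (i : A) = t + j - l := by rw [h2]; push_cast; ring
        rw [h1, if_neg h0, if_pos h2, if_neg (by omega), if_pos (by omega)]
        simp
      · rw [if_neg h0, if_neg h2, if_neg (by omega), if_neg (by omega)]
        simp
  rw [locSum_congr h]
  have n4 : ∀ (a : ℤ) (g : Fn A), Null fun i : ℤ => if i = a then g else 0 := fun a g w =>
    (Set.finite_singleton a).subset fun i hi => by
      by_contra hcon
      refine hi ?_
      dsimp only
      rw [if_neg (by simpa using hcon)]
      exact van_zero _
  rw [locSum_sub (n4 _ _) (n4 _ _), locSum_eq_single (j - l) (fun i hi => if_neg hi),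
    locSum_eq_single (j - l - 1) (fun i hi => if_neg hi), if_pos rfl, if_pos rfl, ← sub_smul]
  congr 1
  -- The two surviving terms form a finite difference of falling factorials, which produces the
  -- factor m + 1 and lowers the degree by one.
  have := fall_add_one_sub (t + j - l) m
  rw [← this]
  congr 2
  ring

end Vertex

/-! ### An abstract recursion for W_{t,l,m}, with replaceable derivatives -/

section Recursion

variable {A N : Type*} [CommRing A] [Ring N]

/-- The operators `W_{t,l,m}` on the power series over a ring `N`, built from the times and from the
operators `D k` in place of the derivatives. -/
def wRec (φ : A →+* N) (ι : ℕ+ → Time) (D : ℕ+ → MvPowerSeries Time N → MvPowerSeries Time N) :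
    ℕ → A → ℤ → MvPowerSeries Time N → MvPowerSeries Time N
  | 0, _, l, f => if l = 0 then f else 0
  | m + 1, t, l, f => C (φ (t - m)) * wRec φ ι D m t l f
      + locSum fun k : ℕ+ => (k : ℕ) • (X (ι k) * wRec φ ι D m (t + (k : ℕ)) (l + k) f)
        + wRec φ ι D m (t - (k : ℕ)) (l - k) (D k f)

theorem wRec_zero (φ : A →+* N) (ι : ℕ+ → Time)
    (D : ℕ+ → MvPowerSeries Time N → MvPowerSeries Time N) (t : A) (l : ℤ)
    (f : MvPowerSeries Time N) : wRec φ ι D 0 t l f = if l = 0 then f else 0 := rfl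

theorem wRec_succ (φ : A →+* N) (ι : ℕ+ → Time)
    (D : ℕ+ → MvPowerSeries Time N → MvPowerSeries Time N) (m : ℕ) (t : A) (l : ℤ)
    (f : MvPowerSeries Time N) : wRec φ ι D (m + 1) t l f = C (φ (t - m)) * wRec φ ι D m t l f
      + locSum fun k : ℕ+ => (k : ℕ) • (X (ι k) * wRec φ ι D m (t + (k : ℕ)) (l + k) f)
        + wRec φ ι D m (t - (k : ℕ)) (l - k) (D k f) := rfl

theorem shifts_wRec (φ : A →+* N) {ι : ℕ+ → Time} (hι : IsTimes ι)
    {D : ℕ+ → MvPowerSeries Time N → MvPowerSeries Time N} (hD : ∀ k : ℕ+, Shifts (-(k : ℤ)) (D k))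
    (m : ℕ) (t : A) (l : ℤ) : Shifts (-l) (wRec φ ι D m t l) := by
  induction m generalizing t l with
  | zero =>
    intro w f hf
    rw [wRec_zero]
    split_ifs with h
    · subst h
      simpa using hf
    · exact van_zero _
  | succ m ih =>
    intro w f hf
    rw [wRec_succ]
    refine ((ih t l w f hf).mul_left _).add (Van.locSum fun k => Van.add (Van.nsmul ?_ _) ?_)
    · exact ((hι.van_X k).mul (ih _ _ w f hf)).mono (by omega)
    · exact (ih _ _ _ _ (hD k w f hf)).mono (by omega)

theorem null_wRec (φ : A →+* N) {ι : ℕ+ → Time} (hι : IsTimes ι)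
    {D : ℕ+ → MvPowerSeries Time N → MvPowerSeries Time N} (hD : ∀ k : ℕ+, Shifts (-(k : ℤ)) (D k))
    (m : ℕ) (t : A) (l : ℤ) (f : MvPowerSeries Time N) :
    Null fun k : ℕ+ => (k : ℕ) • (X (ι k) * wRec φ ι D m (t + (k : ℕ)) (l + k) f)
        + wRec φ ι D m (t - (k : ℕ)) (l - k) (D k f) := by
  refine Null.of_subset (fun w => (fun k : ℕ+ => (k : ℕ)) ⁻¹' Set.Iic (w + l.natAbs))
    (fun w => (Set.finite_Iic _).preimage PNat.coe_injective.injOn) fun w k hk => ?_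
  rw [Set.mem_preimage, Set.mem_Iic] at hk
  refine Van.add (Van.nsmul ?_ _) ?_
  · exact ((hι.van_X k).mul_right _).mono (by omega)
  · exact (shifts_wRec φ hι hD m _ _ 0 _ (van_of_nonpos le_rfl _)).mono (by omega)

/-- The operators `W_{t,l,m}` commute with maps that commute with the times and with the operators
that replace the derivatives. -/
theorem map_wRec {B N' : Type*} [CommRing B] [Ring N'] (φ : A →+* N) (φ' : B →+* N') (ρ : A →+* B)
    {ι : ℕ+ → Time} (hι : IsTimes ι) {D : ℕ+ → MvPowerSeries Time N → MvPowerSeries Time N}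
    (hD : ∀ k : ℕ+, Shifts (-(k : ℤ)) (D k))
    {D' : ℕ+ → MvPowerSeries Time N' → MvPowerSeries Time N'}
    (ψ : MvPowerSeries Time N →+ MvPowerSeries Time N') {n : ℤ} (hψ : Shifts n ψ)
    (hC : ∀ a f, ψ (C (φ a) * f) = C (φ' (ρ a)) * ψ f)
    (hX : ∀ k f, ψ (X (ι k) * f) = X (ι k) * ψ f) (hDD : ∀ k f, ψ (D k f) = D' k (ψ f))
    (m : ℕ) (t : A) (l : ℤ) (f : MvPowerSeries Time N) :
    ψ (wRec φ ι D m t l f) = wRec φ' ι D' m (ρ t) l (ψ f) := by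
  induction m generalizing t l f with
  | zero =>
    rw [wRec_zero, wRec_zero]
    split_ifs
    · rfl
    · rw [map_zero]
  | succ m ih =>
    rw [wRec_succ, wRec_succ, map_add, hC, ih, map_locSum ψ hψ (null_wRec φ hι hD m t l f), map_sub,
      map_natCast]
    congr 1
    refine locSum_congr fun k => ?_
    rw [map_add, map_nsmul, hX, ih, ih, hDD, map_add, map_sub, map_natCast]

end Recursion

/-! ### The vertex operator on the diagonal -/

section Vertex

variable {A : Type*} [CommRing A] [Algebra ℂ A] {ι : ℕ+ → Time}

theorem Null.congr {R I : Type*} [Ring R] {F G : I → MvPowerSeries Time R} (hF : Null F)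
    (h : ∀ i, F i = G i) : Null G := funext h ▸ hF

theorem null_wOp_zero (hι : IsTimes ι) (l : ℤ) (f : Fn A) :
    Null fun i : ℤ => vOp hι i (-l - i) f := by
  have h := null_wOp hι (0 : A) l 0 f
  simpa only [fall_zero, one_smul] using h

/-- This is X(λ,λ) = 1. On the diagonal the commutators (μ^r - λ^r) X and (λ⁻ʳ - μ⁻ʳ)/r · X vanish,
so the coefficients commute with all times and derivatives and are fixed by their value on 1 at the
origin. -/
theorem locSum_vOp (hι : IsTimes ι) (l : ℤ) (f : Fn A) :
    (locSum fun i : ℤ => vOp hι i (-l - i) f) = if l = 0 then f else 0 := by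
  set F : ℤ → Module.End A (Fn A) := fun l =>
    locSumEnd (fun i : ℤ => vOp hι i (-l - i)) (null_wOp_zero hι l) with hFdef
  have hF : ∀ l f, F l f = locSum fun i : ℤ => vOp hι i (-l - i) f := fun l f => rfl
  have e1 : ∀ (l : ℤ) (r : ℕ+) (f : Fn A),
      (locSum fun i : ℤ => vOp hι i (-l - i + r) f) = F (l - r) f := by
    intro l r f
    rw [hF]
    refine locSum_congr fun i => ?_
    congr 2
    ring
  have e2 : ∀ (l : ℤ) (r : ℕ+) (f : Fn A),
      (locSum fun i : ℤ => vOp hι (i + r) (-l - i) f) = F (l - r) f := by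
    intro l r f
    refine (locSum_congr fun i => ?_).trans (locSum_comp_equiv (Equiv.addRight (r : ℤ))
      fun i => vOp hι i (-(l - r) - i) f)
    show _ = vOp hι (i + r) (-(l - r) - (i + r)) f
    congr 2
    ring
  have e3 : ∀ (l : ℤ) (r : ℕ+) (f : Fn A),
      (locSum fun i : ℤ => vOp hι (i - r) (-l - i) f) = F (l + r) f := by
    intro l r f
    refine (locSum_congr fun i => ?_).trans (locSum_comp_equiv (Equiv.subRight (r : ℤ))
      fun i => vOp hι i (-(l + r) - i) f)
    show _ = vOp hι (i - r) (-(l + r) - (i - r)) f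
    congr 2
    ring
  have e4 : ∀ (l : ℤ) (r : ℕ+) (f : Fn A),
      (locSum fun i : ℤ => vOp hι i (-l - i - r) f) = F (l + r) f := by
    intro l r f
    rw [hF]
    refine locSum_congr fun i => ?_
    congr 2
    ring
  have n1 : ∀ (l : ℤ) (r : ℕ+) (f : Fn A), Null fun i : ℤ => vOp hι i (-l - i + r) f := by
    intro l r f
    have := null_wOp_zero hι (l - r) f
    convert this using 4
    ring
  have n2 : ∀ (l : ℤ) (r : ℕ+) (f : Fn A), Null fun i : ℤ => vOp hι (i + r) (-l - i) f := by
    intro l r f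
    have := (null_wOp_zero hι (l - r) f).comp (Equiv.addRight (r : ℤ)).injective
    refine this.congr fun i => ?_
    show vOp hι (i + r) (-(l - r) - (i + r)) f = _
    congr 2
    ring
  have n3 : ∀ (l : ℤ) (r : ℕ+) (f : Fn A), Null fun i : ℤ => vOp hι (i - r) (-l - i) f := by
    intro l r f
    have := (null_wOp_zero hι (l + r) f).comp (Equiv.subRight (r : ℤ)).injective
    refine this.congr fun i => ?_
    show vOp hι (i - r) (-(l + r) - (i - r)) f = _
    congr 2
    ring
  have n4 : ∀ (l : ℤ) (r : ℕ+) (f : Fn A), Null fun i : ℤ => vOp hι i (-l - i - r) f := by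
    intro l r f
    have := null_wOp_zero hι (l + r) f
    convert this using 4
    ring
  have hX : ∀ l r f, F l (X (ι r) * f) = X (ι r) * F l f := by
    intro l r f
    rw [hF, hF, X_mul_locSum _ (null_wOp_zero hι l f)]
    simp only [vOp_X hι]
    have h1 : Null fun i : ℤ => vOp hι i (-l - i + r) f - vOp hι (i + r) (-l - i) f := by
      simp only [sub_eq_add_neg]
      exact (n1 l r f).add ((n2 l r f).map (φ := fun f => -f) (n := 0)
        fun w f hf => by simpa using hf.neg)
    rw [locSum_add ((null_wOp_zero hι l f).map (shifts_X_mul _)) (h1.csmul _),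
      locSum_csmul h1, locSum_sub (n1 l r f) (n2 l r f), e1, e2, sub_self, smul_zero, add_zero]
  have hD : ∀ l r f, der (ι r) (F l f) = F l (der (ι r) f) := by
    intro l r f
    rw [hF, hF, map_locSum (der (ι r)) (hι.shifts_der r) (null_wOp_zero hι l f)]
    simp only [der_vOp hι]
    rw [locSum_sub ((null_wOp_zero hι l _).add (n3 l r f)) (n4 l r f),
      locSum_add (null_wOp_zero hι l _) (n3 l r f), e3, e4, add_sub_cancel_right]
  -- The criterion is applied to F l minus the expected scalar; at the origin only i = 0
  -- contributes.
  have key := eq_zero_of_commutators (fun l => F l - (if l = 0 then 1 else 0)) (fun l => -l)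
    (fun l w f hf => by
      refine Van.sub ?_ ?_
      · exact Van.locSum fun i => (shifts_vOp hι _ _ _ _ hf).mono (by omega)
      · split_ifs with h
        · subst h
          simpa using hf
        · exact van_zero _) (fun τ f h l => by
      have h1 := h l
      rw [LinearMap.sub_apply] at h1 ⊢
      have h2 : (if l = 0 then 1 else 0 : Module.End A (Fn A)) (X τ * f)
          = X τ * (if l = 0 then 1 else 0 : Module.End A (Fn A)) f := by
        split_ifs
        · rfl
        · simp
      have h3 : F l (X τ * f) = X τ * F l f := by
        by_cases hτ : τ ∈ Set.range ι
        · obtain ⟨r, rfl⟩ := hτ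
          exact hX l r f
        · rw [hF, hF, X_mul_locSum _ (null_wOp_zero hι l f)]
          exact locSum_congr fun i => vOp_X_of_notMem hι _ _ hτ f
      rw [h2, h3, ← mul_sub, h1, mul_zero]) (fun τ γ h l => by
      have h1 : der τ (F l 1) = F l (der τ 1) := by
        by_cases hτ : τ ∈ Set.range ι
        · obtain ⟨r, rfl⟩ := hτ
          exact hD l r 1
        · rw [hF, hF, map_locSum (der τ) (shifts_der τ) (null_wOp_zero hι l 1)]
          exact locSum_congr fun i => der_vOp_of_notMem hι _ _ hτ 1
      rw [LinearMap.sub_apply, map_sub, h1, der_one, map_zero]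
      split_ifs <;> simp [der_one]) (fun l => by
      rw [LinearMap.sub_apply, map_sub, hF, coeff_locSum, finsum_eq_single _ 0]
      · rw [vOp_one, coeff_zero_mul, coeff_zero_expX hι, coeff_zero_expX hι, if_pos rfl, one_mul,
          sub_zero]
        by_cases h : l = 0
        · simp [h]
        · rw [if_neg h, if_neg (by omega)]
          simp
      · intro i hi
        rw [vOp_one, coeff_zero_mul, coeff_zero_expX hι, if_neg hi, zero_mul]) l
  have h1 := LinearMap.congr_fun key f
  rw [LinearMap.sub_apply, LinearMap.zero_apply, sub_eq_zero, hF] at h1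
  rw [h1]
  split_ifs <;> rfl

end Vertex

/-! ### Euler's identity for the vertex operator -/

section Vertex

variable {A : Type*} [CommRing A] [Algebra ℂ A] {ι : ℕ+ → Time}

theorem nsmul_locSum {R I : Type*} [Ring R] (n : ℕ) {F : I → MvPowerSeries Time R}
    (hF : Null F) : n • locSum F = locSum fun i => n • F i :=
  map_locSum (nsmulAddMonoidHom n) (n := 0) (fun w f hf => by simpa using hf.nsmul n) hF

/-- The part of μ∂_μ that falls on e^{ξ(x,μ)}, where it brings down ∑ k x_k μ^k. -/
theorem euler_vTerm_left (hι : IsTimes ι) (i j : ℤ) (p : ℤ × ℤ) (f : Fn A) :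
    (i + p.2) • vTerm A ι i j p f
      = locSum fun k : ℕ+ => (k : ℕ) • (X (ι k) * vTerm A ι (i - k) j p f) := by
  have hn : Null fun k : ℕ+ => (k : ℕ) •
      ((1 : ℂ) • X (ι k) * expX A ι 1 (i + p.2 - k)) := by
    refine Null.of_subset (fun w => (fun k : ℕ+ => (k : ℕ)) ⁻¹' Set.Iic w)
      (fun w => (Set.finite_Iic _).preimage PNat.coe_injective.injOn) fun w k hk => ?_
    rw [Set.mem_preimage, Set.mem_Iic] at hk
    rw [one_smul]
    exact (((hι.van_X k).mul_right _).mono (by omega)).nsmul _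
  have h1 : (i + p.2) • vTerm A ι i j p f
      = (expX A ι (-1) (j + p.1) * expD A ι 1 p.1 (expD A ι (-1) p.2 f))
        * ((i + p.2) • expX A ι 1 (i + p.2)) := by
    rw [vTerm_apply, mul_smul_comm]
    congr 1
    ring
  rw [h1, euler_expX, X_mul_locSum _ hn]
  refine locSum_congr fun k => ?_
  rw [vTerm_apply, one_smul, mul_smul_comm, sub_add_eq_add_sub]
  congr 1
  ring

/-- The part of μ∂_μ that falls on exp(-∑ μ⁻ᵏ ∂_k / k), where it brings down ∑ μ⁻ᵏ ∂_k. The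
derivative is commuted to the right end so that it acts on f first. -/
theorem euler_vTerm_right (hι : IsTimes ι) (i j : ℤ) (p : ℤ × ℤ) (f : Fn A) :
    (-p.2) • vTerm A ι i j p f
      = locSum fun k : ℕ+ => vTerm A ι (i + k) j (p.1, p.2 - k) (der (ι k) f) := by
  have hs : Null fun k : ℕ+ => (-1 : ℂ) • der (ι k) (expD A ι (-1) (p.2 - k) f) := by
    refine Null.of_subset (fun w => (fun k : ℕ+ => (k : ℕ)) ⁻¹' Set.Iic p.2.natAbs)
      (fun w => (Set.finite_Iic _).preimage PNat.coe_injective.injOn) fun w k hk => ?_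
    rw [Set.mem_preimage, Set.mem_Iic] at hk
    rw [expD_of_neg _ (by omega), LinearMap.zero_apply, map_zero, smul_zero]
    exact van_zero _
  have h1 : (-p.2) • vTerm A ι i j p f
      = (-(expX A ι 1 (i + p.2) * expX A ι (-1) (j + p.1)))
        * expD A ι 1 p.1 (p.2 • expD A ι (-1) p.2 f) := by
    rw [vTerm_apply, map_zsmul, mul_smul_comm, neg_mul, smul_neg, neg_smul]
  rw [h1, euler_expD, map_locSum _ (shifts_expD hι 1 p.1) hs,
    X_mul_locSum _ (hs.map (shifts_expD hι 1 p.1))]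
  refine locSum_congr fun k => ?_
  rw [vTerm_apply, expD_csmul, expD_der (-1)]
  dsimp only
  rw [show i + k + (p.2 - k) = i + p.2 by ring, mul_smul_comm, neg_smul, one_smul, neg_mul,
    neg_neg]

/-- Euler's identity for the vertex operator. -/
theorem euler_vOp (hι : IsTimes ι) (i j : ℤ) (f : Fn A) :
    i • vOp hι i j f = locSum fun k : ℕ+ => (k : ℕ) • (X (ι k) * vOp hι (i - k) j f)
      + vOp hι (i + k) j (der (ι k) f) := by
  obtain ⟨T1, hT1⟩ : ∃ T1 : ℤ × ℤ → ℕ+ → Fn A,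
      ∀ p k, T1 p k = (k : ℕ) • (X (ι k) * vTerm A ι (i - k) j p f) := ⟨_, fun _ _ => rfl⟩
  obtain ⟨T2, hT2⟩ : ∃ T2 : ℤ × ℤ → ℕ+ → Fn A,
      ∀ p k, T2 p k = vTerm A ι (i + k) j (p.1, p.2 - k) (der (ι k) f) := ⟨_, fun _ _ => rfl⟩
  have hK : ∀ w : ℕ, ((Set.Icc 0 (w - j) ×ˢ Set.Icc 0 (w - i) : Set (ℤ × ℤ)) ×ˢ
      ((fun k : ℕ+ => (k : ℕ)) ⁻¹' Set.Iic (w + i.natAbs))).Finite := fun w =>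
    ((Set.finite_Icc _ _).prod (Set.finite_Icc _ _)).prod
      ((Set.finite_Iic _).preimage PNat.coe_injective.injOn)
  have n1 : Null fun q : (ℤ × ℤ) × ℕ+ => T1 q.1 q.2 := by
    refine Null.of_subset _ hK fun w q hq => ?_
    rw [hT1]
    refine Van.nsmul ?_ _
    by_cases h : q.1.1 < 0 ∨ q.1.2 < 0
    · rw [vTerm_of_neg _ _ _ h, mul_zero]
      exact van_zero _
    · refine ((hι.van_X _).mul (van_vTerm hι (i - q.2) j q.1 f)).mono ?_
      simp only [Set.mem_prod, Set.mem_Icc, Set.mem_preimage, Set.mem_Iic] at hq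
      omega
  have n2 : Null fun q : (ℤ × ℤ) × ℕ+ => T2 q.1 q.2 := by
    refine Null.of_subset _ hK fun w q hq => ?_
    rw [hT2]
    by_cases h : q.1.1 < 0 ∨ q.1.2 - q.2 < 0
    · rw [vTerm_of_neg _ _ _ h]
      exact van_zero _
    · refine (van_vTerm hι (i + q.2) j (q.1.1, q.1.2 - q.2) _).mono ?_
      simp only [Set.mem_prod, Set.mem_Icc, Set.mem_preimage, Set.mem_Iic] at hq
      dsimp only
      omega
  -- The weight i splits as (i + p.2) + (-p.2), the powers of μ in the two factors of X that contain
  -- μ.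
  have hterm : ∀ p, i • vTerm A ι i j p f = locSum fun k => T1 p k + T2 p k := by
    intro p
    have m1 : Null fun k => T1 p k := n1.comp (Prod.mk_right_injective p)
    have m2 : Null fun k => T2 p k := n2.comp (Prod.mk_right_injective p)
    rw [locSum_add m1 m2]
    have a1 : locSum (T1 p) = (i + p.2) • vTerm A ι i j p f := by
      rw [euler_vTerm_left hι, funext (hT1 p)]
    have a2 : locSum (T2 p) = (-p.2) • vTerm A ι i j p f := by
      rw [euler_vTerm_right hι, funext (hT2 p)]
    rw [a1, a2, ← add_smul]
    congr 1
    ring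
  have hi : i • vOp hι i j f = locSum fun p => i • vTerm A ι i j p f :=
    map_locSum (zsmulAddGroupHom i : Fn A →+ Fn A) (n := 0)
      (fun w f hf => by simpa using hf.zsmul i) (null_vTerm hι i j f)
  rw [hi, locSum_congr hterm, locSum_comm (n1.add n2)]
  refine locSum_congr fun k => ?_
  have m1 : Null fun p => T1 p k := n1.comp (Prod.mk_left_injective k)
  have m2 : Null fun p => T2 p k := n2.comp (Prod.mk_left_injective k)
  rw [locSum_add m1 m2]
  congr 1
  · rw [vOp_apply, X_mul_locSum _ (null_vTerm hι (i - k) j f),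
      nsmul_locSum _ ((null_vTerm hι (i - k) j f).map (shifts_X_mul (ι k)))]
    exact locSum_congr fun p => hT1 p k
  · refine (locSum_congr fun p => hT2 p k).trans ?_
    exact locSum_comp_equiv ((Equiv.refl ℤ).prodCongr (Equiv.subRight (k : ℤ)))
      fun p => vTerm A ι (i + k) j p (der (ι k) f)

end Vertex

/-! ### The recursion for W_{t,l,m} -/

section Vertex

variable {A : Type*} [CommRing A] [Algebra ℂ A] {ι : ℕ+ → Time}

theorem wOp_zero (hι : IsTimes ι) (t : A) (l : ℤ) (f : Fn A) :
    wOp ι t l 0 f = if l = 0 then f else 0 := by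
  rw [wOp_eq hι, ← locSum_vOp hι]
  exact locSum_congr fun i => by rw [fall_zero, one_smul]

/-- The next falling factorial has the extra factor t + i - m = (t - m) + i, and Euler's identity
for the vertex operator replaces i by times and derivatives. Reindexing i by ±k moves the parameters
to t ± k and l ± k. -/
theorem wOp_succ (hι : IsTimes ι) (t : A) (l : ℤ) (m : ℕ) (f : Fn A) :
    wOp ι t l (m + 1) f = (t - m) • wOp ι t l m f
      + locSum fun k : ℕ+ => (k : ℕ) • (X (ι k) * wOp ι (t + (k : ℕ)) (l + k) m f)
        + wOp ι (t - (k : ℕ)) (l - k) m (der (ι k) f) := by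
  obtain ⟨T1, hT1⟩ : ∃ T1 : ℤ → ℕ+ → Fn A, ∀ i k, T1 i k
      = fall (t + i) m • ((k : ℕ) • (X (ι k) * vOp hι (i - k) (-l - i) f)) :=
    ⟨_, fun _ _ => rfl⟩
  obtain ⟨T2, hT2⟩ : ∃ T2 : ℤ → ℕ+ → Fn A, ∀ i k, T2 i k
      = fall (t + i) m • vOp hι (i + k) (-l - i) (der (ι k) f) := ⟨_, fun _ _ => rfl⟩
  have hK : ∀ w : ℕ, (Set.Icc (-l - w) (w : ℤ) ×ˢ
      ((fun k : ℕ+ => (k : ℕ)) ⁻¹' Set.Iic (2 * w + l.natAbs))).Finite := fun w =>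
    (Set.finite_Icc _ _).prod ((Set.finite_Iic _).preimage PNat.coe_injective.injOn)
  have n1 : Null fun q : ℤ × ℕ+ => T1 q.1 q.2 := by
    refine Null.of_subset _ hK fun w q hq => ?_
    rw [hT1]
    refine (Van.nsmul (((hι.van_X _).mul (van_vOp hι _ _ f)).mono ?_) _).asmul _
    simp only [Set.mem_prod, Set.mem_Icc, Set.mem_preimage, Set.mem_Iic] at hq
    omega
  have n2 : Null fun q : ℤ × ℕ+ => T2 q.1 q.2 := by
    refine Null.of_subset _ hK fun w q hq => ?_
    rw [hT2]
    refine ((van_vOp hι _ _ _).mono ?_).asmul _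
    simp only [Set.mem_prod, Set.mem_Icc, Set.mem_preimage, Set.mem_Iic] at hq
    omega
  have hterm : ∀ i : ℤ, fall (t + i) (m + 1) • vOp hι i (-l - i) f
      = (t - m) • (fall (t + i) m • vOp hι i (-l - i) f) + locSum fun k => T1 i k + T2 i k := by
    intro i
    have m1 : Null fun k => T1 i k := n1.comp (Prod.mk_right_injective i)
    have m2 : Null fun k => T2 i k := n2.comp (Prod.mk_right_injective i)
    have e1 : fall (t + i) (m + 1) = (t - m) * fall (t + i) m + fall (t + i) m * (i : A) := by
      rw [fall_succ]
      ring
    have hn : Null fun k : ℕ+ => (k : ℕ) • (X (ι k) * vOp hι (i - k) (-l - i) f)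
        + vOp hι (i + k) (-l - i) (der (ι k) f) := by
      refine Null.of_subset (fun w => (fun k : ℕ+ => (k : ℕ)) ⁻¹' Set.Iic (w + i.natAbs))
        (fun w => (Set.finite_Iic _).preimage PNat.coe_injective.injOn) fun w k hk => ?_
      rw [Set.mem_preimage, Set.mem_Iic] at hk
      exact (Van.nsmul (((hι.van_X _).mul_right _).mono (by omega)) _).add
        ((van_vOp hι _ _ _).mono (by omega))
    rw [e1, add_smul, mul_smul, mul_smul, Int.cast_smul_eq_zsmul, euler_vOp hι,
      ← locSum_asmul hn]
    congr 1
    refine locSum_congr fun k => ?_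
    rw [hT1, hT2, smul_add]
  rw [wOp_eq hι, locSum_congr hterm,
    locSum_add ((null_wOp hι t l m f).asmul _) (Null.locSum (n1.add n2)),
    locSum_asmul (null_wOp hι t l m f), ← wOp_eq hι, locSum_comm (n1.add n2)]
  congr 1
  refine locSum_congr fun k => ?_
  rw [locSum_add (n1.comp (Prod.mk_left_injective k)) (n2.comp (Prod.mk_left_injective k))]
  congr 1
  · rw [wOp_eq hι, X_mul_locSum _ (null_wOp hι _ _ m f),
      nsmul_locSum _ ((null_wOp hι _ _ m f).map (shifts_X_mul (ι k)))]
    refine Eq.trans (locSum_congr fun i => ?_) (locSum_comp_equiv (Equiv.subRight (k : ℤ))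
      fun i : ℤ => (k : ℕ) • (X (ι k) * fall (t + (k : ℕ) + (i : A)) m •
        vOp hι i (-(l + k) - i) f))
    show T1 i k = (k : ℕ) • (X (ι k) * fall (t + (k : ℕ) + ((i - k : ℤ) : A)) m •
      vOp hι (i - k) (-(l + k) - (i - k)) f)
    rw [hT1, mul_smul_comm, smul_comm, show -(l + k) - (i - k) = -l - i by ring]
    congr 3
    push_cast
    ring
  · rw [wOp_eq hι]
    refine Eq.trans (locSum_congr fun i => ?_) (locSum_comp_equiv (Equiv.addRight (k : ℤ))
      fun i : ℤ => fall (t - (k : ℕ) + (i : A)) m • vOp hι i (-(l - k) - i) (der (ι k) f))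
    show T2 i k = fall (t - (k : ℕ) + ((i + k : ℤ) : A)) m •
      vOp hι (i + k) (-(l - k) - (i + k)) (der (ι k) f)
    rw [hT2, show -(l - k) - (i + k) = -l - i by ring]
    congr 2
    push_cast
    ring

/-- The recursion and `wOp_zero` determine the operators, so any map intertwining times and
derivatives with their substitutes can be carried through by `map_wRec`. -/
theorem wOp_eq_wRec (hι : IsTimes ι) (t : A) (l : ℤ) (m : ℕ) (f : Fn A) :
    wOp ι t l m f = wRec (RingHom.id A) ι (fun k => der (ι k)) m t l f := by
  induction m generalizing t l f with
  | zero => rw [wOp_zero hι, wRec_zero]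
  | succ m ih =>
    rw [wOp_succ hι, wRec_succ, ih, smul_eq_C_mul]
    congr 1
    refine locSum_congr fun k => ?_
    rw [ih, ih]

end Vertex

/-! ### Modes and normally ordered products -/

section Modes

variable {A : Type*} [CommRing A] (ι : ℕ+ → Time)

theorem mode_pos (k : ℕ+) (f : Fn A) : mode A ι k f = der (ι k) f := by
  have h : 0 < (k : ℤ) := by exact_mod_cast k.pos
  have h1 : (⟨(k : ℤ).toNat, by omega⟩ : ℕ+) = k := PNat.eq (by
    show (k : ℤ).toNat = k
    omega)
  rw [mode, dif_pos h, h1, dFn_apply]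

theorem mode_neg (k : ℕ+) (f : Fn A) : mode A ι (-(k : ℤ)) f = (k : ℕ) • (X (ι k) * f) := by
  have h : 0 < (k : ℤ) := by exact_mod_cast k.pos
  have h1 : (⟨(-(-(k : ℤ))).toNat, by omega⟩ : ℕ+) = k := PNat.eq (by
    show (-(-(k : ℤ))).toNat = k
    omega)
  rw [mode, dif_neg (by omega), dif_pos (by omega), h1, neg_neg, LinearMap.smul_apply,
    natCast_zsmul]
  rfl

theorem mode_zero : mode A ι 0 = 0 := by
  rw [mode, dif_neg (lt_irrefl _), dif_neg (lt_irrefl _)]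

theorem int_cases (l : ℤ) : (∃ k : ℕ+, l = k) ∨ l = 0 ∨ ∃ k : ℕ+, l = -k := by
  rcases lt_trichotomy l 0 with h | h | h
  · exact Or.inr (Or.inr ⟨⟨(-l).toNat, by omega⟩, by simp; omega⟩)
  · exact Or.inr (Or.inl h)
  · exact Or.inl ⟨⟨l.toNat, by omega⟩, by simp; omega⟩

theorem mode_commute {i j : ℤ} (h : (0 < i ∧ 0 < j) ∨ (i < 0 ∧ j < 0)) :
    Commute (mode A ι i) (mode A ι j) := by
  rcases int_cases i with ⟨a, rfl⟩ | rfl | ⟨a, rfl⟩ <;>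
    rcases int_cases j with ⟨b, rfl⟩ | rfl | ⟨b, rfl⟩ <;> try omega
  · ext1 f
    simp only [Module.End.mul_apply, mode_pos, ← dFn_apply]
    exact LinearMap.congr_fun (commute_dFn (ι a) (ι b)).eq f
  · ext1 f
    simp only [Module.End.mul_apply, mode_neg, mul_smul_comm]
    rw [smul_comm, mul_left_comm]

variable {ι}

theorem van_mode (hι : IsTimes ι) (k : ℤ) (f : Fn A) : Van (-k) (mode A ι k f) := by
  rcases int_cases k with ⟨k, rfl⟩ | rfl | ⟨k, rfl⟩
  · exact van_of_nonpos (by omega) _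
  · exact van_of_nonpos (by omega) _
  · rw [mode_neg]
    exact (((hι.van_X k).mul_right f).mono (by omega)).nsmul _

theorem locSum_mode (l : ℤ) (f : Fn A) :
    (locSum fun k : ℕ+ => (k : ℕ) • (X (ι k) * if l + k = 0 then f else 0)
      + if l - k = 0 then der (ι k) f else 0) = mode A ι l f := by
  rcases int_cases l with ⟨r, rfl⟩ | rfl | ⟨r, rfl⟩
  · rw [locSum_eq_single r, if_neg (by positivity), if_pos (sub_self _), mul_zero, smul_zero,
      zero_add, mode_pos]
    intro k hk
    rw [if_neg (by positivity), if_neg, mul_zero, smul_zero, zero_add]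
    intro h
    exact hk (PNat.eq (by omega))
  · rw [mode_zero, LinearMap.zero_apply]
    refine (locSum_congr fun k => ?_).trans locSum_zero
    have := k.pos
    rw [if_neg (by omega), if_neg (by omega), mul_zero, smul_zero, zero_add]
  · rw [locSum_eq_single r, if_pos (neg_add_cancel _), if_neg, add_zero, mode_neg]
    · have := r.pos
      omega
    · intro k hk
      have := r.pos
      rw [if_neg, if_neg (by omega), mul_zero, smul_zero, zero_add]
      intro h
      exact hk (PNat.eq (by omega))

theorem null_normalPair (hι : IsTimes ι) (l : ℤ) (f : Fn A) :
    Null fun i : ℤ => normalPair A ι i (l - i) f := by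
  refine Null.of_subset (fun w => Set.Icc (-(w : ℤ) - l.natAbs) (w + l.natAbs))
    (fun w => Set.finite_Icc _ _) fun w i hi => ?_
  refine (van_mode hι _ _).mono ?_
  rw [Set.mem_Icc] at hi
  omega

theorem locSum_int {R : Type*} [Ring R] {F : ℤ → MvPowerSeries Time R} (hF : Null F)
    (h0 : F 0 = 0) : locSum F = locSum fun k : ℕ+ => F (-k) + F k := by
  have i1 : Function.Injective fun k : ℕ+ => (-(k : ℤ)) := fun a b h => PNat.eq (by
    dsimp only at h
    omega)
  have i2 : Function.Injective fun k : ℕ+ => (k : ℤ) := fun a b h => PNat.eq (by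
    dsimp only at h
    omega)
  rw [locSum_add (hF.comp i1) (hF.comp i2)]
  ext γ
  rw [map_add, coeff_locSum, coeff_locSum, coeff_locSum,
    ← finsum_mem_range (f := fun i => coeff γ (F i)) i1,
    ← finsum_mem_range (f := fun i => coeff γ (F i)) i2,
    ← finsum_mem_union' _ ((hF.finite γ).subset Set.inter_subset_right)
      ((hF.finite γ).subset Set.inter_subset_right)]
  · rw [finsum_mem_def]
    refine finsum_congr fun i => ?_
    by_cases hi : i ∈ (Set.range fun k : ℕ+ => -(k : ℤ)) ∪ Set.range fun k : ℕ+ => (k : ℤ)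
    · rw [Set.indicator_of_mem hi]
    · rw [Set.indicator_of_notMem hi]
      rcases int_cases i with ⟨k, rfl⟩ | rfl | ⟨k, rfl⟩
      · exact (hi (Or.inr ⟨k, rfl⟩)).elim
      · rw [h0, map_zero]
      · exact (hi (Or.inl ⟨k, rfl⟩)).elim
  · rw [Set.disjoint_left]
    rintro _ ⟨a, rfl⟩ ⟨b, hb⟩
    have := a.pos
    dsimp only at hb
    omega

/-- Pairing i = -k with i = k makes one factor of every product a time x_k or a derivative ∂_k in
its normally ordered place. If both indices have the same sign the order is immaterial, and the term
i = 0 vanishes because p₀ = 0. -/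
theorem coeffSum_normalPair (hι : IsTimes ι) (l : ℤ) (f : Fn A) :
    coeffSum (fun i : ℤ => normalPair A ι i (l - i) f)
      = locSum fun k : ℕ+ => (k : ℕ) • (X (ι k) * mode A ι (l + k) f)
        + mode A ι (l - k) (der (ι k) f) := by
  refine (locSum_int (null_normalPair hι l f) ?_).trans (locSum_congr fun k => ?_)
  · rcases le_total 0 (l - 0) with h | h
    · rw [normalPair, min_eq_left h, mode_zero, zero_mul, LinearMap.zero_apply]
    · rw [normalPair, max_eq_left h, mode_zero, mul_zero, LinearMap.zero_apply]
  · have hk := k.pos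
    rw [← mode_neg, ← mode_pos ι k f, ← Module.End.mul_apply, ← Module.End.mul_apply,
      ← LinearMap.add_apply, ← LinearMap.add_apply, sub_neg_eq_add, normalPair, normalPair]
    congr 2
    · rcases le_total (-(k : ℤ)) (l + k) with h | h
      · rw [min_eq_left h, max_eq_right h]
      · rw [min_eq_right h, max_eq_left h]
        exact mode_commute ι (Or.inr ⟨by omega, by omega⟩)
    · rcases le_total (k : ℤ) (l - k) with h | h
      · rw [min_eq_left h, max_eq_right h]
        exact mode_commute ι (Or.inl ⟨by omega, by omega⟩)
      · rw [min_eq_right h, max_eq_left h]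

theorem null_mode_delta (l : ℤ) (f : Fn A) :
    Null (fun k : ℕ+ => (k : ℕ) • (X (ι k) * if l + k = 0 then f else 0)
      + if l - k = 0 then der (ι k) f else 0) := by
  refine Null.of_subset (fun w => (fun k : ℕ+ => (k : ℕ)) ⁻¹' Set.Iic l.natAbs)
    (fun w => (Set.finite_Iic _).preimage PNat.coe_injective.injOn) fun w k hk => ?_
  rw [Set.mem_preimage, Set.mem_Iic] at hk
  rw [if_neg (by omega), if_neg (by omega), mul_zero, smul_zero, zero_add]
  exact van_zero _

theorem null_mode_mode (hι : IsTimes ι) (l : ℤ) (f : Fn A) :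
    Null fun k : ℕ+ => (k : ℕ) • (X (ι k) * mode A ι (l + k) f)
        + mode A ι (l - k) (der (ι k) f) := by
  refine Null.of_subset (fun w => (fun k : ℕ+ => (k : ℕ)) ⁻¹' Set.Iic (w + l.natAbs))
    (fun w => (Set.finite_Iic _).preimage PNat.coe_injective.injOn) fun w k hk => ?_
  rw [Set.mem_preimage, Set.mem_Iic] at hk
  exact (Van.nsmul (((hι.van_X _).mul_right _).mono (by omega)) _).add
    ((van_mode hι _ _).mono (by omega))

end Modes

/-! ### Explicit formulas for m = 1 and m = 2 -/

section Vertex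

variable {A : Type*} [CommRing A] [Algebra ℂ A] {ι : ℕ+ → Time}

theorem wOp_one (hι : IsTimes ι) (t : A) (l : ℤ) (f : Fn A) :
    wOp ι t l 1 f = mode A ι l f + if l = 0 then t • f else 0 := by
  rw [wOp_succ hι, add_comm, ← locSum_mode]
  congr 1
  · refine locSum_congr fun k => ?_
    rw [wOp_zero hι, wOp_zero hι]
  · rw [wOp_zero hι, Nat.cast_zero, sub_zero]
    split_ifs
    · rfl
    · rw [smul_zero]

/-- In the recursion the scalar part of W_{·,·,1} survives only at k = -l or k = l, where t + k,
respectively t - k, equals t - l. It thus adds (t - l) p_l, and the term with t - 1 gives the rest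
of the coefficient 2t - l - 1 of p_l. -/
theorem wOp_two (hι : IsTimes ι) (t : A) (l : ℤ) (f : Fn A) :
    wOp ι t l 2 f = coeffSum (fun i : ℤ => normalPair A ι i (l - i) f)
      - ((l : A) - 2 * t + 1) • mode A ι l f + if l = 0 then (t * (t - 1)) • f else 0 := by
  have h1 : ∀ k : ℕ+, (k : ℕ) • (X (ι k) * wOp ι (t + (k : ℕ)) (l + k) 1 f)
        + wOp ι (t - (k : ℕ)) (l - k) 1 (der (ι k) f)
      = ((k : ℕ) • (X (ι k) * mode A ι (l + k) f) + mode A ι (l - k) (der (ι k) f))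
        + (t - l) • ((k : ℕ) • (X (ι k) * if l + k = 0 then f else 0)
          + if l - k = 0 then der (ι k) f else 0) := by
    intro k
    have e1 : (if l + k = 0 then (t + (k : ℕ)) • f else 0)
        = (t - l) • (if l + k = 0 then f else 0) := by
      split_ifs with h
      · congr 1
        rw [show l = -(k : ℤ) by omega]
        push_cast
        ring
      · rw [smul_zero]
    have e2 : (if l - k = 0 then (t - (k : ℕ)) • der (ι k) f else 0)
        = (t - l) • (if l - k = 0 then der (ι k) f else 0) := by
      split_ifs with h
      · congr 1
        rw [show l = (k : ℤ) by omega]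
        push_cast
        ring
      · rw [smul_zero]
    rw [wOp_one hι, wOp_one hι, e1, e2, mul_add, smul_add, smul_add, mul_smul_comm,
      smul_comm (k : ℕ) (t - l)]
    abel
  rw [wOp_succ hι, locSum_congr h1,
    locSum_add (null_mode_mode hι l f) ((null_mode_delta l f).asmul _),
    locSum_asmul (null_mode_delta l f), locSum_mode, ← coeffSum_normalPair hι, wOp_one hι]
  have e3 : (if l = 0 then (t * (t - 1)) • f else 0)
      = (t - 1) • (if l = 0 then t • f else 0) := by
    split_ifs
    · rw [smul_smul, mul_comm]
    · rw [smul_zero]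
  rw [e3, Nat.cast_one]
  module

end Vertex

/-! ### Difference operators divisible by Λ - 1 -/

namespace Skew

variable {A : Type*} [CommRing A] {θ : RingAut A}

theorem coeff_add (c d : Skew θ) (n : ℤ) : (c + d).coeff n = c.coeff n + d.coeff n := rfl

theorem coeff_sub (c d : Skew θ) (n : ℤ) : (c - d).coeff n = c.coeff n - d.coeff n := by
  rw [eq_sub_iff_add_eq, ← coeff_add, sub_add_cancel]

theorem coeff_zero (n : ℤ) : (0 : Skew θ).coeff n = 0 := rfl

theorem coeff_mono (k n : ℤ) (a : A) : (mono θ k a).coeff n = if n = k then a else 0  := by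
  show (HahnSeries.single k a).coeff n = _
  rw [HahnSeries.coeff_single]
  split_ifs <;> rfl

/-- The coefficient of `Tⁿ` as an additive map. -/
def coeffHom (θ : RingAut A) (n : ℤ) : Skew θ →+ A where
  toFun c := c.coeff n
  map_zero' := rfl
  map_add' _ _ := rfl

/-- The operators `a Tⁿ` as an additive function of `a`. -/
def monoHom (θ : RingAut A) (n : ℤ) : A →+ Skew θ where
  toFun := mono θ n
  map_zero' := ext fun k => by rw [coeff_mono, ite_self, coeff_zero]
  map_add' a b := ext fun k => by
    rw [coeff_add, coeff_mono, coeff_mono, coeff_mono]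
    split_ifs
    · rfl
    · rw [add_zero]

theorem mono_zero (n : ℤ) : mono θ n 0 = 0 := map_zero (monoHom θ n)

theorem mono_add (n : ℤ) (a b : A) : mono θ n (a + b) = mono θ n a + mono θ n b :=
  map_add (monoHom θ n) a b

theorem mono_one : mono θ 0 1 = 1 := rfl

theorem coeff_mul_eq_single {c d : Skew θ} {n i j : ℤ} (hij : i + j = n)
    (h : ∀ i' j', i' + j' = n → i' ≠ i → c.coeff i' = 0 ∨ d.coeff j' = 0) :
    (c * d).coeff n = c.coeff i * (θ ^ i) (d.coeff j) := by
  rw [coeff_mul]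
  refine (Finset.sum_eq_single (i, j) ?_ ?_)
  · rintro ⟨i', j'⟩ hp hne
    rw [Finset.mem_antidiagonal] at hp
    rcases h i' j' hp.2.2 (fun h => hne (by
      have := hp.2.2
      dsimp only at this
      rw [Prod.mk.injEq]
      omega)) with h | h
    · rw [h, zero_mul]
    · rw [h, _root_.map_zero, mul_zero]
  · intro hp
    rw [Finset.mem_antidiagonal] at hp
    by_cases hc : c.coeff i = 0
    · rw [hc, zero_mul]
    · by_cases hd : d.coeff j = 0
      · rw [hd, _root_.map_zero, mul_zero]
      · exact (hp ⟨hc, hd, hij⟩).elim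

theorem coeff_mono_mul (k : ℤ) (a : A) (c : Skew θ) (n : ℤ) :
    (mono θ k a * c).coeff n = a * (θ ^ k) (c.coeff (n - k)) := by
  rw [coeff_mul_eq_single (i := k) (j := n - k) (by ring), coeff_mono, if_pos rfl]
  intro i' j' _ hi
  left
  rw [coeff_mono, if_neg hi]

theorem coeff_mul_mono (c : Skew θ) (k : ℤ) (a : A) (n : ℤ) :
    (c * mono θ k a).coeff n = c.coeff (n - k) * (θ ^ (n - k)) a := by
  rw [coeff_mul_eq_single (i := n - k) (j := k) (by ring), coeff_mono, if_pos rfl]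
  intro i' j' hij hi
  right
  rw [coeff_mono, if_neg]
  omega

/-- The operators of multiplication by functions. -/
def const (θ : RingAut A) : A →+* Skew θ where
  toFun := mono θ 0
  map_one' := rfl
  map_mul' a b := by
    rw [mono_mul_mono]
    rfl
  map_zero' := mono_zero 0
  map_add' := mono_add 0

/-- There are no negative powers of `T`. -/
def NoNeg (c : Skew θ) : Prop := ∀ n < 0, c.coeff n = 0

theorem NoNeg.mul {c d : Skew θ} (hc : NoNeg c) (hd : NoNeg d) : NoNeg (c * d) := by
  intro n hn
  rw [coeff_mul_eq_single (i := n) (j := 0) (by ring), hc n hn, zero_mul]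
  intro i j hij _
  by_cases h : i < 0
  · exact Or.inl (hc i h)
  · exact Or.inr (hd j (by omega))

/-- If c had a lowest negative power, its product with the unit `d.coeff 0` (twisted by an
automorphism) would be the coefficient of that power in `c * d`. -/
theorem NoNeg.of_mul {c d : Skew θ} (hd : NoNeg d) (h0 : IsUnit (d.coeff 0))
    (h : NoNeg (c * d)) : NoNeg c := by
  by_contra hcon
  unfold NoNeg at hcon
  push Not at hcon
  obtain ⟨k, hk, hck⟩ := hcon
  have hw := c.isPWO.isWF
  have hne : (Function.support c.coeff).Nonempty := ⟨k, hck⟩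
  have h1 : hw.min hne ≤ k := hw.min_le hne hck
  have h2 := h (hw.min hne) (by omega)
  rw [coeff_mul_eq_single (i := hw.min hne) (j := 0) (by ring)] at h2
  · exact hw.min_mem hne (((h0.map (θ ^ hw.min hne)).mul_left_eq_zero).1 h2)
  · intro i j hij hi
    by_cases hj : j < 0
    · exact Or.inr (hd j hj)
    · left
      by_contra hi0
      have := hw.min_le hne (a := i) hi0
      omega

theorem geOne_support (c : Skew θ) : (Function.support fun n : ℕ =>
    mono θ (-((n : ℤ) + 1)) (c.coeff (-((n : ℤ) + 1)))
      - mono θ 0 (c.coeff (-((n : ℤ) + 1)))) ⊆ {n : ℕ | c.coeff (-((n : ℤ) + 1)) ≠ 0} := by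
  intro n hn h0
  refine hn ?_
  dsimp only
  rw [h0, mono_zero, mono_zero, sub_zero]

theorem geOneOther_support (η : RingAut A) (c : Skew θ) : (Function.support fun n : ℕ =>
    mono η ((n : ℤ) + 1) (c.coeff (-((n : ℤ) + 1)))
      - mono η 0 (c.coeff (-((n : ℤ) + 1)))) ⊆ {n : ℕ | c.coeff (-((n : ℤ) + 1)) ≠ 0} := by
  intro n hn h0
  refine hn ?_
  dsimp only
  rw [h0, mono_zero, mono_zero, sub_zero]

theorem geOne_add (c d : Skew θ) : (c + d).geOne = c.geOne + d.geOne := by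
  rw [geOne, geOne, geOne, ← finsum_add_distrib ((finite_neg c).subset (geOne_support c))
    ((finite_neg d).subset (geOne_support d))]
  refine finsum_congr fun n => ?_
  rw [coeff_add, mono_add, mono_add]
  abel

theorem geOneOther_add (η : RingAut A) (c d : Skew θ) :
    (c + d).geOneOther η = c.geOneOther η + d.geOneOther η := by
  rw [geOneOther, geOneOther, geOneOther,
    ← finsum_add_distrib ((finite_neg c).subset (geOneOther_support η c))
      ((finite_neg d).subset (geOneOther_support η d))]
  refine finsum_congr fun n => ?_
  rw [coeff_add, mono_add, mono_add]
  abel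

/-- The projections `geOne` and `geOneOther` as one additive map. -/
def geOnePair (θ η : RingAut A) : Skew θ →+ Skew θ × Skew η where
  toFun c := (c.geOne, c.geOneOther η)
  map_zero' := by
    rw [geOne, geOneOther, Prod.mk_eq_zero]
    constructor <;>
    · refine finsum_eq_zero_of_forall_eq_zero fun n => ?_
      rw [coeff_zero, mono_zero, mono_zero, sub_zero]
  map_add' c d := by rw [geOne_add, geOneOther_add, Prod.mk_add_mk]

theorem geOnePair_of_noNeg (η : RingAut A) {c : Skew θ} (h : NoNeg c) : geOnePair θ η c = 0 := by
  refine Prod.ext (finsum_eq_zero_of_forall_eq_zero fun n => ?_)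
    (finsum_eq_zero_of_forall_eq_zero fun n => ?_) <;>
  rw [h _ (by omega), mono_zero, mono_zero, sub_zero]

/-- The operator `a Λⁿ` in both rings of series. -/
def monoPair (θ η : RingAut A) (n : ℕ) (a : A) : Skew θ × Skew η := (mono θ (-n) a, mono η n a)

/-- The operator `a (Λⁿ - 1)` in both rings of series. -/
def deltaPair (θ η : RingAut A) (n : ℕ) (a : A) : Skew θ × Skew η :=
  monoPair θ η n a - monoPair θ η 0 a

/-- The finite difference operators that are divisible by `Λ - 1`. -/
def deltaGroup (θ η : RingAut A) : AddSubgroup (Skew θ × Skew η) :=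
  AddSubgroup.closure {q | ∃ n a, q = deltaPair θ η n a}

variable {η : RingAut A}

theorem deltaPair_mem (n : ℕ) (a : A) : deltaPair θ η n a ∈ deltaGroup θ η :=
  AddSubgroup.subset_closure ⟨n, a, rfl⟩

/-- bΛᵏ · a(Λⁿ - 1) = c(Λ^{k+n} - 1) - c(Λᵏ - 1) with c = b·σᵏ(a), where σ is the shift. The
hypothesis `h` says that Λ acts on coefficients in the same way in both rings. -/
theorem monoPair_mul_mem (h : θ * η = 1) (k : ℕ) (b : A) {q : Skew θ × Skew η}
    (hq : q ∈ deltaGroup θ η) : monoPair θ η k b * q ∈ deltaGroup θ η := by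
  induction hq using AddSubgroup.closure_induction with
  | mem q hq =>
    obtain ⟨n, a, rfl⟩ := hq
    have h1 : θ ^ (-(k : ℤ)) = η ^ (k : ℤ) := by
      rw [eq_inv_of_mul_eq_one_left h, inv_zpow, zpow_neg, inv_inv]
    have h2 : ∀ n : ℕ, monoPair θ η k b * monoPair θ η n a
        = monoPair θ η (k + n) (b * (η ^ (k : ℤ)) a) := by
      intro n
      rw [monoPair, monoPair, monoPair, Prod.mk_mul_mk, mono_mul_mono, mono_mul_mono, h1]
      push_cast
      rw [neg_add]
    have h3 : monoPair θ η k b * deltaPair θ η n a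
        = deltaPair θ η (k + n) (b * (η ^ (k : ℤ)) a)
          - deltaPair θ η k (b * (η ^ (k : ℤ)) a) := by
      rw [deltaPair, mul_sub, h2, h2, deltaPair, deltaPair, add_zero, sub_sub_sub_cancel_right]
    rw [h3]
    exact sub_mem (deltaPair_mem _ _) (deltaPair_mem _ _)
  | zero =>
    rw [mul_zero]
    exact zero_mem _
  | add x y _ _ hx hy =>
    rw [mul_add]
    exact add_mem hx hy
  | neg x _ hx =>
    rw [mul_neg]
    exact neg_mem hx

theorem mul_mem_deltaGroup (h : θ * η = 1) {p q : Skew θ × Skew η} (hp : p ∈ deltaGroup θ η)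
    (hq : q ∈ deltaGroup θ η) : p * q ∈ deltaGroup θ η := by
  induction hp using AddSubgroup.closure_induction with
  | mem p hp =>
    obtain ⟨n, a, rfl⟩ := hp
    rw [deltaPair, sub_mul]
    exact sub_mem (monoPair_mul_mem h _ _ hq) (monoPair_mul_mem h _ _ hq)
  | zero =>
    rw [zero_mul]
    exact zero_mem _
  | add x y _ _ hx hy =>
    rw [add_mul]
    exact add_mem hx hy
  | neg x _ hx =>
    rw [neg_mul]
    exact neg_mem hx

theorem geOnePair_mem (c : Skew θ) : geOnePair θ η c ∈ deltaGroup θ η := by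
  have h : geOnePair θ η c
      = ∑ n ∈ (finite_neg c).toFinset, deltaPair θ η (n + 1) (c.coeff (-((n : ℤ) + 1))) := by
    refine Prod.ext ?_ ?_
    · rw [Prod.fst_sum]
      refine (finsum_eq_sum_of_support_subset _ ?_).trans (Finset.sum_congr rfl fun n _ => ?_)
      · rw [Set.Finite.coe_toFinset]
        exact geOne_support c
      · simp [deltaPair, monoPair]
    · rw [Prod.snd_sum]
      refine (finsum_eq_sum_of_support_subset _ ?_).trans (Finset.sum_congr rfl fun n _ => ?_)
      · rw [Set.Finite.coe_toFinset]
        exact geOneOther_support η c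
      · simp [deltaPair, monoPair]
  rw [h]
  exact sum_mem fun n _ => deltaPair_mem _ _

theorem geOnePair_deltaPair (n : ℕ) (a : A) :
    geOnePair θ η (deltaPair θ η n a).1 = deltaPair θ η n a := by
  have h0 : ∀ k : ℕ, (deltaPair θ η n a).1.coeff (-((k : ℤ) + 1))
      = if n = k + 1 then a else 0 := by
    intro k
    show (mono θ (-n) a - mono θ (-(0 : ℕ)) a).coeff (-((k : ℤ) + 1)) = _
    rw [coeff_sub, coeff_mono, coeff_mono, if_neg (by push_cast; omega) (c := _ = -((0 : ℕ) : ℤ)),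
      sub_zero]
    refine if_congr ?_ rfl rfl
    omega
  rcases n with _ | n
  · refine (geOnePair_of_noNeg η fun k hk => ?_).trans ?_
    · rw [deltaPair, sub_self]
      rfl
    · rw [deltaPair, sub_self]
  · refine Prod.ext ?_ ?_
    · refine (finsum_eq_single _ n fun k hk => ?_).trans ?_
      · rw [h0, if_neg (by omega), mono_zero, mono_zero, sub_zero]
      · rw [h0, if_pos rfl]
        simp [deltaPair, monoPair]
    · refine (finsum_eq_single _ n fun k hk => ?_).trans ?_
      · rw [h0, if_neg (by omega), mono_zero, mono_zero, sub_zero]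
      · rw [h0, if_pos rfl]
        simp [deltaPair, monoPair]

/-- A combination of a(Λⁿ - 1) is determined by its positive powers of Λ, that is, by the negative
powers of T in its first component. This is what later identifies an operator from partial
information. -/
theorem geOnePair_of_mem {q : Skew θ × Skew η} (hq : q ∈ deltaGroup θ η) :
    geOnePair θ η q.1 = q := by
  induction hq using AddSubgroup.closure_induction with
  | mem q hq =>
    obtain ⟨n, a, rfl⟩ := hq
    exact geOnePair_deltaPair n a
  | zero => exact _root_.map_zero _
  | add x y _ _ hx hy => rw [Prod.fst_add, _root_.map_add, hx, hy]
  | neg x _ hx => rw [Prod.fst_neg, _root_.map_neg, hx]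

end Skew

/-! ### Coefficients of time-dependent difference operators -/

section Symbols

variable {A : Type*} [CommRing A] {θ : RingAut A} {ι : ℕ+ → Time}

theorem commute_of_coeff {R : Type*} [Ring R] {P Q : MvPowerSeries Time R}
    (h : ∀ α β, Commute (coeff α P) (coeff β Q)) : Commute P Q := by
  refine MvPowerSeries.ext fun γ => ?_
  rw [MvPowerSeries.coeff_mul, MvPowerSeries.coeff_mul]
  refine Finset.sum_equiv (Equiv.prodComm _ _) (fun p => ?_) fun p _ => (h p.1 p.2).eq
  rw [Finset.HasAntidiagonal.mem_antidiagonal, Finset.HasAntidiagonal.mem_antidiagonal, add_comm]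
  rfl

/-- The coefficient of `Tⁿ` as an additive map. -/
def symbHom (θ : RingAut A) (n : ℤ) : Op θ →+ Fn A where
  toFun P := symb P n
  map_zero' := rfl
  map_add' _ _ := rfl

theorem coeff_symb (P : Op θ) (n : ℤ) (α : Time →₀ ℕ) :
    coeff α (symb P n) = (coeff α P).coeff n := rfl

theorem symb_ext {P Q : Op θ} (h : ∀ n, symb P n = symb Q n) : P = Q :=
  MvPowerSeries.ext fun α => Skew.ext fun n => by rw [← coeff_symb, h, coeff_symb]

theorem symb_sub (P Q : Op θ) (n : ℤ) : symb (P - Q) n = symb P n - symb Q n :=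
  map_sub (symbHom θ n) P Q

theorem shifts_symb (n : ℤ) : Shifts 0 (symbHom θ n) := fun w f hf γ hγ => by
  show (coeff γ f).coeff n = 0
  rw [hf γ (by omega)]
  rfl

theorem symb_der (i : Time) (P : Op θ) (n : ℤ) : symb (der i P) n = der i (symb P n) := by
  ext α
  rw [coeff_symb, coeff_der, coeff_der, coeff_symb]
  exact map_nsmul (Skew.coeffHom θ n) _ _

/-- The operators of multiplication by functions of `s` and of the times. -/
def constOp (θ : RingAut A) : Fn A →+* Op θ := MvPowerSeries.map (Skew.const θ)

theorem coeff_constOp (f : Fn A) (α : Time →₀ ℕ) :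
    coeff α (constOp θ f) = Skew.mono θ 0 (coeff α f) := rfl

theorem constOp_X (i : Time) : constOp θ (X i) = X i := MvPowerSeries.map_X _ _

theorem shifts_constOp : Shifts 0 (constOp θ) := fun w f hf γ hγ => by
  rw [coeff_constOp, hf γ (by omega), Skew.mono_zero]

theorem symb_constOp_mul (f : Fn A) (P : Op θ) (n : ℤ) :
    symb (constOp θ f * P) n = f * symb P n := by
  ext γ
  rw [coeff_symb, MvPowerSeries.coeff_mul, MvPowerSeries.coeff_mul]
  refine (map_sum (Skew.coeffHom θ n) _ _).trans (Finset.sum_congr rfl fun p _ => ?_)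
  show (coeff p.1 (constOp θ f) * coeff p.2 P).coeff n = _
  rw [coeff_constOp, Skew.coeff_mono_mul, sub_zero]
  rfl

theorem symb_mul_C (P : Op θ) (k : ℤ) (a : A) (n : ℤ) :
    symb (P * C (Skew.mono θ k a)) n = symb P (n - k) * C ((θ ^ (n - k)) a) := by
  ext γ
  rw [coeff_symb, MvPowerSeries.coeff_mul_C, MvPowerSeries.coeff_mul_C, Skew.coeff_mul_mono]
  rfl

theorem der_constOp (i : Time) (f : Fn A) : der i (constOp θ f) = constOp θ (der i f) := by
  ext α : 1
  rw [coeff_der, coeff_constOp, coeff_constOp, coeff_der]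
  exact (map_nsmul (Skew.monoHom θ 0) _ _).symm

theorem commute_mono {a : A} (h : ∀ n : ℤ, (θ ^ n) a = a) (c : Skew θ) :
    Commute (Skew.mono θ 0 a) c := by
  refine Skew.ext fun n => ?_
  rw [Skew.coeff_mono_mul, Skew.coeff_mul_mono, sub_zero, h, mul_comm]
  rfl

/-- The operator with coefficients `h n` for `n ≥ 0`. -/
def opOfNat (θ : RingAut A) (h : ℕ → Fn A) : Op θ := fun γ =>
  (HahnSeries.ofSuppBddBelow (fun n : ℤ => if 0 ≤ n then coeff γ (h n.toNat) else 0) ⟨0, by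
    intro n hn
    by_contra hlt
    exact hn (if_neg (by omega))⟩ : HahnSeries ℤ A)

theorem symb_opOfNat (h : ℕ → Fn A) (n : ℕ) : symb (opOfNat θ h) n = h n := by
  ext γ
  show (if (0 : ℤ) ≤ n then coeff γ (h (n : ℤ).toNat) else 0) = _
  rw [if_pos (by omega), Int.toNat_natCast]

theorem symb_opOfNat_of_neg (h : ℕ → Fn A) {n : ℤ} (hn : n < 0) : symb (opOfNat θ h) n = 0 := by
  ext γ
  show (if (0 : ℤ) ≤ n then coeff γ (h n.toNat) else 0) = _
  rw [if_neg (by omega), map_zero]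

/-- If `P W` has no negative powers of `T` and `W` starts with an invertible coefficient of `T⁰`,
then `P` has no negative powers of `T`. -/
theorem symb_eq_zero_of_mul {P W : Op θ} (hW : ∀ n < 0, symb W n = 0) (h0 : IsUnit (symb W 0))
    (h : ∀ n < 0, symb (P * W) n = 0) {n : ℤ} (hn : n < 0) : symb P n = 0 := by
  have hW' : ∀ α, Skew.NoNeg (coeff α W) := fun α n hn => by
    rw [← coeff_symb, hW n hn, map_zero]
  have h0' : IsUnit ((coeff 0 W).coeff 0) := h0.map (constantCoeff (σ := Time) (R := A))
  have key : ∀ (d : ℕ) (γ : Time →₀ ℕ), γ.degree = d → Skew.NoNeg (coeff γ P) := by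
    intro d
    induction d using Nat.strong_induction_on with
    | _ d ih =>
      intro γ hγ
      -- In the coefficient of the product at γ, every summand except (γ, 0) has a factor of P of
      -- lower degree and is covered by the induction hypothesis.
      refine Skew.NoNeg.of_mul (hW' 0) h0' fun n hn => ?_
      have h1 : (coeff γ (P * W)).coeff n = 0 := by
        rw [← coeff_symb, h n hn, map_zero]
      rw [MvPowerSeries.coeff_mul] at h1
      have h2 := (map_sum (Skew.coeffHom θ n) (fun p : (Time →₀ ℕ) × (Time →₀ ℕ) =>
        coeff p.1 P * coeff p.2 W) (Finset.HasAntidiagonal.antidiagonal γ)).symm.trans h1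
      rw [Finset.sum_eq_single (γ, 0)] at h2
      · exact h2
      · rintro ⟨α, β⟩ hp hne
        rw [Finset.HasAntidiagonal.mem_antidiagonal] at hp
        dsimp only at hp
        refine Skew.NoNeg.mul (ih α.degree ?_ α rfl) (hW' β) n hn
        rw [← hγ, ← hp, map_add]
        refine Nat.lt_add_of_pos_right (Nat.pos_of_ne_zero fun hβ => hne ?_)
        rw [Finsupp.degree_eq_zero_iff] at hβ
        rw [← hp, hβ, add_zero]
      · intro hp
        rw [Finset.HasAntidiagonal.mem_antidiagonal] at hp
        exact (hp (add_zero γ)).elim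
  ext γ
  rw [coeff_symb, key _ γ rfl n hn, map_zero]

theorem null_bareOrlov (hι : IsTimes ι) :
    Null fun k : ℕ+ => (C (Skew.mono θ (1 - (k : ℤ)) ((k : ℕ) : A)) * X (ι k) : Op θ) := by
  refine Null.of_subset (fun w => (fun k : ℕ+ => (k : ℕ)) ⁻¹' Set.Iic w)
    (fun w => (Set.finite_Iic _).preimage PNat.coe_injective.injOn) fun w k hk => ?_
  rw [Set.mem_preimage, Set.mem_Iic] at hk
  exact ((hι.van_X k).mul_left _).mono (by omega)

theorem bareOrlov_eq (ι : ℕ+ → Time) (t : A) : bareOrlov ι θ t = C (Skew.mono θ 1 t)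
    + locSum fun k : ℕ+ => (C (Skew.mono θ (1 - (k : ℤ)) ((k : ℕ) : A)) * X (ι k) : Op θ) := by
  classical
  refine MvPowerSeries.ext fun α => ?_
  rw [map_add, coeff_C, coeff_locSum]
  refine congrArg (fun c : Skew θ => (if α = 0 then Skew.mono θ 1 t else 0) + c) ?_
  refine finsum_congr fun k => ?_
  rw [MvPowerSeries.coeff_C_mul, coeff_X]
  split_ifs
  · rw [mul_one]
  · rw [mul_zero]

end Symbols

/-! ### The exponential factor of the wave operators -/

section Exponential

variable {A : Type*} [CommRing A] [Algebra ℂ A] {θ : RingAut A} {ι : ℕ+ → Time}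

theorem map_ringHom_expX {B : Type*} [CommRing B] [Algebra ℂ B] (ρ : A →+* B)
    (hρ : ∀ z : ℂ, ρ (algebraMap ℂ A z) = algebraMap ℂ B z) (ε : ℂ) (n : ℤ) :
    MvPowerSeries.map ρ (expX A ι ε n) = expX B ι ε n := by
  let φ : Fn A →ₐ[ℂ] Fn B :=
    { MvPowerSeries.map ρ with
      commutes' := fun z => by
        show MvPowerSeries.map ρ (algebraMap ℂ (Fn A) z) = _
        rw [MvPowerSeries.algebraMap_apply, MvPowerSeries.algebraMap_apply, MvPowerSeries.map_C,
          hρ] }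
  have h := map_expZ φ (fun k => ε • (X (ι k) : Fn A)) n
  have h1 : ∀ k, φ (ε • (X (ι k) : Fn A)) = ε • (X (ι k) : Fn B) := by
    intro k
    rw [map_smul]
    congr 1
    exact MvPowerSeries.map_X ρ _
  simp only [h1] at h
  exact h.symm

/-- The automorphism fixes the complex constants. -/
def FixesScalars (θ : RingAut A) : Prop := ∀ z : ℂ, θ (algebraMap ℂ A z) = algebraMap ℂ A z

theorem FixesScalars.zpow (hθ : FixesScalars θ) (n : ℤ) (z : ℂ) :
    (θ ^ n) (algebraMap ℂ A z) = algebraMap ℂ A z :=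
  (MulAction.stabilizer (RingAut A) (algebraMap ℂ A z)).zpow_mem (hθ z) n

/-- The coefficients of e^{εξ} in the times are complex constants, which the automorphism fixes. -/
theorem constOp_expX_commute (hθ : FixesScalars θ) (ε : ℂ) (n : ℤ) (P : Op θ) :
    Commute (constOp θ (expX A ι ε n)) P :=
  commute_of_coeff fun α β => commute_mono (fun k => by
    have h := map_ringHom_expX (ι := ι) ((θ ^ k : RingAut A) : A →+* A) (hθ.zpow k) ε n
    exact congrArg (coeff α) h) _

/-- The operator of multiplication by `exp (∑ x_k T⁻ᵏ)`. -/
def expOp (ι : ℕ+ → Time) (θ : RingAut A) : Op θ :=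
  locSum fun a : ℤ => C (Skew.mono θ (-a) 1) * constOp θ (expX A ι 1 a)

theorem null_expX (hι : IsTimes ι) : Null fun a : ℤ => expX A ι 1 a := by
  refine Null.of_subset (fun w => Set.Icc 0 (w : ℤ)) (fun w => Set.finite_Icc _ _) fun w a ha => ?_
  by_cases h : a < 0
  · rw [expX_of_neg _ h]
    exact van_zero _
  · refine (van_expX hι 1 a).mono ?_
    rw [Set.mem_Icc] at ha
    omega

theorem null_constOp_expX (hι : IsTimes ι) : Null fun a : ℤ => constOp θ (expX A ι 1 a) :=
  (null_expX hι).map (φ := (constOp θ : Fn A →+ Op θ)) shifts_constOp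

theorem null_C_mul_expX (hι : IsTimes ι) (b : ℤ → Skew θ) :
    Null fun a : ℤ => C (b a) * constOp θ (expX A ι 1 a) := fun w =>
  (null_constOp_expX hι w).subset fun _ hi hcon => hi (hcon.mul_left _)

theorem der_expOp (hι : IsTimes ι) (k : ℕ+) :
    der (ι k) (expOp ι θ) = C (Skew.mono θ (-k) 1) * expOp ι θ := by
  rw [expOp, map_locSum _ (hι.shifts_der k) (null_C_mul_expX hι _), X_mul_locSum _ (null_C_mul_expX hι _)]
  refine Eq.trans (locSum_congr fun a => ?_) (locSum_comp_equiv (Equiv.subRight (k : ℤ)) _)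
  show _ = C (Skew.mono θ (-k) 1)
    * (C (Skew.mono θ (-(a - k)) 1) * constOp θ (expX A ι 1 (a - k)))
  rw [der_mul, der_C, zero_mul, zero_add, der_constOp, der_expX hι, one_smul, ← mul_assoc,
    ← map_mul, Skew.mono_mul_mono, map_one, mul_one]
  congr 3
  ring

theorem constantCoeff_expOp (hι : IsTimes ι) : constantCoeff (expOp ι θ) = 1 := by
  show coeff 0 (locSum _) = _
  rw [coeff_locSum, finsum_eq_single _ 0]
  · rw [MvPowerSeries.coeff_C_mul, coeff_constOp, coeff_zero_expX hι, if_pos rfl, neg_zero,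
      Skew.mono_one, one_mul]
  · intro a ha
    rw [MvPowerSeries.coeff_C_mul, coeff_constOp, coeff_zero_expX hι, if_neg ha, Skew.mono_zero,
      mul_zero]

/-- The constant term of E in the times is 1, so E is invertible. -/
theorem expOp_right_cancel (hι : IsTimes ι) {P Q : Op θ} (h : P * expOp ι θ = Q * expOp ι θ) :
    P = Q := by
  have h1 := MvPowerSeries.mul_invOfUnit (expOp ι θ) 1 (constantCoeff_expOp hι)
  rw [← mul_one P, ← h1, ← mul_assoc, h, mul_assoc, h1, mul_one]

theorem symb_mul_expOp (hι : IsTimes ι) (hθ : FixesScalars θ) (P : Op θ) (n : ℤ) :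
    symb (P * expOp ι θ) n = locSum fun a : ℤ => symb P (n + a) * expX A ι 1 a := by
  rw [expOp, X_mul_locSum _ (null_C_mul_expX hι _)]
  refine (map_locSum (symbHom θ n) (shifts_symb n)
    ((null_C_mul_expX hι _).map (φ := AddMonoidHom.mulLeft P) (n := 0)
      fun w f hf => (hf.mul_left P).mono (by omega))).trans (locSum_congr fun a => ?_)
  show symb (P * (C (Skew.mono θ (-a) 1) * constOp θ (expX A ι 1 a))) n = _
  rw [← mul_assoc, ← (constOp_expX_commute hθ 1 a _).eq, symb_constOp_mul, symb_mul_C, map_one,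
    map_one, mul_one, sub_neg_eq_add, mul_comm]

theorem expOp_mul_C (hι : IsTimes ι) (hθ : FixesScalars θ) (k : ℤ) (b : A) :
    expOp ι θ * C (Skew.mono θ k b)
      = locSum fun a : ℤ => C (Skew.mono θ (k - a) ((θ ^ (-a)) b)) * constOp θ (expX A ι 1 a) := by
  refine (map_locSum (AddMonoidHom.mulRight (C (Skew.mono θ k b))) (n := 0)
    (fun w f hf => (hf.mul_right _).mono (by omega)) (null_C_mul_expX hι _)).trans
    (locSum_congr fun a => ?_)
  show C (Skew.mono θ (-a) 1) * constOp θ (expX A ι 1 a) * C (Skew.mono θ k b) = _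
  rw [mul_assoc, (constOp_expX_commute hθ 1 a _).eq, ← mul_assoc, ← map_mul,
    Skew.mono_mul_mono, one_mul, neg_add_eq_sub]

theorem C_mul_expOp (hι : IsTimes ι) (k : ℤ) (b : A) :
    C (Skew.mono θ k b) * expOp ι θ
      = locSum fun a : ℤ => C (Skew.mono θ (k - a) b) * constOp θ (expX A ι 1 a) := by
  rw [expOp, X_mul_locSum _ (null_C_mul_expX hι _)]
  refine locSum_congr fun a => ?_
  rw [← mul_assoc, ← map_mul, Skew.mono_mul_mono, map_one, mul_one, ← sub_eq_add_neg]

theorem expOp_commute (hι : IsTimes ι) (hθ : FixesScalars θ) (k : ℤ) :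
    Commute (expOp ι θ) (C (Skew.mono θ k 1)) := by
  refine (expOp_mul_C hι hθ k 1).trans (Eq.trans ?_ (C_mul_expOp hι k 1).symm)
  simp only [map_one]

/-- Moving t to the left past T⁻ᵃ replaces it by t + a, and a times the a-th coefficient of e^ξ is ∑
k x_k times lower coefficients by Euler's identity. Hence E (tT) E⁻¹ = tT + ∑ k x_k T^{1-k}. -/
theorem bareOrlov_mul_expOp (hι : IsTimes ι) (hθ : FixesScalars θ) {t : A}
    (ht : ∀ n : ℤ, (θ ^ n) t = t - n) :
    bareOrlov ι θ t * expOp ι θ = expOp ι θ * C (Skew.mono θ 1 t) := by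
  obtain ⟨F, hF⟩ : ∃ F : ℕ+ → ℤ → Op θ, ∀ k a, F k a = C (Skew.mono θ (1 - a) 1)
      * constOp θ ((k : ℕ) • ((1 : ℂ) • X (ι k) * expX A ι 1 (a - k))) := ⟨_, fun _ _ => rfl⟩
  have nF : Null fun p : ℕ+ × ℤ => F p.1 p.2 := by
    refine Null.of_subset (fun w => ((fun k : ℕ+ => (k : ℕ)) ⁻¹' Set.Iic w) ×ˢ Set.Icc 0 (w : ℤ))
      (fun w => ((Set.finite_Iic _).preimage PNat.coe_injective.injOn).prod (Set.finite_Icc _ _))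
      fun w p hp => ?_
    rw [hF, one_smul]
    by_cases h : p.2 - p.1 < 0
    · rw [expX_of_neg _ h, mul_zero, smul_zero, map_zero, mul_zero]
      exact van_zero _
    · refine Van.mul_left ?_ _
      refine (shifts_constOp _ _ (((hι.van_X p.1).mul (van_expX hι 1 _)).nsmul _)).mono ?_
      simp only [Set.mem_prod, Set.mem_Icc, Set.mem_preimage, Set.mem_Iic] at hp
      omega
  have e1 : (locSum fun k : ℕ+ => C (Skew.mono θ (1 - (k : ℤ)) ((k : ℕ) : A)) * X (ι k))
      * expOp ι θ = locSum fun a : ℤ => locSum fun k : ℕ+ => F k a := by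
    rw [← locSum_comm nF]
    refine (map_locSum (AddMonoidHom.mulRight (expOp ι θ)) (n := 0)
      (fun w f hf => (hf.mul_right _).mono (by omega)) (null_bareOrlov hι)).trans
      (locSum_congr fun k => ?_)
    show C _ * X (ι k) * expOp ι θ = _
    rw [(commute_X _ _).eq, mul_assoc, C_mul_expOp hι, X_mul_locSum _ (null_C_mul_expX hι _)]
    refine Eq.trans (locSum_congr fun a => ?_) (locSum_comp_equiv (Equiv.addRight (k : ℤ)) _)
    show _ = F k (a + k)
    have h1 : Skew.mono θ (1 - (k : ℤ) - a) ((k : ℕ) : A)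
        = (k : ℕ) • Skew.mono θ (1 - (a + k)) 1 := by
      rw [show 1 - (k : ℤ) - a = 1 - (a + k) by ring, ← nsmul_one (A := A)]
      exact map_nsmul (Skew.monoHom θ _) _ _
    rw [hF, one_smul, h1, add_sub_cancel_right, map_nsmul, map_nsmul, map_mul, constOp_X,
      smul_mul_assoc, mul_smul_comm, mul_smul_comm, ← mul_assoc, ← mul_assoc, (commute_X _ _).eq]
  have e2 : ∀ a : ℤ, (locSum fun k : ℕ+ => F k a)
      = C (Skew.mono θ (1 - a) (a : A)) * constOp θ (expX A ι 1 a) := by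
    intro a
    have hn : Null fun k : ℕ+ => (k : ℕ) • ((1 : ℂ) • X (ι k) * expX A ι 1 (a - k)) := by
      refine Null.of_subset (fun w => (fun k : ℕ+ => (k : ℕ)) ⁻¹' Set.Iic w)
        (fun w => (Set.finite_Iic _).preimage PNat.coe_injective.injOn) fun w k hk => ?_
      rw [Set.mem_preimage, Set.mem_Iic] at hk
      rw [one_smul]
      exact (((hι.van_X k).mul_right _).mono (by omega)).nsmul _
    have h1 : Skew.mono θ (1 - a) (a : A) = a • Skew.mono θ (1 - a) 1 := by
      rw [← zsmul_one a]
      exact map_zsmul (Skew.monoHom θ _) _ _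
    rw [locSum_congr fun k => hF k a, ← X_mul_locSum (F := fun k : ℕ+ => constOp θ ((k : ℕ) •
      ((1 : ℂ) • X (ι k) * expX A ι 1 (a - k)))) _ (hn.map (φ := (constOp θ : Fn A →+ Op θ))
      shifts_constOp), h1, map_zsmul, smul_mul_assoc, ← mul_smul_comm, ← map_zsmul, euler_expX]
    congr 1
    exact (map_locSum (constOp θ : Fn A →+ Op θ) shifts_constOp hn).symm
  rw [bareOrlov_eq, add_mul, e1, C_mul_expOp hι, expOp_mul_C hι hθ, locSum_congr e2,
    ← locSum_add (null_C_mul_expX hι _) (null_C_mul_expX hι _)]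
  refine locSum_congr fun a => ?_
  rw [← add_mul, ← map_add, ← Skew.mono_add, ht]
  push_cast
  rw [sub_neg_eq_add]

end Exponential

/-! ### The action of W_{t,l,m} on a function times a wave function -/

section Pairs

variable {A : Type*} [CommRing A] {θ η : RingAut A} {ι : ℕ+ → Time}

theorem der_map {R S : Type*} [Ring R] [Ring S] (f : R →+* S) (i : Time)
    (P : MvPowerSeries Time R) : der i (MvPowerSeries.map f P) = MvPowerSeries.map f (der i P) := by
  ext α
  rw [coeff_der, MvPowerSeries.coeff_map, MvPowerSeries.coeff_map, coeff_der, map_nsmul]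

theorem shifts_map {R S : Type*} [Ring R] [Ring S] (f : R →+* S) :
    Shifts 0 (MvPowerSeries.map (σ := Time) f) := fun w P hP γ hγ => by
  rw [MvPowerSeries.coeff_map, hP γ (by omega), map_zero]

/-- Functions as operators in both rings of series. -/
def constPair (θ η : RingAut A) : A →+* Skew θ × Skew η := (Skew.const θ).prod (Skew.const η)

/-- Every coefficient is a finite difference operator divisible by `Λ - 1`. -/
def IsDelta (Q : MvPowerSeries Time (Skew θ × Skew η)) : Prop :=
  ∀ γ, coeff γ Q ∈ Skew.deltaGroup θ η

theorem IsDelta.add {P Q : MvPowerSeries Time (Skew θ × Skew η)} (hP : IsDelta P)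
    (hQ : IsDelta Q) : IsDelta (P + Q) := fun γ => by
  rw [map_add]
  exact add_mem (hP γ) (hQ γ)

theorem IsDelta.nsmul {P : MvPowerSeries Time (Skew θ × Skew η)} (hP : IsDelta P) (n : ℕ) :
    IsDelta (n • P) := fun γ => by
  rw [map_nsmul]
  exact nsmul_mem (hP γ) n

theorem IsDelta.der {P : MvPowerSeries Time (Skew θ × Skew η)} (hP : IsDelta P) (i : Time) :
    IsDelta (der i P) := fun γ => by
  rw [coeff_der]
  exact nsmul_mem (hP _) _

theorem IsDelta.locSum {I : Type*} {F : I → MvPowerSeries Time (Skew θ × Skew η)}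
    (hF : ∀ i, IsDelta (F i)) : IsDelta (locSum F) := fun γ => by
  rw [coeff_locSum]
  exact finsum_induction (· ∈ Skew.deltaGroup θ η) (zero_mem _) (fun _ _ => add_mem)
    fun i => hF i γ

theorem IsDelta.mul (h : θ * η = 1) {P Q : MvPowerSeries Time (Skew θ × Skew η)} (hP : IsDelta P)
    (hQ : IsDelta Q) : IsDelta (P * Q) := fun γ => by
  rw [MvPowerSeries.coeff_mul]
  exact sum_mem fun p _ => Skew.mul_mem_deltaGroup h (hP _) (hQ _)

theorem IsDelta.const_mul (h : θ * η = 1) (f : Fn A) {Q : MvPowerSeries Time (Skew θ × Skew η)}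
    (hQ : IsDelta Q) : IsDelta (MvPowerSeries.map (constPair θ η) f * Q) := fun γ => by
  rw [MvPowerSeries.coeff_mul]
  exact sum_mem fun p _ => Skew.monoPair_mul_mem h 0 _ (hQ _)

/-- The derivative of `Q Ψ` is `(∇ Q) Ψ` if the derivative of `Ψ` is `B Ψ`. -/
def nabla {N : Type*} [Ring N] (ι : ℕ+ → Time) (B : ℕ+ → MvPowerSeries Time N) (k : ℕ+)
    (Q : MvPowerSeries Time N) : MvPowerSeries Time N := der (ι k) Q + Q * B k

theorem shifts_nabla {N : Type*} [Ring N] (hι : IsTimes ι) (B : ℕ+ → MvPowerSeries Time N)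
    (k : ℕ+) : Shifts (-(k : ℤ)) (nabla ι B k) := fun w f hf =>
  (hι.shifts_der k w f hf).add ((hf.mul_right _).mono (by omega))

/-- Operators divisible by Λ - 1 are stable under ∂_k, products and left multiplication by
functions, and each `B k` is one of them. So modulo them `nabla` acts on functions as ∂_k. The
induction is over general `v` because `nabla` of a function is no longer a function. -/
theorem isDelta_wRec_sub (h : θ * η = 1) (hι : IsTimes ι)
    {B : ℕ+ → MvPowerSeries Time (Skew θ × Skew η)} (hB : ∀ k, IsDelta (B k)) (m : ℕ) (t : A)
    (l : ℤ) (v : MvPowerSeries Time (Skew θ × Skew η)) (g : Fn A)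
    (hv : IsDelta (v - MvPowerSeries.map (constPair θ η) g)) :
    IsDelta (wRec (constPair θ η) ι (nabla ι B) m t l v
      - wRec (constPair θ η) ι (fun k => der (ι k)) m t l
        (MvPowerSeries.map (constPair θ η) g)) := by
  induction m generalizing t l v g with
  | zero =>
    rw [wRec_zero, wRec_zero]
    split_ifs
    · exact hv
    · rw [sub_self]
      exact fun γ => zero_mem _
  | succ m ih =>
    have n1 := null_wRec (constPair θ η) hι (shifts_nabla hι B) m t l v
    have n2 := null_wRec (constPair θ η) hι (D := fun k => der (ι k)) hι.shifts_der m t l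
      (MvPowerSeries.map (constPair θ η) g)
    rw [wRec_succ, wRec_succ, add_sub_add_comm, ← mul_sub, ← locSum_sub n1 n2]
    refine IsDelta.add ?_ (IsDelta.locSum fun k => ?_)
    · rw [← MvPowerSeries.map_C]
      exact (ih t l v g hv).const_mul h _
    · rw [add_sub_add_comm, ← smul_sub, ← mul_sub]
      refine IsDelta.add (IsDelta.nsmul ?_ _) ?_
      · rw [← MvPowerSeries.map_X (constPair θ η)]
        exact (ih _ _ v g hv).const_mul h _
      · rw [der_map]
        refine ih _ _ _ _ ?_
        have h1 : nabla ι B k v - MvPowerSeries.map (constPair θ η) (der (ι k) g)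
            = der (ι k) (v - MvPowerSeries.map (constPair θ η) g)
              + ((v - MvPowerSeries.map (constPair θ η) g) * B k
                + MvPowerSeries.map (constPair θ η) g * B k) := by
          rw [nabla, map_sub, der_map, sub_mul]
          abel
        rw [h1]
        exact (hv.der _).add ((hv.mul h (hB k)).add ((hB k).const_mul h _))

variable [Algebra ℂ A]

/-- The operator `B` divisible by `Λ - 1` in `W_{t,l,m} (f ψ) = (W_{t,l,m} f) ψ + B ψ`. -/
def wDelta (θ η : RingAut A) (ι : ℕ+ → Time) (B : ℕ+ → MvPowerSeries Time (Skew θ × Skew η))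
    (m : ℕ) (t : A) (l : ℤ) (f : Fn A) : MvPowerSeries Time (Skew θ × Skew η) :=
  wRec (constPair θ η) ι (nabla ι B) m t l (MvPowerSeries.map (constPair θ η) f)
    - MvPowerSeries.map (constPair θ η) (wOp ι t l m f)

theorem map_constPair_wOp (hι : IsTimes ι) (m : ℕ) (t : A) (l : ℤ) (f : Fn A) :
    MvPowerSeries.map (constPair θ η) (wOp ι t l m f)
      = wRec (constPair θ η) ι (fun k => der (ι k)) m t l
        (MvPowerSeries.map (constPair θ η) f) := by
  rw [wOp_eq_wRec hι]
  refine map_wRec (RingHom.id A) (constPair θ η) (RingHom.id A) hι (D := fun k => der (ι k))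
    (D' := fun k => der (ι k)) hι.shifts_der
    (MvPowerSeries.map (σ := Time) (constPair θ η)).toAddMonoidHom
    (shifts_map (constPair θ η)) (fun a f => ?_) (fun k f => ?_) (fun k f => ?_) m t l f
  · show MvPowerSeries.map (constPair θ η) _ = _
    rw [map_mul, MvPowerSeries.map_C]
    rfl
  · show MvPowerSeries.map (constPair θ η) _ = _
    rw [map_mul, MvPowerSeries.map_X]
    rfl
  · exact (der_map (constPair θ η) (ι k) f).symm

theorem isDelta_wDelta (h : θ * η = 1) (hι : IsTimes ι)
    {B : ℕ+ → MvPowerSeries Time (Skew θ × Skew η)} (hB : ∀ k, IsDelta (B k)) (m : ℕ) (t : A)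
    (l : ℤ) (f : Fn A) : IsDelta (wDelta θ η ι B m t l f) := by
  rw [wDelta, map_constPair_wOp hι]
  refine isDelta_wRec_sub h hι hB m t l _ f ?_
  rw [sub_self]
  exact fun γ => zero_mem _

/-- The action of `W_{t,l,m}` on the product of `f` and a wave function. -/
theorem wOp_mul_symb (hι : IsTimes ι) {B : ℕ+ → MvPowerSeries Time (Skew θ × Skew η)}
    {ζ : RingAut A} (π : Skew θ × Skew η →+* Skew ζ) (hπ : ∀ a, π (constPair θ η a) = Skew.const ζ a)
    {Ψ : Op ζ} (hΨ : ∀ k, der (ι k) Ψ = MvPowerSeries.map π (B k) * Ψ) (m : ℕ) (t : A) (l : ℤ)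
    (f : Fn A) (j : ℤ) : wOp ι t l m (f * symb Ψ j)
      = wOp ι t l m f * symb Ψ j
        + symb (MvPowerSeries.map π (wDelta θ η ι B m t l f) * Ψ) j := by
  have hc : ∀ g : Fn A, MvPowerSeries.map π (MvPowerSeries.map (constPair θ η) g)
      = constOp ζ g := fun g => MvPowerSeries.ext fun γ => by
    rw [MvPowerSeries.coeff_map, MvPowerSeries.coeff_map, hπ]
    rfl
  -- The map Q ↦ coefficient of Tʲ in QΨ intertwines `nabla` with ∂_k, so `map_wRec` carries the
  -- whole recursion from operators to functions.
  let ψ : MvPowerSeries Time (Skew θ × Skew η) →+ Fn A := (symbHom ζ j).comp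
    ((AddMonoidHom.mulRight Ψ).comp (MvPowerSeries.map (σ := Time) π).toAddMonoidHom)
  have hψ : ∀ Q, ψ Q = symb (MvPowerSeries.map π Q * Ψ) j := fun _ => rfl
  have hm : ∀ g Q, ψ (MvPowerSeries.map (constPair θ η) g * Q) = g * ψ Q := by
    intro g Q
    rw [hψ, hψ, map_mul, hc, mul_assoc, symb_constOp_mul]
  have key := map_wRec (constPair θ η) (RingHom.id A) (RingHom.id A) hι
    (D' := fun k => der (ι k)) (shifts_nabla hι B) ψ (n := 0) (fun w Q hQ => by
      rw [hψ]
      have h1 := shifts_map π w Q hQ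
      exact (shifts_symb j _ _ (h1.mul_right Ψ)).mono (by omega))
    (fun a Q => by
      rw [← MvPowerSeries.map_C, hm]
      rfl)
    (fun k Q => by
      rw [← MvPowerSeries.map_X (constPair θ η), hm])
    (fun k Q => by
      rw [hψ, hψ, ← symb_der, nabla, der_mul, hΨ, map_add, map_mul, der_map, add_mul, mul_assoc])
    m t l (MvPowerSeries.map (constPair θ η) f)
  have h1 : ψ (MvPowerSeries.map (constPair θ η) f) = f * symb Ψ j := by
    rw [hψ, hc, symb_constOp_mul]
  rw [h1, RingHom.id_apply] at key
  rw [wOp_eq_wRec hι, ← key, wDelta, map_sub, sub_mul, symb_sub, hc,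
    symb_constOp_mul, ← hψ]
  exact (add_sub_cancel _ _).symm

end Pairs

/-! ### Lax and Orlov operators on the wave operator -/

section Dressing

variable {A : Type*} [CommRing A] {θ η : RingAut A} {ι ι' : ℕ+ → Time}

theorem Skew.T_zpow (l : ℤ) : ((Skew.T θ ^ l : (Skew θ)ˣ) : Skew θ) = Skew.mono θ l 1 := by
  induction l using Int.induction_on with
  | zero => rfl
  | succ n ih =>
    rw [zpow_add_one, Units.val_mul, ih]
    refine (Skew.mono_mul_mono _ _ _ _).trans ?_
    rw [map_one, mul_one]
  | pred n ih =>
    rw [zpow_sub_one, Units.val_mul, ih]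
    refine (Skew.mono_mul_mono _ _ _ _).trans ?_
    rw [map_one, mul_one]
    rfl

theorem lax_zpow (W : (Op θ)ˣ) (l : ℤ) :
    ((lax W ^ l : (Op θ)ˣ) : Op θ) = (W : Op θ) * C (Skew.mono θ (-l) 1) * ((W⁻¹ : (Op θ)ˣ) : Op θ) := by
  rw [lax, conj_zpow, ← map_zpow, inv_zpow', Units.val_mul, Units.val_mul]
  congr 2
  show C _ = _
  rw [Skew.T_zpow]

theorem fall_map {B : Type*} [CommRing B] (f : A →+* B) (t : A) (m : ℕ) :
    f (fall t m) = fall (f t) m := by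
  rw [fall, fall, map_prod]
  exact Finset.prod_congr rfl fun r _ => by rw [map_sub, map_natCast]

theorem Skew.mono_pow {t : A} (ht : ∀ n : ℤ, (θ ^ n) t = t - n) (m : ℕ) :
    Skew.mono θ 1 t ^ m = Skew.mono θ m (fall t m) := by
  induction m with
  | zero =>
    rw [pow_zero, fall_zero]
    rfl
  | succ m ih =>
    rw [pow_succ, ih, Skew.mono_mul_mono, ht, fall_succ, Nat.cast_succ, Int.cast_natCast]

variable [Algebra ℂ A]

theorem lax_zpow_mul (hι : IsTimes ι) (hθ : FixesScalars θ) (W : (Op θ)ˣ) (l : ℤ) :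
    ((lax W ^ l : (Op θ)ˣ) : Op θ) * ((W : Op θ) * expOp ι θ)
      = (W : Op θ) * expOp ι θ * C (Skew.mono θ (-l) 1) := by
  rw [lax_zpow, mul_assoc, Units.inv_mul_cancel_left, mul_assoc, ← (expOp_commute hι hθ _).eq,
    mul_assoc]

theorem orlov_pow_mul (hι : IsTimes ι) (hθ : FixesScalars θ) {t : A}
    (ht : ∀ n : ℤ, (θ ^ n) t = t - n) (W : (Op θ)ˣ) (m : ℕ) :
    orlov ι t W ^ m * ((W : Op θ) * expOp ι θ) = (W : Op θ) * expOp ι θ * C (Skew.mono θ m (fall t m)) := by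
  rw [← Skew.mono_pow ht, map_pow]
  induction m with
  | zero => rw [pow_zero, pow_zero, one_mul, mul_one]
  | succ m ih =>
    have h1 : orlov ι t W * ((W : Op θ) * expOp ι θ) = (W : Op θ) * expOp ι θ * C (Skew.mono θ 1 t) := by
      rw [orlov, mul_assoc, Units.inv_mul_cancel_left, mul_assoc, bareOrlov_mul_expOp hι hθ ht,
        mul_assoc]
    rw [pow_succ, mul_assoc, h1, ← mul_assoc, ih, mul_assoc, ← pow_succ]

/-- On Ψ = W E the operators L and M act by right multiplication with T⁻¹ and tT. Moreover (tT)^m =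
(t)_m T^m, because moving T past t lowers t by one. -/
theorem orlovLax_mul (hι : IsTimes ι) (hθ : FixesScalars θ) {t : A}
    (ht : ∀ n : ℤ, (θ ^ n) t = t - n) (W : (Op θ)ˣ) (m : ℕ) (l : ℤ) :
    orlovLax ι t W m (m + l) * ((W : Op θ) * expOp ι θ)
      = (W : Op θ) * expOp ι θ * C (Skew.mono θ (-l) (fall t m)) := by
  rw [orlovLax, mul_assoc, lax_zpow_mul hι hθ, ← mul_assoc, orlov_pow_mul hι hθ ht, mul_assoc,
    ← map_mul, Skew.mono_mul_mono, map_one, mul_one]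
  congr 3
  ring

/-- Differentiating E contributes L^k Ψ, which turns -(L^k)_{≤0} into (L^k)_{≥1}, an operator
divisible by Λ - 1. -/
theorem der_wave (hι : IsTimes ι) (hθ : FixesScalars θ) (W : (Op θ)ˣ) (k : ℕ+)
    (hW : dOp (ι k) (W : Op θ) = -leZero ((lax W : Op θ) ^ (k : ℕ)) * W) :
    der (ι k) ((W : Op θ) * expOp ι θ) = geOne ((lax W : Op θ) ^ (k : ℕ)) * ((W : Op θ) * expOp ι θ) := by
  have h1 : der (ι k) (W : Op θ) = -leZero ((lax W : Op θ) ^ (k : ℕ)) * W := hW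
  have h2 := lax_zpow_mul hι hθ W k
  rw [zpow_natCast, Units.val_pow_eq_pow_val] at h2
  rw [der_mul, h1, der_expOp hι, leZero, neg_sub, sub_mul, sub_mul, mul_assoc, mul_assoc, h2,
    ← (expOp_commute hι hθ _).eq, mul_assoc, sub_add_cancel]

theorem symb_mul_expOp_eq (hι : IsTimes ι) (hθ : FixesScalars θ) (P : Op θ) (u : Fn A)
    (h : ℤ → Fn A) (hP : ∀ n, symb P n * u = h n) (j : ℤ) :
    symb (P * expOp ι θ) (-j) * u = locSum fun n : ℤ => expX A ι 1 (j + n) * h n := by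
  have hn : Null fun a : ℤ => symb P (-j + a) * expX A ι 1 a := fun w =>
    (null_expX hι w).subset fun _ hi hcon => hi (hcon.mul_left _)
  rw [symb_mul_expOp hι hθ, mul_comm, X_mul_locSum _ hn]
  refine Eq.trans (locSum_congr fun a => ?_) (locSum_comp_equiv (Equiv.addLeft (-j)) _)
  show _ = expX A ι 1 (j + (-j + a)) * h (-j + a)
  rw [← hP, add_neg_cancel_left]
  ring

/-- `W` and `U` are the dressing operators of a solution with tau functions `τ₀`, `τ₁`, as seen
from the set of times `ι`. -/
structure IsSolution (θ η : RingAut A) (ι ι' : ℕ+ → Time) (W : (Op θ)ˣ) (U : Op η)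
    (τ₀ τ₁ : Fn A) : Prop where
  form : ∀ n : ℤ, n < 0 → symb (W : Op θ) n = 0
  lead : IsUnit (symb (W : Op θ) 0)
  flow : ∀ k : ℕ+, dOp (ι k) (W : Op θ) = -leZero ((lax W : Op θ) ^ (k : ℕ)) * W
  flow' : ∀ k : ℕ+, dOp (ι k) U = geOneOther η ((lax W : Op θ) ^ (k : ℕ)) * U
  unit : IsUnit τ₁
  wave : ∀ n : ℕ, symb (W : Op θ) n * τ₁ = gCoeff ι n τ₀
  wave' : ∀ n : ℕ, symb U n * τ₁ = gCoeff ι' n (shiftFn η τ₀)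

/-- The relation between `W` and τ₀ multiplied by e^ξ. The coefficient of T⁻ʲ corresponds to z^j in
Γ(z), hence the sign. -/
theorem IsSolution.symb_wave (hι : IsTimes ι) (hθ : FixesScalars θ) {W : (Op θ)ˣ} {U : Op η}
    {τ₀ τ₁ : Fn A} (h : IsSolution θ η ι ι' W U τ₀ τ₁) (j : ℤ) :
    symb ((W : Op θ) * expOp ι θ) (-j) * τ₁ = waveOp hι j τ₀ := by
  refine symb_mul_expOp_eq hι hθ W τ₁ (fun n => expD A ι (-1) n τ₀) (fun n => ?_) j
  rcases lt_or_ge n 0 with hn | hn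
  · rw [h.form n hn, zero_mul, expD_of_neg _ hn, LinearMap.zero_apply]
  · lift n to ℕ using hn
    rw [h.wave, gCoeff_eq]

/-- The operators `W_{t,l,m}` of one set of times commute with `G(z)` of the other set. -/
theorem wOp_expD_shiftFn (hι : IsTimes ι) (hι' : IsTimes ι')
    (hd : ∀ k, ι k ∉ Set.range ι') (t : A) (l : ℤ) (m : ℕ) (n : ℤ) (f : Fn A) :
    expD A ι' (-1) n (shiftFn η (wOp ι t l m f))
      = wOp ι (η t) l m (expD A ι' (-1) n (shiftFn η f)) := by
  rw [wOp_eq_wRec hι, wOp_eq_wRec hι]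
  refine map_wRec (RingHom.id A) (RingHom.id A) (η : A →+* A) hι (D := fun k => der (ι k))
    (D' := fun k => der (ι k)) hι.shifts_der
    ((expD A ι' (-1) n).toAddMonoidHom.comp
      (MvPowerSeries.map (σ := Time) (η : A →+* A)).toAddMonoidHom)
    (n := -n) (fun w f hf => ?_) (fun a f => ?_) (fun k f => ?_) (fun k f => ?_) m t l f
  · exact (shifts_expD hι' (-1) n _ _ (shifts_map (η : A →+* A) w f hf)).mono (by omega)
  · show expD A ι' (-1) n (MvPowerSeries.map (η : A →+* A) (C a * f))
      = C (η a) * expD A ι' (-1) n (MvPowerSeries.map (η : A →+* A) f)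
    rw [map_mul, MvPowerSeries.map_C, ← smul_eq_C_mul, map_smul, smul_eq_C_mul]
    rfl
  · show expD A ι' (-1) n (MvPowerSeries.map (η : A →+* A) (X (ι k) * f))
      = X (ι k) * expD A ι' (-1) n (MvPowerSeries.map (η : A →+* A) f)
    rw [map_mul, MvPowerSeries.map_X, expD_X_of_notMem (hd k)]
  · show expD A ι' (-1) n (MvPowerSeries.map (η : A →+* A) (der (ι k) f))
      = der (ι k) (expD A ι' (-1) n (MvPowerSeries.map (η : A →+* A) f))
    rw [← der_map, expD_der]

end Dressing

/-! ### The action of the additional symmetries -/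

section Main

variable {A : Type*} [CommRing A] {θ η : RingAut A} {ι ι' : ℕ+ → Time}

/-- The projections of `P` to both rings of series. -/
def geOneBoth (θ η : RingAut A) (P : Op θ) : MvPowerSeries Time (Skew θ × Skew η) :=
  fun γ => Skew.geOnePair θ η (coeff γ P)

theorem isDelta_geOneBoth (P : Op θ) : IsDelta (geOneBoth θ η P) := fun _ => Skew.geOnePair_mem _

theorem map_fst_geOneBoth (P : Op θ) :
    MvPowerSeries.map (RingHom.fst _ _) (geOneBoth θ η P) = geOne P := rfl

theorem map_snd_geOneBoth (P : Op θ) :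
    MvPowerSeries.map (RingHom.snd _ _) (geOneBoth θ η P) = geOneOther η P := rfl

/-- The negative powers of T in the first component of Q come from `n • Y` alone, and an operator
divisible by Λ - 1 is recovered from them. -/
theorem IsDelta.eq_geOneBoth {Q : MvPowerSeries Time (Skew θ × Skew η)} (hQ : IsDelta Q)
    {n : ℕ} {Y Z : Op θ} (h : MvPowerSeries.map (RingHom.fst _ _) Q = Z + n • Y)
    (hZ : ∀ n < 0, symb Z n = 0) : Q = n • geOneBoth θ η Y := by
  refine MvPowerSeries.ext fun γ => ?_
  have h1 : (coeff γ Q).1 = coeff γ Z + n • coeff γ Y := by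
    rw [← map_nsmul, ← map_add, ← h]
    rfl
  rw [← Skew.geOnePair_of_mem (hQ γ), h1, map_add, map_nsmul, map_nsmul,
    Skew.geOnePair_of_noNeg η fun k hk => ?_, zero_add]
  · rfl
  · rw [← coeff_symb, hZ k hk, map_zero]

theorem zpow_sub_of_shift {s : A} (hs : θ s = s - 1) (n : ℤ) : (θ ^ n) s = s - n := by
  induction n using Int.induction_on with
  | zero => simp
  | succ n ih =>
    rw [zpow_add_one, RingAut.mul_apply, hs, map_sub, ih, map_one]
    push_cast
    ring
  | pred n ih =>
    have h1 : θ⁻¹ s = s + 1 := by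
      rw [RingAut.inv_apply, RingEquiv.symm_apply_eq, map_add, hs, map_one, sub_add_cancel]
    rw [zpow_sub_one, RingAut.mul_apply, h1, map_add, ih, map_one]
    push_cast
    ring

variable [Algebra ℂ A]

variable {W : (Op θ)ˣ} {U : Op η} {τ₀ τ₁ : Fn A} {s : A}

/-- `W_{s+1,l,m+1}` acts on the products of `τ₁` with the wave functions by a multiple of the
projections of `M^m L^{m+l}`. -/
theorem IsSolution.exists_wDelta (hι : IsTimes ι) (hθ : FixesScalars θ) (hη : θ * η = 1)
    (hs : θ s = s - 1) (h : IsSolution θ η ι ι' W U τ₀ τ₁) (m : ℕ) (l : ℤ) :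
    wDelta θ η ι (fun k => geOneBoth θ η ((lax W : Op θ) ^ (k : ℕ))) (m + 1) (s + 1) l τ₁
        = MvPowerSeries.map (constPair θ η) τ₁
          * ((m + 1) • geOneBoth θ η (orlovLax ι s W m (m + l)))
      ∧ ∀ n : ℕ, (m + 1) • (symb (-leZero (orlovLax ι s W m (m + l)) * (W : Op θ)) n * τ₁)
          = gCoeff ι n (wOp ι s l (m + 1) τ₀)
            - symb (W : Op θ) n * wOp ι (s + 1) l (m + 1) τ₁ := by
  have ht := zpow_sub_of_shift hs
  set Y := orlovLax ι s W m (m + l) with hY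
  set f₀ := wOp ι s l (m + 1) τ₀ with hf₀
  set f₁ := wOp ι (s + 1) l (m + 1) τ₁ with hf₁
  obtain ⟨B, hB⟩ : ∃ B, B = wDelta θ η ι (fun k => geOneBoth θ η ((lax W : Op θ) ^ (k : ℕ)))
    (m + 1) (s + 1) l τ₁ := ⟨_, rfl⟩
  have hBd : IsDelta B := by
    rw [hB]
    exact isDelta_wDelta hη hι (fun k => isDelta_geOneBoth _) _ _ _ _
  obtain ⟨v, hv⟩ : ∃ v : Fn A, v * τ₁ = 1 := by
    obtain ⟨u, hu⟩ := h.unit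
    exact ⟨((u⁻¹ : (Fn A)ˣ) : Fn A), by rw [← hu, Units.inv_mul]⟩
  set N : Op θ := opOfNat θ fun n => gCoeff ι n f₀ - symb (W : Op θ) n * f₁ with hN
  set E := expOp ι θ with hE
  -- W_{s+1,l,m+1} applied to τ₁Ψ = Γτ₀ and solved for the part BΨ.
  have w1 : ∀ j : ℤ, symb (MvPowerSeries.map (RingHom.fst _ _) B * ((W : Op θ) * E)) (-j)
      = wOp ι (s + 1) l (m + 1) (waveOp hι j τ₀) - f₁ * symb ((W : Op θ) * E) (-j) := by
    intro j
    have h1 := wOp_mul_symb hι (RingHom.fst (Skew θ) (Skew η)) (fun a => rfl)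
      (B := fun k => geOneBoth θ η ((lax W : Op θ) ^ (k : ℕ)))
      (fun k => der_wave hι hθ W k (h.flow k)) (m + 1) (s + 1) l τ₁ (-j)
    rw [mul_comm τ₁, h.symb_wave hι hθ, ← hB] at h1
    rw [h1, add_sub_cancel_left]
  have hfall : ∀ n : ℤ, (θ ^ n) (fall s m) = fall (s - n) m := fun n => by
    rw [← ht]
    exact fall_map ((θ ^ n : RingAut A) : A →+* A) s m
  have w2 : ∀ j : ℤ, symb (constOp θ τ₁ * Y * ((W : Op θ) * E)) (-j)
      = fall (s + j - l) m • waveOp hι (j - l) τ₀ := by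
    intro j
    rw [mul_assoc, symb_constOp_mul, orlovLax_mul hι hθ ht, symb_mul_C, hfall,
      show -j - -l = -(j - l) by ring, ← h.symb_wave hι hθ, smul_eq_C_mul]
    push_cast
    rw [show s - -((j : A) - l) = s + j - l by ring]
    ring
  have w3 : ∀ j : ℤ, symb (N * E) (-j)
      = waveOp hι j f₀ - f₁ * symb ((W : Op θ) * E) (-j) := by
    intro j
    have e1 := symb_mul_expOp_eq hι hθ N 1
      (fun n => expD A ι (-1) n f₀ - symb (W : Op θ) n * f₁) (fun n => by
        rw [mul_one]
        rcases lt_or_ge n 0 with hn | hn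
        · rw [symb_opOfNat_of_neg _ hn, h.form n hn, zero_mul, expD_of_neg _ hn,
            LinearMap.zero_apply, sub_zero]
        · lift n to ℕ using hn
          rw [symb_opOfNat, gCoeff_eq]) j
    have e2 := symb_mul_expOp_eq hι hθ (W : Op θ) f₁ (fun n => symb (W : Op θ) n * f₁)
      (fun n => rfl) j
    have n2 : Null fun n : ℤ => expX A ι 1 (j + n) * (symb (W : Op θ) n * f₁) := fun w =>
      ((null_expX hι).comp (Equiv.addLeft j).injective w).subset
        fun _ hi hcon => hi (hcon.mul_right _)
    rw [mul_comm f₁, e2, waveOp_apply, ← locSum_sub (null_waveTerm hι j f₀) n2, ← mul_one (symb _ _),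
      e1]
    refine locSum_congr fun n => ?_
    rw [waveTerm_apply, mul_sub]
  -- The relation `wOp_waveOp` splits `w1` into the coefficients of (m+1) τ₁YΨ (`w2`) and of NE
  -- (`w3`); cancelling E leaves an identity in which N has no negative powers of T.
  have key : (MvPowerSeries.map (RingHom.fst _ _) B - (m + 1) • (constOp θ τ₁ * Y)) * (W : Op θ)
      = N := by
    refine expOp_right_cancel hι (symb_ext fun n => ?_)
    obtain ⟨j, rfl⟩ : ∃ j, n = -j := ⟨-n, by ring⟩
    rw [mul_assoc, sub_mul, symb_sub, w1, w3, smul_mul_assoc]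
    have e3 : symb ((m + 1) • (constOp θ τ₁ * Y * ((W : Op θ) * E))) (-j)
        = (m + 1) • symb (constOp θ τ₁ * Y * ((W : Op θ) * E)) (-j) :=
      map_nsmul (symbHom θ (-j)) _ _
    rw [e3, w2, wOp_waveOp hι, mul_smul, ← Nat.cast_succ, Nat.cast_smul_eq_nsmul]
    abel
  set Z : Op θ := MvPowerSeries.map (RingHom.fst _ _)
    (MvPowerSeries.map (constPair θ η) v * B) - (m + 1) • Y with hZ
  have hc : ∀ g : Fn A, MvPowerSeries.map (RingHom.fst (Skew θ) (Skew η))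
      (MvPowerSeries.map (constPair θ η) g) = constOp θ g := fun g => rfl
  have hvv : ∀ P : Op θ, constOp θ v * (constOp θ τ₁ * P) = P := by
    intro P
    rw [← mul_assoc, ← map_mul, hv, map_one, one_mul]
  have hvv' : ∀ P : Op θ, constOp θ τ₁ * (constOp θ v * P) = P := by
    intro P
    rw [← mul_assoc, ← map_mul, mul_comm τ₁, hv, map_one, one_mul]
  have hZ' : Z = constOp θ v
      * (MvPowerSeries.map (RingHom.fst _ _) B - (m + 1) • (constOp θ τ₁ * Y)) := by
    rw [hZ, map_mul, hc, mul_sub, mul_smul_comm, hvv]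
  have hZW : Z * (W : Op θ) = constOp θ v * N := by rw [hZ', mul_assoc, key]
  have hZn : ∀ n < 0, symb Z n = 0 := fun n hn =>
    symb_eq_zero_of_mul (fun n hn => h.form n hn) h.lead (fun n hn => by
      rw [hZW, symb_constOp_mul, symb_opOfNat_of_neg _ hn, mul_zero]) hn
  -- After division by τ₁ the remainder Z has no negative powers of T, so B/τ₁ is (m+1) times the
  -- projection of Y to degree at least one, and Z is -(m+1) Y_{≤0}.
  have hB0 := (hBd.const_mul hη v).eq_geOneBoth (Y := Y) (Z := Z) (n := m + 1)
    (by rw [hZ, sub_add_cancel]) hZn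
  constructor
  · rw [← hB, ← hB0, ← mul_assoc, ← map_mul, mul_comm τ₁, hv, map_one, one_mul]
  · intro n
    have e4 : (m + 1) • -leZero Y = Z := by
      rw [hZ, hB0, map_nsmul, map_fst_geOneBoth, leZero, neg_sub, smul_sub]
    have e5 : (m + 1) • (symb (-leZero Y * (W : Op θ)) n * τ₁)
        = symb (constOp θ τ₁ * (((m + 1) • -leZero Y) * (W : Op θ))) n := by
      rw [symb_constOp_mul, smul_mul_assoc, mul_comm τ₁, ← smul_mul_assoc]
      congr 1
    rw [e5, e4, hZW, hvv', symb_opOfNat]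

theorem IsSolution.wave_wOp (hι : IsTimes ι) (hθ : FixesScalars θ) (hη : θ * η = 1)
    (hs : θ s = s - 1) (h : IsSolution θ η ι ι' W U τ₀ τ₁) (m : ℕ) (l : ℤ) (n : ℕ) :
    (m + 1) • (symb (-leZero (orlovLax ι s W m (m + l)) * (W : Op θ)) n * τ₁)
        + symb (W : Op θ) n * wOp ι (s + 1) l (m + 1) τ₁
      = gCoeff ι n (wOp ι s l (m + 1) τ₀) := by
  rw [(h.exists_wDelta hι hθ hη hs m l).2 n, sub_add_cancel]

/-- U depends on the times `ι` through the same operators (L^k)_{≥1} as Ψ, without an exponential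
factor. Hence the operator B found from Ψ also describes W_{s+1,l,m+1}(τ₁U), while W commutes with
the G of the other times and the shift by η turns s into s + 1. -/
theorem IsSolution.wave_wOp' (hι : IsTimes ι) (hι' : IsTimes ι') (hd : ∀ k, ι k ∉ Set.range ι')
    (hθ : FixesScalars θ) (hη : θ * η = 1)
    (hs : θ s = s - 1) (h : IsSolution θ η ι ι' W U τ₀ τ₁) (m : ℕ) (l : ℤ) (n : ℕ) :
    (m + 1) • (symb (geOneOther η (orlovLax ι s W m (m + l)) * U) n * τ₁)
        + symb U n * wOp ι (s + 1) l (m + 1) τ₁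
      = gCoeff ι' n (shiftFn η (wOp ι s l (m + 1) τ₀)) := by
  have hηs : η s = s + 1 := by
    rw [eq_inv_of_mul_eq_one_right hη, RingAut.inv_apply, RingEquiv.symm_apply_eq, map_add, hs,
      map_one, sub_add_cancel]
  have h1 := wOp_mul_symb hι (RingHom.snd (Skew θ) (Skew η)) (fun a => rfl)
    (B := fun k => geOneBoth θ η ((lax W : Op θ) ^ (k : ℕ)))
    (fun k => h.flow' k) (m + 1) (s + 1) l τ₁ n
  have hc : MvPowerSeries.map (RingHom.snd (Skew θ) (Skew η))
      (MvPowerSeries.map (constPair θ η) τ₁) = constOp η τ₁ := rfl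
  rw [mul_comm τ₁, h.wave', gCoeff_eq, ← hηs, ← wOp_expD_shiftFn hι hι' hd, hηs,
    (h.exists_wDelta hι hθ hη hs m l).1, map_mul, map_nsmul, map_snd_geOneBoth, hc, mul_assoc,
    symb_constOp_mul, smul_mul_assoc] at h1
  rw [gCoeff_eq, h1, add_comm, mul_comm, mul_comm τ₁]
  congr 1
  rw [← smul_mul_assoc]
  congr 1

end Main

/-! ### Uniqueness of the action on tau functions -/

section Uniqueness

variable {A : Type*} [CommRing A] {σ : RingAut A}

theorem shiftFn_smul (c : A) (f : Fn A) : shiftFn σ (c • f) = σ c • shiftFn σ f := by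
  rw [smul_eq_C_mul, smul_eq_C_mul, shiftFn, map_mul, MvPowerSeries.map_C]
  rfl

variable [Algebra ℂ A]

theorem isAddTorsionFree_of_complex : IsAddTorsionFree A where
  nsmul_right_injective n hn f g h := by
    dsimp only at h
    rw [← Nat.cast_smul_eq_nsmul ℂ, ← Nat.cast_smul_eq_nsmul ℂ] at h
    exact smul_right_injective _ (Nat.cast_ne_zero.2 hn : (n : ℂ) ≠ 0) h

/-- A factor that commutes with `G(z)` on an invertible function does not depend on the times. -/
theorem der_eq_zero_of_expD_mul {ι : ℕ+ → Time} {κ f : Fn A} (hf : IsUnit f)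
    (h : ∀ n : ℕ, expD A ι (-1) n (κ * f) = κ * expD A ι (-1) n f) (k : ℕ+) :
    der (ι k) κ = 0 := by
  -- By multiplicativity of G, the n-th relation reads ∑_{0<i≤n} G_i(κ) G_{n-i}(f) = 0. By induction
  -- only G_n(κ) f remains, and f is a unit.
  have h1 : ∀ n : ℕ, 0 < n → expD A ι (-1) n κ = 0 := by
    intro n
    induction n using Nat.strong_induction_on with
    | _ n ih =>
      intro hn
      have h2 := h n
      rw [expD_mul, ← Finset.sum_sdiff (s₁ := {(0, n), (n, 0)}), Finset.sum_pair,
        Finset.sum_eq_zero, zero_add, Nat.cast_zero, expD_zero, Module.End.one_apply,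
        Module.End.one_apply, add_eq_left] at h2
      · exact (hf.mul_left_eq_zero).1 h2
      · rintro ⟨i, j⟩ hp
        simp only [Finset.mem_sdiff, Finset.HasAntidiagonal.mem_antidiagonal, Finset.mem_insert,
          Finset.mem_singleton, Prod.mk.injEq] at hp
        dsimp only
        rw [ih i (by omega) (by omega), zero_mul]
      · intro heq
        rw [Prod.mk.injEq] at heq
        omega
      · intro p hp
        rw [Finset.mem_insert, Finset.mem_singleton] at hp
        rw [Finset.HasAntidiagonal.mem_antidiagonal]
        rcases hp with rfl | rfl <;> simp
  -- In Euler's identity for G_k(κ) the only surviving summand is -∂_k κ.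
  have h3 := euler_expD_natCast (ι := ι) (-1) (k : ℕ) κ
  obtain ⟨n, rfl⟩ : ∃ n : ℕ, k = n.succPNat := ⟨k.natPred, (PNat.succPNat_natPred k).symm⟩
  rw [h1 _ n.succPNat.pos, smul_zero, Finset.sum_eq_single n] at h3
  · rw [Nat.succPNat_coe, Nat.cast_succ, sub_self, expD_zero, Module.End.one_apply] at h3
    have h4 := congrArg (fun g => (-1 : ℂ) • g) h3
    simpa using h4.symm
  · intro j hj hjn
    rw [Finset.mem_range, Nat.succPNat_coe] at hj
    rw [Nat.succPNat_coe, show ((n.succ : ℕ) : ℤ) - (j + 1) = ((n - j : ℕ) : ℤ) by omega,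
      h1 _ (by omega), map_zero]
  · intro hn
    rw [Finset.mem_range, Nat.succPNat_coe] at hn
    omega

theorem eq_C_of_der {κ : Fn A} (h : ∀ i, der i κ = 0) : κ = C (coeff 0 κ) := by
  have := isAddTorsionFree_of_complex (A := A)
  rw [← sub_eq_zero]
  refine eq_zero_of_der (fun _ => 0) ?_ fun i => ?_
  · rw [map_sub, coeff_zero_C, sub_self]
  · rw [map_sub, h, der_C, sub_zero, zero_mul]

variable {W₁ : Op σ⁻¹} {W₂ : Op σ} {τ₀ τ₁ : Fn A}

theorem expD_smul_const {ι : ℕ+ → Time} (n : ℤ) (c : A) (f : Fn A) :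
    expD A ι (-1) n (c • f) = c • expD A ι (-1) n f := map_smul _ _ _

/-- The action on tau functions is unique up to a common factor that is periodic in `s` and does
not depend on the times. -/
theorem actsOnTau_iff (hτ : IsTau σ W₁ W₂ τ₀ τ₁) {V₁ : Op σ⁻¹} {V₂ : Op σ} {a₀ a₁ : Fn A}
    (ha : ActsOnTau σ W₁ W₂ τ₁ V₁ V₂ a₀ a₁) (f₀ f₁ : Fn A) :
    ActsOnTau σ W₁ W₂ τ₁ V₁ V₂ f₀ f₁ ↔
      ∃ c : A, σ c = c ∧ f₀ = a₀ + c • τ₀ ∧ f₁ = a₁ + c • τ₁ := by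
  have w1 := hτ.wave₁
  have w2 := hτ.wave₂
  have a1 := ha.wave₁
  have a2 := ha.wave₂
  simp only [gCoeff_eq] at w1 w2 a1 a2
  constructor
  · intro hf
    have b1 := hf.wave₁
    have b2 := hf.wave₂
    simp only [gCoeff_eq] at b1 b2
    obtain ⟨v, hv⟩ : ∃ v : Fn A, v * τ₁ = 1 := by
      obtain ⟨u, hu⟩ := hτ.unit₁
      exact ⟨((u⁻¹ : (Fn A)ˣ) : Fn A), by rw [← hu, Units.inv_mul]⟩
    -- κ is the quotient of the difference of the two τ₁-values by τ₁; the relations with n = 0 show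
    -- that it serves for τ₀ and for its shift as well, which makes it periodic.
    obtain ⟨κ, hκ⟩ : ∃ κ, κ = (f₁ - a₁) * v := ⟨_, rfl⟩
    have hd : f₁ - a₁ = κ * τ₁ := by rw [hκ, mul_assoc, hv, mul_one]
    have e1 : ∀ n : ℕ, expD A Sum.inl (-1) n (f₀ - a₀) = κ * expD A Sum.inl (-1) n τ₀ := by
      intro n
      rw [map_sub, ← b1, ← a1, add_sub_add_left_eq_sub, ← mul_sub, hd, ← w1]
      ring
    have e2 : ∀ n : ℕ, expD A Sum.inr (-1) n (shiftFn σ (f₀ - a₀))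
        = κ * expD A Sum.inr (-1) n (shiftFn σ τ₀) := by
      intro n
      have : shiftFn σ (f₀ - a₀) = shiftFn σ f₀ - shiftFn σ a₀ := map_sub _ _ _
      rw [this, map_sub, ← b2, ← a2, add_sub_add_left_eq_sub, ← mul_sub, hd, ← w2]
      ring
    have e3 : f₀ - a₀ = κ * τ₀ := by simpa [expD_zero] using e1 0
    have e4 : shiftFn σ (f₀ - a₀) = κ * shiftFn σ τ₀ := by simpa [expD_zero] using e2 0
    have u2 : IsUnit (shiftFn σ τ₀) := hτ.unit₀.map (MvPowerSeries.map (σ : A →+* A))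
    have e5 : shiftFn σ κ = κ := by
      rw [e3] at e4
      exact u2.mul_right_cancel ((map_mul (MvPowerSeries.map (σ : A →+* A)) κ τ₀).symm.trans e4)
    have hκ0 : κ = C (coeff 0 κ) := eq_C_of_der fun i => by
      rcases i with k | k
      · exact der_eq_zero_of_expD_mul hτ.unit₀ (fun n => by rw [← e3, e1]) k
      · exact der_eq_zero_of_expD_mul u2 (fun n => by rw [← e4, e2]) k
    refine ⟨coeff 0 κ, congrArg (coeff 0) e5, ?_, ?_⟩
    · rw [smul_eq_C_mul, ← hκ0, ← e3, add_sub_cancel]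
    · rw [smul_eq_C_mul, ← hκ0, ← hd, add_sub_cancel]
  · rintro ⟨c, hc, rfl, rfl⟩
    constructor
    · intro n
      rw [gCoeff_eq, map_add, ← a1, expD_smul_const, ← w1, mul_add, mul_smul_comm, add_assoc]
    · intro n
      have : shiftFn σ (a₀ + c • τ₀) = shiftFn σ a₀ + c • shiftFn σ τ₀ := by
        rw [shiftFn, map_add, ← shiftFn, ← shiftFn, shiftFn_smul, hc]
      rw [gCoeff_eq, this, map_add, ← a2, expD_smul_const, ← w2, mul_add, mul_smul_comm, add_assoc]

end Uniqueness

/-! ### The two families of symmetries -/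

section Symmetries

theorem isTimes_inl : IsTimes Sum.inl := wt_inl

theorem isTimes_inr : IsTimes Sum.inr := wt_inr

variable {A : Type*} [CommRing A] {σ : RingAut A}

theorem shiftFn_inv_shiftFn (f : Fn A) : shiftFn σ⁻¹ (shiftFn σ f) = f := by
  ext γ
  exact σ.symm_apply_apply _

variable [Algebra ℂ A] {W₁ : (Op σ⁻¹)ˣ}
  {W₂ : (Op σ)ˣ} {τ₀ τ₁ : Fn A} {s : A}

theorem FixesScalars.inv (hσ : FixesScalars σ) : FixesScalars σ⁻¹ := fun z => by
  rw [RingAut.inv_apply, RingEquiv.symm_apply_eq, hσ]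

/-- G is linear over ℂ, so the factor m + 1 can be moved to the tau functions. -/
theorem wave_of_nsmul {ι : ℕ+ → Time} (m n : ℕ) (P u f₁ f₀ : Fn A)
    (h : (m + 1) • u + P * f₁ = gCoeff ι n f₀) :
    u + P * (((m : ℂ) + 1)⁻¹ • f₁) = gCoeff ι n (((m : ℂ) + 1)⁻¹ • f₀) := by
  have hm : (m : ℂ) + 1 ≠ 0 := Nat.cast_add_one_ne_zero m
  rw [gCoeff_eq, expD_csmul, ← gCoeff_eq, ← h, smul_add, mul_smul_comm,
    ← Nat.cast_smul_eq_nsmul ℂ, smul_smul, Nat.cast_succ, inv_mul_cancel₀ hm, one_smul]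

theorem isSolution_first (hW : IsDressing σ W₁ W₂)
    (hτ : IsTau σ (W₁ : Op σ⁻¹) (W₂ : Op σ) τ₀ τ₁) :
    IsSolution σ⁻¹ σ Sum.inl Sum.inr W₁ (W₂ : Op σ) τ₀ τ₁ where
  form := hW.form₁
  lead := hW.lead₁
  flow := hW.flow₁₁
  flow' := hW.flow₁₂
  unit := hτ.unit₁
  wave := hτ.wave₁
  wave' := hτ.wave₂

/-- Exchanging Λ with Λ⁻¹ and the two families of times preserves the structure if τ₀(s+1) takes the
place of τ₀. -/
theorem isSolution_second (hW : IsDressing σ W₁ W₂)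
    (hτ : IsTau σ (W₁ : Op σ⁻¹) (W₂ : Op σ) τ₀ τ₁) :
    IsSolution σ σ⁻¹ Sum.inr Sum.inl W₂ (W₁ : Op σ⁻¹) (shiftFn σ τ₀) τ₁ where
  form := hW.form₂
  lead := hW.lead₂
  flow := hW.flow₂₂
  flow' := hW.flow₂₁
  unit := hτ.unit₁
  wave := hτ.wave₂
  wave' n := by rw [hτ.wave₁, shiftFn_inv_shiftFn]

theorem shiftFn_csmul (hσ : FixesScalars σ) (z : ℂ) (f : Fn A) :
    shiftFn σ (z • f) = z • shiftFn σ f := by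
  rw [← algebraMap_smul A z f, shiftFn_smul, hσ, algebraMap_smul]

theorem addSymm1_wOp (hσ : FixesScalars σ) (hs : σ s = s + 1) (hW : IsDressing σ W₁ W₂)
    (hτ : IsTau σ (W₁ : Op σ⁻¹) (W₂ : Op σ) τ₀ τ₁) (m : ℕ) (l : ℤ) :
    AddSymm1 σ s W₁ W₂ τ₁ m (m + l) (((m : ℂ) + 1)⁻¹ • W1 s l (m + 1) τ₀)
      (((m : ℂ) + 1)⁻¹ • W1 (s + 1) l (m + 1) τ₁) := by
  have hs' : σ⁻¹ s = s - 1 := by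
    rw [RingAut.inv_apply, RingEquiv.symm_apply_eq, map_sub, hs, map_one, add_sub_cancel_right]
  have h := isSolution_first hW hτ
  constructor
  · intro n
    exact wave_of_nsmul m n _ _ _ _
      (h.wave_wOp isTimes_inl hσ.inv (inv_mul_cancel σ) hs' m l n)
  · intro n
    rw [shiftFn_csmul hσ]
    exact wave_of_nsmul m n _ _ _ _ (h.wave_wOp' isTimes_inl isTimes_inr (by simp) hσ.inv
      (inv_mul_cancel σ) hs' m l n)

/-- The general result is used with -s for s and τ₀(s+1) for τ₀. Undoing the shift in τ₀ turns -s
into -(s-1), and on τ₁ the parameter -s + 1 is the same, which explains why s - 1 occurs for both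
tau functions. -/
theorem addSymm2_wOp (hσ : FixesScalars σ) (hs : σ s = s + 1) (hW : IsDressing σ W₁ W₂)
    (hτ : IsTau σ (W₁ : Op σ⁻¹) (W₂ : Op σ) τ₀ τ₁) (m : ℕ) (l : ℤ) :
    AddSymm2 σ s W₁ W₂ τ₁ m (m + l) (((m : ℂ) + 1)⁻¹ • W2 (s - 1) l (m + 1) τ₀)
      (((m : ℂ) + 1)⁻¹ • W2 (s - 1) l (m + 1) τ₁) := by
  have hs' : σ (-s) = -s - 1 := by
    rw [map_neg, hs]
    ring
  have h := isSolution_second hW hτ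
  have e1 : shiftFn σ (W2 (s - 1) l (m + 1) τ₀) = wOp Sum.inr (-s) l (m + 1) (shiftFn σ τ₀) := by
    have h1 := wOp_expD_shiftFn (η := σ) isTimes_inr isTimes_inl (by simp) (-(s - 1)) l (m + 1) 0 τ₀
    rw [expD_zero, Module.End.one_apply, Module.End.one_apply, map_neg, map_sub, map_one, hs,
      add_sub_cancel_right] at h1
    exact h1
  have e2 : W2 (s - 1) l (m + 1) τ₁ = wOp Sum.inr (-s + 1) l (m + 1) τ₁ := by
    rw [W2, neg_sub, neg_add_eq_sub]
  have e3 : W2 (s - 1) l (m + 1) τ₀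
      = shiftFn σ⁻¹ (wOp Sum.inr (-s) l (m + 1) (shiftFn σ τ₀)) := by
    rw [← e1, shiftFn_inv_shiftFn]
  rw [e2]
  constructor
  · intro n
    rw [e3]
    exact wave_of_nsmul m n _ _ _ _ (h.wave_wOp' isTimes_inr isTimes_inl (by simp) hσ
      (mul_inv_cancel σ) hs' m l n)
  · intro n
    rw [shiftFn_csmul hσ, e1]
    exact wave_of_nsmul m n _ _ _ _
      (h.wave_wOp isTimes_inr hσ (mul_inv_cancel σ) hs' m l n)

theorem W2_one (t : A) (l : ℤ) (f : Fn A) :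
    W2 t l 1 f = mode A Sum.inr l f - if l = 0 then t • f else 0 := by
  rw [W2, wOp_one isTimes_inr, sub_eq_add_neg]
  split_ifs
  · rw [neg_smul]
  · rw [neg_zero]

end Symmetries

end MToda

theorem mainTheorem3 (D : Set ℂ) (hD : ∀ s : ℂ, s + 1 ∈ D ↔ s ∈ D)
    (W₁ : (MToda.Op (MToda.shift D hD)⁻¹)ˣ) (W₂ : (MToda.Op (MToda.shift D hD))ˣ)
    (hW : MToda.IsDressing (MToda.shift D hD) W₁ W₂)
    (τ₀ τ₁ : MToda.Fn (D → ℂ)) (hτ : MToda.IsTau (MToda.shift D hD) ↑W₁ ↑W₂ τ₀ τ₁) :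
    (∀ (m : ℕ) (l : ℤ) (f₀ f₁ : MToda.Fn (D → ℂ)),
      MToda.AddSymm1 (MToda.shift D hD) (MToda.coord D) W₁ W₂ τ₁ m (m + l) f₀ f₁ ↔
        ∃ c : D → ℂ, MToda.shift D hD c = c ∧
          f₀ = ((m : ℂ) + 1)⁻¹ • MToda.W1 (MToda.coord D) l (m + 1) τ₀ + c • τ₀ ∧
          f₁ = ((m : ℂ) + 1)⁻¹ • MToda.W1 (MToda.coord D + 1) l (m + 1) τ₁ + c • τ₁) ∧
    (∀ (m : ℕ) (l : ℤ) (f₀ f₁ : MToda.Fn (D → ℂ)),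
      MToda.AddSymm2 (MToda.shift D hD) (MToda.coord D) W₁ W₂ τ₁ m (m + l) f₀ f₁ ↔
        ∃ c : D → ℂ, MToda.shift D hD c = c ∧
          f₀ = ((m : ℂ) + 1)⁻¹ • MToda.W2 (MToda.coord D - 1) l (m + 1) τ₀ + c • τ₀ ∧
          f₁ = ((m : ℂ) + 1)⁻¹ • MToda.W2 (MToda.coord D - 1) l (m + 1) τ₁ + c • τ₁) ∧
    (∀ (t : D → ℂ) (l : ℤ) (f : MToda.Fn (D → ℂ)),
      MToda.W1 t l 0 f = (if l = 0 then f else 0) ∧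
      MToda.W2 t l 0 f = (if l = 0 then f else 0) ∧
      MToda.W1 t l 1 f = MToda.mode (D → ℂ) Sum.inl l f + (if l = 0 then t • f else 0) ∧
      MToda.W2 t l 1 f = MToda.mode (D → ℂ) Sum.inr l f - (if l = 0 then t • f else 0) ∧
      MToda.W1 t l 2 f =
        MToda.coeffSum (fun i : ℤ => MToda.normalPair (D → ℂ) Sum.inl i (l - i) f)
          - ((l : D → ℂ) - 2 * t + 1) • MToda.mode (D → ℂ) Sum.inl l f
          + (if l = 0 then (t * (t - 1)) • f else 0) ∧
      MToda.W2 t l 2 f =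
        MToda.coeffSum (fun i : ℤ => MToda.normalPair (D → ℂ) Sum.inr i (l - i) f)
          - ((l : D → ℂ) + 2 * t + 1) • MToda.mode (D → ℂ) Sum.inr l f
          + (if l = 0 then (t * (t + 1)) • f else 0)) := by
  have hσ : MToda.FixesScalars (MToda.shift D hD) := fun z => rfl
  have hs : MToda.shift D hD (MToda.coord D) = MToda.coord D + 1 := rfl
  refine ⟨fun m l f₀ f₁ => MToda.actsOnTau_iff hτ (MToda.addSymm1_wOp hσ hs hW hτ m l) f₀ f₁,
    fun m l f₀ f₁ => MToda.actsOnTau_iff hτ (MToda.addSymm2_wOp hσ hs hW hτ m l) f₀ f₁,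
    fun t l f => ⟨MToda.wOp_zero MToda.isTimes_inl t l f, MToda.wOp_zero MToda.isTimes_inr (-t) l f,
      MToda.wOp_one MToda.isTimes_inl t l f, MToda.W2_one t l f,
      MToda.wOp_two MToda.isTimes_inl t l f, ?_⟩⟩
  rw [MToda.W2, MToda.wOp_two MToda.isTimes_inr, mul_neg, sub_neg_eq_add]
  congr 3
  ring
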